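/- **Setting.** Let $x_1,\dots,x_n\in\mathbb R^d$ and $Q\ge1$ with $nQ\ge2$, $d\ge1$, $0<\varepsilon<1$, and let $0<lo\le hi$ be a range of distances with $\log(hi/lo)\le\varepsilon\,(nQ)^{b}$. A query is a pair $(y,i)$ with $y\in\mathbb R^d$, $i\in[n]$. In each of $Q$ rounds an adversary, who knows the data set and all parameters and may be randomized, chooses a query depending on all previous queries and answers, and receives the algorithm's answer. **Algorithm.** Put $m=\lceil C_m/\varepsilon^2\rceil$, $k=\lceil C_k\log(nQ)\rceil$, $r=\lceil C_r\sqrt Q\log^2(nQ)\rceil+1$. Draw independent random matrices $\Pi_1,\dots,\Pi_r\in\mathbb R^{m\times d}$ and store all vectors $\Pi_jx_i$. To answer $(y,i)$, draw $S_1,\dots,S_k$ independently and uniformly from $[r]$, compute the estimates $\|\Pi_{S_j}x_i-\Pi_{S_j}y\|_2$, round each of them up to the finite set $U=\{0\}\cup\{lo\,(1+\varepsilon/4)^l:0\le l\le M\}$ with $M=\lceil\log(hi/lo)/\log(1+\varepsilon/4)\rceil+1$ (to $\max U$ if it exceeds it), and return the $(1,0)$-differentially private median of the rounded values: the exponential mechanism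 that returns $u\in U$ with probability proportional to $e^{s(u)/2}$, where $s(u)$ is the minimum of the number of values $\le u$ and the number of values $\ge u$. The matrices $\Pi_j$ are either * *Gaussian JL*: $\Pi=G/\sqrt m$ with independent standard Gaussian entries of $G$; or * *fast JL* (subsampled randomized Hadamard transform): pad the vector with zeros to length $D=2^{\lceil\log_2d\rceil}$, multiply its coordinates by independent uniform signs, apply the Hadamard matrix $H_D\in\{\pm1\}^{D\times D}$, keep $m$ independent uniformly random coordinates and divide by $\sqrt m$. **Cost.** Query time is the worst-case number of steps of a randomized computation tree over the reals which, for every content of its read-only memory, produces exactly the answer distribution of the algorithm. Its unit-cost instructions are: loading a constant; reading a coordinate of $y$, a stored word, or a cell of the random tape that describes $\Pi_1,\dots,\Pi_r$; $+,-,\times,/,\sqrt{\cdot},\log$; comparing two registers; rounding a register up to an integer and branching on it; drawing a uniformly random index; tossing a coin with given bias. Space is the number of stored words (real numbers), i.e. the coordinates of all $\Pi_jx_i$; the random tape is not counted. **Theorem.** For all $b,c\in\mathbb N$ there are constants $C_m,C_k,C_r,C_T,C_S>0$, depending only on $b$ and $c$, such that for all $n,Q,d,\varepsilon,lo,hi$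 as above, for all data sets and all adversaries, the following holds for Gaussian JL, and for $d\ge2$ also for fast JL. 1. With probability at least $1-(nQ)^{-c}$, every one of the $Q$ queries $(y_q,i_q)$ whose true distance $\|x_{i_q}-y_q\|_2$ is $0$ or lies in $[lo,hi]$ receives an answer $d_q$ with $$(1-\varepsilon)\|x_{i_q}-y_q\|_2\le d_q\le(1+\varepsilon)\|x_{i_q}-y_q\|_2.$$ 2. With fast JL, the query time is at most $C_T\left(\frac{\log d}{\varepsilon^2}+d\log d\right)\log(nQ)$ and the space is at most $C_S\,\frac{n\sqrt Q\log^3(nQ)}{\varepsilon^2}$ words. 3. With Gaussian JL, the query time is at most $C_T\,\frac{d\log(nQ)}{\varepsilon^2}$ and the space is at most $C_S\,\frac{n\sqrt Q\log^2(nQ)}{\varepsilon^2}$ words. -/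

import Mathlib

/-!
Adaptive distance estimation with private medians of Johnson-Lindenstrauss sketches:
random linear sketches, the private median, the query algorithm, the game with an adaptive
adversary, and a step-counting machine model.
-/

open MeasureTheory ProbabilityTheory
open scoped ENNReal NNReal

noncomputable section

namespace AdaptiveDistance

/-! ## Random linear sketches -/

/-- A family of random maps `ℝ^d → ℝ^m`. One random matrix is described by the content of finitely
many cells of a random tape; `law` is the distribution of that content and `sketch` applies the
matrix it describes to a vector. -/
structure SketchFamily (d m : ℕ) where
  Cell : Type
  law : Measure (Cell → ℝ)
  sketch : (Cell → ℝ) → EuclideanSpace ℝ (Fin d) → EuclideanSpace ℝ (Fin m)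

/-- The Gaussian Johnson-Lindenstrauss transform: `Π = G / √m`, where `G` is an `m × d` matrix with
independent standard Gaussian entries. -/
def gaussianJL (d m : ℕ) : SketchFamily d m where
  Cell := Fin m × Fin d
  law := Measure.pi fun _ => gaussianReal 0 1
  sketch g x := WithLp.toLp 2 fun t => (√(m : ℝ))⁻¹ * ∑ l : Fin d, g (t, l) * x l

/-- The entry in row `a`, column `b` of the `2^L × 2^L` Hadamard matrix
`H_{2D} = [[H_D, H_D], [H_D, -H_D]]`, `H_1 = [1]` (rows and columns numbered from `0`). -/
def hadamardEntry : ℕ → ℕ → ℕ → ℝ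
  | 0, _, _ => 1
  | L + 1, a, b =>
      (if a.testBit L && b.testBit L then -1 else 1) * hadamardEntry L a b

/-- The fast Johnson-Lindenstrauss transform (subsampled randomized Hadamard transform). Vectors are
padded with zeros to length `D = 2^L`, `L = ⌈log₂ d⌉`; the coordinates are multiplied by independent
uniform signs; the Hadamard matrix is applied; and `m` independent uniformly random coordinates,
scaled by `1 / √m`, are kept. The tape holds the `d` signs and the `m` row numbers. -/
def fastJL (d m : ℕ) : SketchFamily d m where
  Cell := Fin d ⊕ Fin m
  law := Measure.pi fun c => Sum.elim
    (fun _ : Fin d => uniformOn ({1, -1} : Set ℝ))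
    (fun _ : Fin m => uniformOn (Set.range fun a : Fin (2 ^ Nat.clog 2 d) => ((a : ℕ) : ℝ))) c
  sketch g x := WithLp.toLp 2 fun t =>
    (√(m : ℝ))⁻¹ * ∑ l : Fin d, hadamardEntry (Nat.clog 2 d) ⌈g (.inr t)⌉₊ l * g (.inl l) * x l

/-! ## The private median -/

/-- How well `u` splits the database `v`: the smaller one of the numbers of elements that are at
most `u` and at least `u`. -/
def medianScore {k N : ℕ} (v : Fin k → Fin N) (u : Fin N) : ℕ :=
  min (Finset.univ.filter fun j => v j ≤ u).card (Finset.univ.filter fun j => u ≤ v j).card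

/-- The unnormalized probability `exp (score / 2)` of `u` in the exponential mechanism. -/
def medianWeight {k N : ℕ} (v : Fin k → Fin N) (u : Fin N) : ℝ≥0∞ :=
  ENNReal.ofReal (Real.exp ((medianScore v u : ℝ) / 2))

theorem medianWeight_tsum_ne_zero {k N : ℕ} [NeZero N] (v : Fin k → Fin N) :
    (∑' u, medianWeight v u) ≠ 0 := by
  intro h
  have h0 := ENNReal.tsum_eq_zero.1 h 0
  simp only [medianWeight, ENNReal.ofReal_eq_zero] at h0
  exact absurd h0 (not_le.2 (Real.exp_pos _))

theorem medianWeight_tsum_ne_top {k N : ℕ} (v : Fin k → Fin N) :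
    (∑' u, medianWeight v u) ≠ ∞ := by
  rw [tsum_fintype]
  exact ENNReal.sum_ne_top.2 fun u _ => ENNReal.ofReal_ne_top

/-- The private median of a database over the finite ordered universe `Fin N`: the exponential
mechanism with privacy parameter `1` for `medianScore`. -/
def privMed {k N : ℕ} [NeZero N] (v : Fin k → Fin N) : PMF (Fin N) :=
  PMF.normalize (medianWeight v) (medianWeight_tsum_ne_zero v) (medianWeight_tsum_ne_top v)

/-- A mechanism on databases with `k` rows is `(ε, 0)`-differentially private. -/
def IsPureDP {α β : Type*} {k : ℕ} (ε : ℝ) (M : (Fin k → α) → PMF β) : Prop :=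
  ∀ v w : Fin k → α, (∃ j, ∀ i, i ≠ j → v i = w i) →
    ∀ E : Set β, (M v).toOuterMeasure E ≤ ENNReal.ofReal (Real.exp ε) * (M w).toOuterMeasure E

theorem medianScore_le_succ {k N : ℕ} {v w : Fin k → Fin N} (h : ∃ j, ∀ i, i ≠ j → v i = w i)
    (u : Fin N) : medianScore v u ≤ medianScore w u + 1 := by
  obtain ⟨j, hj⟩ := h
  have key : ∀ p : Fin N → Prop, ∀ _ : DecidablePred p,
      (Finset.univ.filter fun i => p (v i)).card
        ≤ (Finset.univ.filter fun i => p (w i)).card + 1 := by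
    intro p _
    refine (Finset.card_le_card (t := insert j (Finset.univ.filter fun i => p (w i))) ?_).trans
      (Finset.card_insert_le _ _)
    intro i hi
    by_cases hij : i = j
    · simp [hij]
    · simp only [Finset.mem_filter, Finset.mem_univ, true_and] at hi
      simp [hij, ← hj i hij, hi]
  have h1 := key (fun z => z ≤ u) inferInstance
  have h2 := key (fun z => u ≤ z) inferInstance
  simp only [medianScore]
  omega

theorem medianWeight_le {k N : ℕ} {v w : Fin k → Fin N} (h : ∃ j, ∀ i, i ≠ j → v i = w i)
    (u : Fin N) : medianWeight v u ≤ ENNReal.ofReal (Real.exp (1 / 2)) * medianWeight w u := by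
  rw [medianWeight, medianWeight, ← ENNReal.ofReal_mul (Real.exp_pos _).le, ← Real.exp_add]
  refine ENNReal.ofReal_le_ofReal (Real.exp_le_exp.2 ?_)
  have := medianScore_le_succ h u
  have h' : (medianScore v u : ℝ) ≤ medianScore w u + 1 := by exact_mod_cast this
  linarith

/-- The private median is `(1, 0)`-differentially private. -/
theorem privMed_isPureDP {k N : ℕ} [NeZero N] :
    IsPureDP 1 (privMed : (Fin k → Fin N) → PMF (Fin N)) := by
  intro v w h E
  have h' : ∃ j, ∀ i, i ≠ j → w i = v i := h.imp fun j hj i hi => (hj i hi).symm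
  set c := ENNReal.ofReal (Real.exp (1 / 2)) with hc
  have hc0 : c ≠ 0 := by simp [hc, Real.exp_pos]
  have hct : c ≠ ∞ := ENNReal.ofReal_ne_top
  have hcc : ENNReal.ofReal (Real.exp 1) = c * c := by
    rw [hc, ← ENNReal.ofReal_mul (Real.exp_pos _).le, ← Real.exp_add]; norm_num
  have hsum : (∑' u, medianWeight w u) ≤ c * ∑' u, medianWeight v u := by
    rw [← ENNReal.tsum_mul_left]
    exact ENNReal.tsum_le_tsum fun u => medianWeight_le h' u
  have hinv : (∑' u, medianWeight v u)⁻¹ ≤ c * (∑' u, medianWeight w u)⁻¹ := by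
    have := ENNReal.inv_le_inv.2 hsum
    rw [ENNReal.mul_inv (Or.inl hc0) (Or.inl hct)] at this
    calc (∑' u, medianWeight v u)⁻¹ = c * (c⁻¹ * (∑' u, medianWeight v u)⁻¹) := by
          rw [← mul_assoc, ENNReal.mul_inv_cancel hc0 hct, one_mul]
      _ ≤ _ := by gcongr
  have hpt : ∀ u, privMed v u ≤ ENNReal.ofReal (Real.exp 1) * privMed w u := by
    intro u
    rw [privMed, privMed, PMF.normalize_apply, PMF.normalize_apply, hcc]
    calc _ ≤ (c * medianWeight w u) * (c * (∑' u, medianWeight w u)⁻¹) :=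
          mul_le_mul' (medianWeight_le h u) hinv
      _ = _ := by ring
  rw [PMF.toOuterMeasure_apply, PMF.toOuterMeasure_apply, ← ENNReal.tsum_mul_left]
  refine ENNReal.tsum_le_tsum fun u => ?_
  by_cases hu : u ∈ E <;> simp [hu, hpt u]

/-! ## The data structure and its answers -/

/-- The finite set of answers `{0} ∪ {lo (1 + ε/4)^l : 0 ≤ l ≤ M}` is indexed by
`Fin (M + 2)`; the largest answer is at least `(1 + ε/4) hi`. This is `M`. -/
def gridLevels (ε lo hi : ℝ) : ℕ :=
  ⌈Real.log (hi / lo) / Real.log (1 + ε / 4)⌉₊ + 1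

/-- The answer with index `u`. -/
def gridValue (ε lo : ℝ) {M : ℕ} (u : Fin (M + 2)) : ℝ :=
  if (u : ℕ) = 0 then 0 else lo * (1 + ε / 4) ^ ((u : ℕ) - 1)

/-- The index of the smallest answer that is at least `s` (of the largest answer, if there is no
such answer). -/
def gridIndex (ε lo : ℝ) (M : ℕ) (s : ℝ) : Fin (M + 2) :=
  if s ≤ 0 then 0
  else ⟨min (⌈Real.log (s / lo) / Real.log (1 + ε / 4)⌉₊ + 1) (M + 1), by omega⟩

/-- The address of a stored word: sketch `j`, data point `i`, coordinate `t`. -/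
abbrev StoredWord (r n m : ℕ) : Type := Fin r × Fin n × Fin m

/-- What the data structure stores about the data set: all coordinates of all `Π_j x_i`. -/
def build {d m r n : ℕ} (F : SketchFamily d m) (tape : Fin r × F.Cell → ℝ)
    (x : Fin n → EuclideanSpace ℝ (Fin d)) : StoredWord r n m → ℝ :=
  fun a => F.sketch (fun c => tape (a.1, c)) (x a.2.1) a.2.2

/-- A query: a point `y` and the index `i` of a data point. -/
abbrev Query (d n : ℕ) : Type := EuclideanSpace ℝ (Fin d) × Fin n

/-- The distance estimate `‖Π_j x_i - Π_j y‖` obtained from sketch `j`. -/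
def estimate {d m r n : ℕ} (F : SketchFamily d m) (tape : Fin r × F.Cell → ℝ)
    (store : StoredWord r n m → ℝ) (q : Query d n) (j : Fin r) : ℝ :=
  ‖(WithLp.toLp 2 fun t => store (j, q.2, t)) - F.sketch (fun c => tape (j, c)) q.1‖

/-- The distribution of the answer to one query, given the tape with the random matrices and the
stored words: draw `k` of the `r` sketches uniformly with replacement, round their distance
estimates to the finite set of possible answers, and return the private median. -/
def respond {d m r n : ℕ} [NeZero r] (F : SketchFamily d m) (k : ℕ) (ε lo hi : ℝ)
    (tape : Fin r × F.Cell → ℝ) (store : StoredWord r n m → ℝ) (q : Query d n) : PMF ℝ :=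
  (PMF.uniformOfFintype (Fin k → Fin r)).bind fun S =>
    (privMed fun j => gridIndex ε lo (gridLevels ε lo hi) (estimate F tape store q (S j))).map
      (gridValue ε lo)

/-! ## The game with an adaptive adversary -/

/-- The random transcript (queries and answers, oldest first) of the first `t` rounds, if the
adversary computes each query from the preceding transcript, and each answer is drawn from `resp`
with fresh randomness. -/
def transcript {𝒬 : Type*} (resp : 𝒬 → PMF ℝ) (adv : List (𝒬 × ℝ) → 𝒬) :
    ℕ → PMF (List (𝒬 × ℝ))
  | 0 => PMF.pure []
  | t + 1 => (transcript resp adv t).bind fun h =>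
      (resp (adv h)).map fun a => h ++ [(adv h, a)]

/-- The transcripts in which each query whose true distance is `0` or lies in `[lo, hi]` is answered
within a factor `1 ± ε`. -/
def accurate {d n : ℕ} (ε lo hi : ℝ) (x : Fin n → EuclideanSpace ℝ (Fin d)) :
    Set (List (Query d n × ℝ)) :=
  {h | ∀ e ∈ h, (‖x e.1.2 - e.1.1‖ = 0 ∨ lo ≤ ‖x e.1.2 - e.1.1‖ ∧ ‖x e.1.2 - e.1.1‖ ≤ hi) →
    (1 - ε) * ‖x e.1.2 - e.1.1‖ ≤ e.2 ∧ e.2 ≤ (1 + ε) * ‖x e.1.2 - e.1.1‖}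

/-- The probability that all answers in `Q` rounds are accurate. The adversary holds a random seed
`θ` of law `ρ` of its own, independent of the randomness of the data structure. -/
def successProb {d m r n : ℕ} [NeZero r] (F : SketchFamily d m) (k Q : ℕ) (ε lo hi : ℝ)
    (x : Fin n → EuclideanSpace ℝ (Fin d)) {Θ : Type*} [MeasurableSpace Θ] (ρ : Measure Θ)
    (adv : Θ → List (Query d n × ℝ) → Query d n) : ℝ≥0∞ :=
  ∫⁻ θ, ∫⁻ tape : Fin r → F.Cell → ℝ,
    (transcript (respond F k ε lo hi (fun c => tape c.1 c.2)
        (build F (fun c => tape c.1 c.2) x)) (adv θ) Q).toOuterMeasure (accurate ε lo hi x)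
    ∂(Measure.pi fun _ => F.law) ∂ρ

/-! ## Running time

Programs are randomized computation trees over the reals with registers numbered by `ℕ`, initially
`0`, and read-only memory cells with addresses in `ι`. Each instruction costs one step. -/

/-- Binary arithmetic instructions. -/
inductive BinOp
  | add | sub | mul | div

/-- Unary instructions. -/
inductive UnOp
  | sqrt | log

def BinOp.eval : BinOp → ℝ → ℝ → ℝ
  | .add, a, b => a + b
  | .sub, a, b => a - b
  | .mul, a, b => a * b
  | .div, a, b => a / b

def UnOp.eval : UnOp → ℝ → ℝ
  | .sqrt, a => Real.sqrt a
  | .log, a => Real.log a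

/-- Programs. `a`, `b` are registers that are read, `dst` is the register that is written. -/
inductive Prog (ι : Type) : Type
  /-- Stop and output the content of register `a`. -/
  | ret (a : ℕ) : Prog ι
  /-- Write a constant. -/
  | const (dst : ℕ) (c : ℝ) (next : Prog ι) : Prog ι
  /-- Read a memory cell. -/
  | load (dst : ℕ) (i : ι) (next : Prog ι) : Prog ι
  | bin (dst : ℕ) (o : BinOp) (a b : ℕ) (next : Prog ι) : Prog ι
  | un (dst : ℕ) (o : UnOp) (a : ℕ) (next : Prog ι) : Prog ι
  /-- Branch on whether register `a` is at most register `b`. -/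
  | ifLE (a b : ℕ) (yes no : Prog ι) : Prog ι
  /-- Round register `a` up to an integer, and branch on that integer. -/
  | ceil (a : ℕ) (next : ℤ → Prog ι) : Prog ι
  /-- Branch on a uniformly random number in `{0, …, N}`. -/
  | draw (N : ℕ) (next : Fin (N + 1) → Prog ι) : Prog ι
  /-- Branch on a coin whose probability of heads is the content of register `a`, truncated to
  `[0, 1]`. -/
  | coin (a : ℕ) (heads tails : Prog ι) : Prog ι

/-- A coin that shows heads (`true`) with probability `p`, truncated to `[0, 1]`. -/
def biasedCoin (p : ℝ) : PMF Bool :=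
  PMF.ofFintype (fun z => if z then min (ENNReal.ofReal p) 1 else 1 - min (ENNReal.ofReal p) 1)
    (by simp)

/-- The distribution of the output, given the memory and the content of the registers. -/
def Prog.eval {ι : Type} : Prog ι → (ι → ℝ) → (ℕ → ℝ) → PMF ℝ
  | .ret a, _, reg => PMF.pure (reg a)
  | .const dst c p, mem, reg => p.eval mem (Function.update reg dst c)
  | .load dst i p, mem, reg => p.eval mem (Function.update reg dst (mem i))
  | .bin dst o a b p, mem, reg => p.eval mem (Function.update reg dst (o.eval (reg a) (reg b)))
  | .un dst o a p, mem, reg => p.eval mem (Function.update reg dst (o.eval (reg a)))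
  | .ifLE a b p q, mem, reg => open Classical in
      if reg a ≤ reg b then p.eval mem reg else q.eval mem reg
  | .ceil a f, mem, reg => (f ⌈reg a⌉).eval mem reg
  | .draw N f, mem, reg =>
      (PMF.uniformOfFintype (Fin (N + 1))).bind fun z => (f z).eval mem reg
  | .coin a p q, mem, reg =>
      (biasedCoin (reg a)).bind fun z => if z then p.eval mem reg else q.eval mem reg

/-- Each run of the program takes at most `T` steps. -/
def Prog.StepsLE {ι : Type} : Prog ι → ℕ → Prop
  | .ret _, _ => True
  | .const _ _ p, T + 1 => p.StepsLE T
  | .load _ _ p, T + 1 => p.StepsLE T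
  | .bin _ _ _ _ p, T + 1 => p.StepsLE T
  | .un _ _ _ p, T + 1 => p.StepsLE T
  | .ifLE _ _ p q, T + 1 => p.StepsLE T ∧ q.StepsLE T
  | .ceil _ f, T + 1 => ∀ z, (f z).StepsLE T
  | .draw _ f, T + 1 => ∀ z, (f z).StepsLE T
  | .coin _ p q, T + 1 => p.StepsLE T ∧ q.StepsLE T
  | _, 0 => False

/-- While it answers a query, the algorithm can read the coordinates of the query point, the stored
words and the tape with the random matrices, but not the data set. -/
abbrev Address {d m : ℕ} (F : SketchFamily d m) (r n : ℕ) : Type :=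
  Fin d ⊕ StoredWord r n m ⊕ (Fin r × F.Cell)

/-- Queries `(y, i)` are answered with exactly the distribution `respond` by a program that takes
at most `T` steps; the program depends on the parameters and on `i`, but on no real input. -/
def QueryTimeLE {d m : ℕ} (F : SketchFamily d m) (r n k : ℕ) [NeZero r] (ε lo hi : ℝ) (T : ℝ) :
    Prop :=
  ∃ (P : Fin n → Prog (Address F r n)) (t : ℕ), (t : ℝ) ≤ T ∧ (∀ i, (P i).StepsLE t) ∧
    ∀ (tape : Fin r × F.Cell → ℝ) (store : StoredWord r n m → ℝ) (q : Query d n),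
      (P q.2).eval (Sum.elim (fun l => q.1 l) (Sum.elim store tape)) (fun _ => 0)
        = respond F k ε lo hi tape store q

/-! ## The parameters of the construction -/

/-- The number `m = O(1 / ε²)` of rows of a sketch. -/
def numRows (C ε : ℝ) : ℕ := ⌈C / ε ^ 2⌉₊

/-- The number `k = O(log (n Q))` of sketches that are used for one query. -/
def numSamples (C : ℝ) (n Q : ℕ) : ℕ := ⌈C * Real.log (n * Q)⌉₊

/-- The number `r = O(√Q log² (n Q))` of sketches. -/
def numSketches (C : ℝ) (n Q : ℕ) : ℕ := ⌈C * √(Q : ℝ) * Real.log (n * Q) ^ 2⌉₊ + 1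

instance (C : ℝ) (n Q : ℕ) : NeZero (numSketches C n Q) := ⟨Nat.succ_ne_zero _⟩

/-- The number of words that the data structure stores. -/
def storedWords (r n m : ℕ) : ℕ := Fintype.card (StoredWord r n m)

end AdaptiveDistance

end

noncomputable section

namespace AdaptiveDistance

/-! ## Straight-line code -/

/-! Accuracy. A single sketch preserves the norm of one fixed vector within the required precision
except with a small constant probability `p`. This is Chebyshev's inequality with fourth moments, so
`m = O(1/ε²)` rows suffice (`isGoodSketch_gaussianJL`, `isGoodSketch_fastJL`). Call a sketch bad for
a query `(y, i)` if it distorts `x i - y` by more. While at most a quarter of the `r` sketches are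
bad for the current query, the private median of `k` samples is inaccurate with probability at most
`N e^(-k/16)`, where `N` is the number of grid points (`sum_answer_inaccurate_le`). What remains is
to show that an adaptive adversary hardly ever finds a query with more than `r/4` bad sketches.

Fix a set `J` of `ℓ` sketches. If the answers ignored `J`, the next query would be independent of
these sketches, and all of them would be bad with probability at most `p^ℓ`. Replacing the sketches
in `J` by a constant changes the probability of each answer by a factor of at most `C = e^(3ℓk/r)`,
because the median is 1-private and a sample hits `J` with probability `ℓ/r`
(`answer_le_of_differ`). Multiplying `C` over the rounds would force `r` to grow like `Q`. Second
moments are compared instead: by Cauchy-Schwarz one round costs only `1 + χ² ≤ 1 + (C-1)²`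
(`sq_sum_mul_le_of_ratio`, `expect_sq_le`), and for `r` of order `√Q ℓ k` all `Q` rounds together
cost a constant. Hence all of `J` is bad with probability at most about `p^(ℓ/2)`
(`sq_lintegral_expect_all_bad_le`). More than `r/4` bad sketches contain at least a fraction
`8^(-ℓ)` of all `ℓ`-sets, so averaging over `J` costs a factor `8^ℓ`
(`lintegral_expect_many_bad_le`), which a small enough `p` absorbs, leaving `e^(-ℓ)`. Taking `ℓ` of
order `log (nQ)`, a union bound over the rounds concludes (`successProb_ge`).

Time. The program repeats `k` times: draw a sketch, compute its estimate, branch on the grid index.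
After these branches the position in the tree determines all rounded values, so the weights of the
median are constants there, and a binary tree of biased coins of depth `O(log N)` samples it
exactly. An estimate takes `O(md)` steps for the Gaussian matrix, and `O(D log D + m)` for the fast
transform by the Hadamard recursion. Space is the product `r n m`. -/

theorem Prog.StepsLE.mono {ι : Type} {p : Prog ι} {s t : ℕ} (h : p.StepsLE s) (hst : s ≤ t) :
    p.StepsLE t := by
  induction p generalizing s t with
  | ret a => simp [Prog.StepsLE]
  | _ =>
    obtain _ | s := s
    · simp [Prog.StepsLE] at h
    obtain _ | t := t
    · omega
    simp only [Prog.StepsLE] at h ⊢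
    grind

/-- The code `c`, followed by any program `p`, makes at most `T` steps and then runs `p` on register
contents that are in the relation `R` with the initial ones. -/
structure Runs {ι : Type} (c : Prog ι → Prog ι) (T : ℕ)
    (R : (ι → ℝ) → (ℕ → ℝ) → (ℕ → ℝ) → Prop) : Prop where
  eval : ∀ mem reg, ∃ reg', R mem reg reg' ∧ ∀ p, (c p).eval mem reg = p.eval mem reg'
  steps : ∀ p s, p.StepsLE s → (c p).StepsLE (s + T)

namespace Runs

variable {ι : Type} {c c' : Prog ι → Prog ι} {T T' : ℕ}
  {R R' : (ι → ℝ) → (ℕ → ℝ) → (ℕ → ℝ) → Prop}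

theorem imp (h : Runs c T R) (hT : T ≤ T') (hR : ∀ mem reg reg', R mem reg reg' → R' mem reg reg') :
    Runs c T' R' where
  eval mem reg := by
    obtain ⟨reg', h1, h2⟩ := h.eval mem reg
    exact ⟨reg', hR _ _ _ h1, h2⟩
  steps p s hp := (h.steps p s hp).mono (by omega)

theorem seq (h : Runs c T R) (h' : Runs c' T' R') :
    Runs (fun p => c (c' p)) (T + T')
      (fun mem reg reg'' => ∃ reg', R mem reg reg' ∧ R' mem reg' reg'') where
  eval mem reg := by
    obtain ⟨reg', h1, h2⟩ := h.eval mem reg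
    obtain ⟨reg'', h3, h4⟩ := h'.eval mem reg'
    exact ⟨reg'', ⟨reg', h1, h3⟩, fun p => by rw [h2, h4]⟩
  steps p s hp := (h.steps _ _ (h'.steps p s hp)).mono (by omega)

theorem nil : Runs (ι := ι) (fun p => p) 0 (fun _ reg reg' => reg' = reg) where
  eval _ reg := ⟨reg, rfl, fun _ => rfl⟩
  steps _ _ hp := hp

theorem const (dst : ℕ) (a : ℝ) :
    Runs (ι := ι) (Prog.const dst a) 1 (fun _ reg reg' => reg' = Function.update reg dst a) where
  eval _ _ := ⟨_, rfl, fun _ => rfl⟩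
  steps _ _ hp := hp

theorem load (dst : ℕ) (i : ι) :
    Runs (Prog.load dst i) 1 (fun mem reg reg' => reg' = Function.update reg dst (mem i)) where
  eval _ _ := ⟨_, rfl, fun _ => rfl⟩
  steps _ _ hp := hp

theorem bin (dst : ℕ) (o : BinOp) (a b : ℕ) :
    Runs (ι := ι) (Prog.bin dst o a b) 1
      (fun _ reg reg' => reg' = Function.update reg dst (o.eval (reg a) (reg b))) where
  eval _ _ := ⟨_, rfl, fun _ => rfl⟩
  steps _ _ hp := hp

theorem un (dst : ℕ) (o : UnOp) (a : ℕ) :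
    Runs (ι := ι) (Prog.un dst o a) 1
      (fun _ reg reg' => reg' = Function.update reg dst (o.eval (reg a))) where
  eval _ _ := ⟨_, rfl, fun _ => rfl⟩
  steps _ _ hp := hp

/-- Branching on an integer, with code that may depend on it. -/
theorem ceil (a : ℕ) {c : ℤ → Prog ι → Prog ι}
    {R : ℤ → (ι → ℝ) → (ℕ → ℝ) → (ℕ → ℝ) → Prop} (h : ∀ z, Runs (c z) T (R z)) :
    Runs (fun p => Prog.ceil a fun z => c z p) (T + 1)
      (fun mem reg reg' => R ⌈reg a⌉ mem reg reg') where
  eval mem reg := by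
    obtain ⟨reg', h1, h2⟩ := (h ⌈reg a⌉).eval mem reg
    exact ⟨reg', h1, fun p => by rw [← h2]; rfl⟩
  steps p s hp := fun z => (h z).steps p s hp

/-- A loop with invariant `I`. -/
theorem loop (I : ℕ → (ι → ℝ) → (ℕ → ℝ) → (ℕ → ℝ) → Prop) (h0 : ∀ mem reg, I 0 mem reg reg)
    (n : ℕ) (body : ∀ i < n, ∃ c, Runs c T fun mem reg reg' => ∀ reg₀, I i mem reg₀ reg →
      I (i + 1) mem reg₀ reg') :
    ∃ c : Prog ι → Prog ι, Runs c (n * T) (I n) := by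
  induction n with
  | zero =>
    refine ⟨_, nil.imp (by omega) ?_⟩
    rintro mem reg reg' rfl
    exact h0 mem reg'
  | succ n ih =>
    obtain ⟨c, hc⟩ := ih fun i hi => body i (by omega)
    obtain ⟨c', hc'⟩ := body n (by omega)
    refine ⟨_, (hc.seq hc').imp (by rw [Nat.succ_mul]) ?_⟩
    rintro mem reg reg'' ⟨reg', h1, h2⟩
    exact h2 _ h1

end Runs

/-! ## Sampling from a finite distribution -/

/-- A distribution with positive weights on a set of at most `2 ^ L` elements can be sampled by a
binary tree of coins. -/
theorem exists_sampler {ι α : Type} [DecidableEq α] (g : α → ℝ) (w : α → ℝ≥0∞)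
    (hw0 : ∀ a, w a ≠ 0) (hwt : ∀ a, w a ≠ ∞) (L : ℕ) (s : Finset α) (hs : s.Nonempty)
    (hL : s.card ≤ 2 ^ L) :
    ∃ P : Prog ι, P.StepsLE (2 * L + 1) ∧ ∀ mem reg y, P.eval mem reg y
      = ∑ a ∈ s, (if y = g a then w a else 0) / ∑ a ∈ s, w a := by
  induction L generalizing s with
  | zero =>
    obtain ⟨a, rfl⟩ := Finset.card_eq_one.1 (le_antisymm (by simpa using hL) hs.card_pos)
    refine ⟨.const 0 (g a) (.ret 0), by simp [Prog.StepsLE], fun mem reg y => ?_⟩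
    by_cases h : y = g a
    · simp [Prog.eval, h, ENNReal.div_self (hw0 a) (hwt a)]
    · simp [Prog.eval, h]
  | succ L ih =>
    by_cases hc : s.card ≤ 2 ^ L
    · obtain ⟨P, hP, h⟩ := ih s hs hc
      exact ⟨P, hP.mono (by omega), h⟩
    push Not at hc
    -- Split off exactly `2 ^ L` elements; the rest has at most `2 ^ L` too. A coin biased by the
    -- total weights picks the part, and the recursive trees sample the conditional laws.
    obtain ⟨s₁, h₁s, h₁c⟩ := Finset.exists_subset_card_eq (s := s) hc.le
    have h₁ : s₁.Nonempty := Finset.card_pos.1 (by rw [h₁c]; positivity)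
    have hcd := Finset.card_sdiff_add_card_eq_card h₁s
    have h₂ : (s \ s₁).Nonempty := Finset.card_pos.1 (by omega)
    obtain ⟨P₁, hP₁, e₁⟩ := ih s₁ h₁ h₁c.le
    obtain ⟨P₂, hP₂, e₂⟩ := ih (s \ s₁) h₂ (by rw [pow_succ] at hL; omega)
    have hne : ∀ s : Finset α, s.Nonempty → (∑ a ∈ s, w a) ≠ 0 := fun s ⟨a, ha⟩ h =>
      hw0 a (Finset.sum_eq_zero_iff.1 h a ha)
    have hnt : ∀ s : Finset α, (∑ a ∈ s, w a) ≠ ∞ := fun s => ENNReal.sum_ne_top.2 fun a _ => hwt a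
    set W₁ := ∑ a ∈ s₁, w a with hW₁
    set W₂ := ∑ a ∈ s \ s₁, w a with hW₂
    have hsum : ∀ f : α → ℝ≥0∞, ∑ a ∈ s, f a = ∑ a ∈ s₁, f a + ∑ a ∈ s \ s₁, f a := fun f => by
      rw [add_comm, Finset.sum_sdiff h₁s]
    have hW : ∑ a ∈ s, w a = W₁ + W₂ := hsum w
    have hW0 : W₁ + W₂ ≠ 0 := hW ▸ hne s hs
    have hWt : W₁ + W₂ ≠ ∞ := hW ▸ hnt s
    have hp1 : W₁ / (W₁ + W₂) ≤ 1 := ENNReal.div_le_of_le_mul (by simp)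
    have hp2 : 1 - W₁ / (W₁ + W₂) = W₂ / (W₁ + W₂) := by
      refine ENNReal.sub_eq_of_eq_add (ne_top_of_le_ne_top ENNReal.one_ne_top hp1) ?_
      rw [← ENNReal.add_div, add_comm, ENNReal.div_self hW0 hWt]
    refine ⟨.const 0 (W₁ / (W₁ + W₂)).toReal (.coin 0 P₁ P₂), ⟨hP₁, hP₂⟩, fun mem reg y => ?_⟩
    have hof : min (ENNReal.ofReal (W₁ / (W₁ + W₂)).toReal) 1 = W₁ / (W₁ + W₂) := by
      rw [ENNReal.ofReal_toReal (ne_top_of_le_ne_top ENNReal.one_ne_top hp1), min_eq_left hp1]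
    simp only [Prog.eval, Function.update_self, PMF.bind_apply, tsum_fintype, Fintype.sum_bool,
      biasedCoin, PMF.ofFintype_apply, if_true, hof, hp2, e₁, e₂, Bool.false_eq_true, if_false]
    rw [hW, hsum, Finset.mul_sum, Finset.mul_sum]
    have key : ∀ (A x : ℝ≥0∞), A ≠ 0 → A ≠ ∞ → A / (W₁ + W₂) * (x / A) = x / (W₁ + W₂) := by
      intro A x hA hA'
      rw [div_eq_mul_inv, div_eq_mul_inv, div_eq_mul_inv]
      calc _ = x * (W₁ + W₂)⁻¹ * (A * A⁻¹) := by ring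
        _ = _ := by rw [ENNReal.mul_inv_cancel hA hA', mul_one]
    congr 1
    · exact Finset.sum_congr rfl fun a _ => key _ _ (hne s₁ h₁) (hnt s₁)
    · exact Finset.sum_congr rfl fun a _ => key _ _ (hne _ h₂) (hnt _)

theorem exists_privMed_sampler {ι : Type} {k N : ℕ} [NeZero N] (g : Fin N → ℝ) (v : Fin k → Fin N)
    {L : ℕ} (hL : N ≤ 2 ^ L) :
    ∃ P : Prog ι, P.StepsLE (2 * L + 1) ∧ ∀ mem reg, P.eval mem reg = (privMed v).map g := by
  obtain ⟨P, hP, h⟩ := exists_sampler (ι := ι) g (medianWeight v)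
    (fun a => by simp [medianWeight, Real.exp_pos]) (fun a => by simp [medianWeight]) L
    Finset.univ ⟨0, Finset.mem_univ _⟩ (by simpa using hL)
  refine ⟨P, hP, fun mem reg => PMF.ext fun y => ?_⟩
  rw [h, PMF.map_apply, tsum_fintype]
  refine Finset.sum_congr rfl fun a _ => ?_
  rw [privMed, PMF.normalize_apply, tsum_fintype]
  split_ifs <;> simp [div_eq_mul_inv]

/-! ## Drawing the samples -/

theorem uniform_bind_cons {k r : ℕ} [NeZero r] {β : Type*} (f : (Fin (k + 1) → Fin r) → PMF β) :
    (PMF.uniformOfFintype (Fin (k + 1) → Fin r)).bind f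
      = (PMF.uniformOfFintype (Fin r)).bind fun s =>
        (PMF.uniformOfFintype (Fin k → Fin r)).bind fun S => f (Fin.cons s S) := by
  ext y
  simp only [PMF.bind_apply, tsum_fintype, PMF.uniformOfFintype_apply]
  rw [← (Fin.consEquiv fun _ => Fin r).sum_comp, Fintype.sum_prod_type]
  refine Finset.sum_congr rfl fun s _ => ?_
  rw [Finset.mul_sum]
  refine Finset.sum_congr rfl fun S _ => ?_
  rw [← mul_assoc]
  congr 1
  rw [← ENNReal.mul_inv (by simp) (by simp)]
  simp [pow_succ, mul_comm]

/-- If code of `T` steps branches on `idx mem s`, then the process that draws `k` uniform values `S j`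
and continues with `G` on the values `idx mem (S j)` can be run with `T + 1` steps per sample. -/
theorem exists_samples {ι : Type} {N r : ℕ} [NeZero r] (idx : (ι → ℝ) → Fin r → Fin N) {T T' : ℕ}
    (hidx : ∀ s, ∃ B : (Fin N → Prog ι) → Prog ι,
      (∀ next t, (∀ u, (next u).StepsLE t) → (B next).StepsLE (t + T)) ∧
      ∀ next mem reg, ∃ reg', (B next).eval mem reg = (next (idx mem s)).eval mem reg')
    (k : ℕ) (G : (Fin k → Fin N) → PMF ℝ)
    (hG : ∀ v, ∃ P : Prog ι, P.StepsLE T' ∧ ∀ mem reg, P.eval mem reg = G v) :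
    ∃ P : Prog ι, P.StepsLE (k * (T + 1) + T') ∧ ∀ mem reg, P.eval mem reg
      = (PMF.uniformOfFintype (Fin k → Fin r)).bind fun S => G fun j => idx mem (S j) := by
  induction k with
  | zero =>
    obtain ⟨P, hP, h⟩ := hG Fin.elim0
    refine ⟨P, by simpa using hP, fun mem reg => ?_⟩
    rw [h]
    have : (fun S : Fin 0 → Fin r => G fun j => idx mem (S j)) = fun _ => G Fin.elim0 := by
      funext S
      congr 1
      exact Subsingleton.elim _ _
    rw [this, PMF.bind_const]
  | succ k ih =>
    have h1 : ∀ u : Fin N, ∃ P : Prog ι, P.StepsLE (k * (T + 1) + T') ∧ ∀ mem reg, P.eval mem reg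
        = (PMF.uniformOfFintype (Fin k → Fin r)).bind fun S =>
          G (Fin.cons u fun j => idx mem (S j)) := fun u =>
      ih (fun v => G (Fin.cons u v)) fun v => hG _
    choose next hn he using h1
    choose B hB hBe using hidx
    -- `draw r` ranges over `{0, …, r}`, so the number of sketches has to be written as a successor.
    obtain ⟨r, rfl⟩ := Nat.exists_eq_succ_of_ne_zero (NeZero.ne r)
    refine ⟨.draw r fun s => B s next, ?_, fun mem reg => ?_⟩
    · have : (k + 1) * (T + 1) + T' = (k * (T + 1) + T' + T) + 1 := by ring
      rw [this]
      exact fun s => hB s next _ hn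
    · rw [uniform_bind_cons]
      simp only [Prog.eval]
      congr 1
      funext s
      obtain ⟨reg', h⟩ := hBe s next mem reg
      rw [h, he]
      congr 1
      funext S
      congr 1
      funext j
      refine Fin.cases ?_ (fun j => ?_) j <;> simp

/-! ## Computing an estimate and rounding it -/

/-- The program branches on an integer ceiling, whereas the grid index is defined by a natural one;
the latter unfolds to `toNat` of the former. -/
theorem gridIndex_eq_of_pos {ε lo : ℝ} {M : ℕ} {s : ℝ} (hs : ¬ s ≤ 0) :
    gridIndex ε lo M s = ⟨min (⌈Real.log (s / lo) / Real.log (1 + ε / 4)⌉.toNat + 1) (M + 1),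
      by omega⟩ := by
  simp only [gridIndex, if_neg hs]
  rfl

/-- Code that leaves `val mem` in register `0` can be extended by a branch on its grid index. -/
theorem Runs.branch_gridIndex {ι : Type} {c : Prog ι → Prog ι} {T : ℕ} {val : (ι → ℝ) → ℝ}
    (h : Runs c T fun mem _ reg' => reg' 0 = val mem) (ε lo : ℝ) (M : ℕ) :
    ∃ B : (Fin (M + 2) → Prog ι) → Prog ι,
      (∀ next t, (∀ u, (next u).StepsLE t) → (B next).StepsLE (t + (T + 8))) ∧
      ∀ next mem reg, ∃ reg',
        (B next).eval mem reg = (next (gridIndex ε lo M (val mem))).eval mem reg' := by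
  -- The eight extra steps: two to test the sign, five for the quotient of logarithms, and the final
  -- branch on its ceiling.
  refine ⟨fun next => c (.const 1 0 (.ifLE 0 1 (next 0)
    (.const 2 lo (.bin 0 .div 0 2 (.un 0 .log 0 (.const 2 (Real.log (1 + ε / 4)) (.bin 0 .div 0 2
      (.ceil 0 fun z => next ⟨min (z.toNat + 1) (M + 1), by omega⟩)))))))), ?_, ?_⟩
  · intro next t ht
    refine (h.steps _ (t + 8) ?_).mono (by omega)
    change _ ∧ _
    exact ⟨(ht 0).mono (by omega), fun z => ht _⟩
  · intro next mem reg
    obtain ⟨reg', h1, h2⟩ := h.eval mem reg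
    simp only [h2]
    by_cases hv : val mem ≤ 0
    · refine ⟨Function.update reg' 1 0, ?_⟩
      simp [Prog.eval, h1, hv, gridIndex]
    · rw [gridIndex_eq_of_pos hv]
      simp only [Prog.eval, Function.update_self, ne_eq, not_false_eq_true,
        Function.update_of_ne, h1, hv, if_false, zero_ne_one, OfNat.zero_ne_ofNat, BinOp.eval, UnOp.eval]
      exact ⟨_, rfl⟩

theorem sum_ite_lt_succ {m i : ℕ} (f : Fin m → ℝ) (hi : i < m) :
    (∑ t : Fin m, if (t : ℕ) < i + 1 then f t else 0)
      = (∑ t : Fin m, if (t : ℕ) < i then f t else 0) + f ⟨i, hi⟩ := by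
  have : ∀ t : Fin m, (if (t : ℕ) < i + 1 then f t else 0)
      = (if (t : ℕ) < i then f t else 0) + if t = ⟨i, hi⟩ then f t else 0 := by
    intro t
    simp only [Fin.ext_iff]
    rcases lt_trichotomy (t : ℕ) i with h | h | h
    · simp [h, h.ne, Nat.lt_succ_of_lt h]
    · simp [h]
    · simp [show ¬ (t : ℕ) < i by omega, show ¬ (t : ℕ) < i + 1 by omega, h.ne']
  simp only [this, Finset.sum_add_distrib, Finset.sum_ite_eq', Finset.mem_univ, if_true]

/-- Code for `‖stored - sketch‖`, given code that prepares an invariant `Inv` and code that computes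
each coordinate of the sketch in register `1`. -/
theorem exists_estimate_code {ι : Type} {m T₀ T₁ : ℕ} (Inv : (ι → ℝ) → (ℕ → ℝ) → Prop)
    (hInv : ∀ mem reg i a, (i = 0 ∨ i = 2) → Inv mem reg → Inv mem (Function.update reg i a))
    {c₀ : Prog ι → Prog ι} (h₀ : Runs c₀ T₀ fun mem _ reg' => Inv mem reg')
    (val : (ι → ℝ) → Fin m → ℝ)
    (h₁ : ∀ t, ∃ c, Runs c T₁ fun mem reg reg' => Inv mem reg →
      Inv mem reg' ∧ reg' 0 = reg 0 ∧ reg' 1 = val mem t)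
    (addr : Fin m → ι) :
    ∃ c : Prog ι → Prog ι, Runs c (T₀ + m * (T₁ + 4) + 2) fun mem _ reg' =>
      reg' 0 = ‖(WithLp.toLp 2 fun t => mem (addr t) : EuclideanSpace ℝ (Fin m))
        - WithLp.toLp 2 (val mem)‖ := by
  -- Register `0` accumulates the sum of squares and register `2` is scratch, which is why `Inv`
  -- must survive writes to these two. Load, subtract, square and add give the four extra steps per
  -- coordinate.
  obtain ⟨c, hc⟩ := Runs.loop (ι := ι) (T := T₁ + 4)
    (fun i mem reg reg' => Inv mem reg → reg 0 = 0 → Inv mem reg' ∧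
      reg' 0 = ∑ t : Fin m, if (t : ℕ) < i then (mem (addr t) - val mem t) ^ 2 else 0)
    (by intro mem reg h1 h2; simp [h1, h2]) m (by
      intro i hi
      obtain ⟨c, hc⟩ := h₁ ⟨i, hi⟩
      refine ⟨_, ((((hc.seq (.load 2 (addr ⟨i, hi⟩))).seq (.bin 2 .sub 2 1)).seq
        (.bin 2 .mul 2 2)).seq (.bin 0 .add 0 2)).imp (by omega) ?_⟩
      rintro mem reg reg' ⟨r4, ⟨r3, ⟨r2, ⟨r1, h1, rfl⟩, rfl⟩, rfl⟩, rfl⟩ reg₀ hI hI0 h0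
      obtain ⟨hI, hs⟩ := hI hI0 h0
      obtain ⟨g1, g2, g3⟩ := h1 hI
      refine ⟨by
        refine hInv _ _ _ _ (.inl rfl) (hInv _ _ _ _ (.inr rfl) (hInv _ _ _ _ (.inr rfl)
          (hInv _ _ _ _ (.inr rfl) g1))), ?_⟩
      simp only [BinOp.eval, Function.update_self, ne_eq, OfNat.zero_ne_ofNat, not_false_eq_true,
        Function.update_of_ne, g2, g3, OfNat.one_ne_ofNat, hs]
      rw [sum_ite_lt_succ _ hi]
      ring)
  refine ⟨_, (((h₀.seq (.const 0 0)).seq hc).seq (.un 0 .sqrt 0)).imp (by omega) ?_⟩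
  rintro mem reg reg' ⟨r3, ⟨r2, ⟨r1, h1, rfl⟩, h2⟩, rfl⟩
  obtain ⟨-, h3⟩ := h2 (hInv _ _ _ _ (.inl rfl) h1) (by simp)
  simp only [UnOp.eval, Function.update_self, h3, EuclideanSpace.norm_eq]
  congr 1
  refine Finset.sum_congr rfl fun t _ => ?_
  simp [t.2, sq_abs]

/-! ## From code for the sketches to the query time -/

theorem queryTimeLE_of_code {d m : ℕ} (F : SketchFamily d m) (r n k : ℕ) [NeZero r] (ε lo hi : ℝ)
    {T L : ℕ} (hL : gridLevels ε lo hi + 2 ≤ 2 ^ L)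
    (h : ∀ (i : Fin n) (s : Fin r), ∃ c : Prog (Address F r n) → Prog (Address F r n),
      Runs c T fun mem _ reg' => reg' 0 = estimate F (fun a => mem (.inr (.inr a)))
        (fun a => mem (.inr (.inl a))) (WithLp.toLp 2 fun l => mem (.inl l), i) s)
    {B : ℝ} (hB : (k * (T + 9) + (2 * L + 1) : ℝ) ≤ B) :
    QueryTimeLE F r n k ε lo hi B := by
  have key : ∀ i : Fin n, ∃ P : Prog (Address F r n), P.StepsLE (k * (T + 8 + 1) + (2 * L + 1)) ∧
      ∀ mem reg, P.eval mem reg = (PMF.uniformOfFintype (Fin k → Fin r)).bind fun S =>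
        (privMed fun j => gridIndex ε lo (gridLevels ε lo hi) (estimate F
          (fun a => mem (.inr (.inr a))) (fun a => mem (.inr (.inl a)))
          (WithLp.toLp 2 fun l => mem (.inl l), i) (S j))).map (gridValue ε lo) := by
    intro i
    -- Each sample costs the `T` steps of its estimate, eight for rounding and one for drawing the
    -- sketch.
    exact exists_samples (ι := Address F r n) (N := gridLevels ε lo hi + 2)
      (fun mem s => gridIndex ε lo (gridLevels ε lo hi) (estimate F
          (fun a => mem (.inr (.inr a))) (fun a => mem (.inr (.inl a)))
          (WithLp.toLp 2 fun l => mem (.inl l), i) s))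
      (fun s => (h i s).elim fun c hc => hc.branch_gridIndex ε lo _) k
      (fun v => (privMed v).map (gridValue ε lo)) fun v => exists_privMed_sampler _ _ hL
  choose P hP hPe using key
  refine ⟨P, k * (T + 8 + 1) + (2 * L + 1), ?_, hP, ?_⟩
  · push_cast
    convert hB using 1
    ring
  · rintro tape store ⟨y, i⟩
    rw [hPe]
    rfl

/-! ## Query time of the Gaussian transform -/

theorem queryTimeLE_gaussianJL {d m : ℕ} (r n k : ℕ) [NeZero r] (ε lo hi : ℝ)
    {L : ℕ} (hL : gridLevels ε lo hi + 2 ≤ 2 ^ L) {B : ℝ}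
    (hB : (k * (m * (4 * d + 7) + 11) + (2 * L + 1) : ℝ) ≤ B) :
    QueryTimeLE (gaussianJL d m) r n k ε lo hi B := by
  refine queryTimeLE_of_code _ r n k ε lo hi (T := m * (4 * d + 3 + 4) + 2) hL (fun i s => ?_)
    (by push_cast; convert hB using 1; ring)
  obtain ⟨c, hc⟩ := exists_estimate_code (ι := Address (gaussianJL d m) r n) (fun _ _ => True)
    (fun _ _ _ _ _ _ => trivial) (Runs.nil.imp le_rfl fun _ _ _ _ => trivial)
    (fun mem t => (√(m : ℝ))⁻¹ * ∑ l : Fin d, mem (.inr (.inr (s, (t, l)))) * mem (.inl l))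
    (T₁ := 4 * d + 3) (m := m) (fun t => by
      obtain ⟨c, hc⟩ := Runs.loop (ι := Address (gaussianJL d m) r n) (T := 4)
        (fun i mem reg reg' => reg 1 = 0 → reg' 0 = reg 0 ∧ reg' 1 = ∑ l : Fin d,
          if (l : ℕ) < i then mem (.inr (.inr (s, (t, l)))) * mem (.inl l) else 0)
        (by intro mem reg h; simp [h]) d (by
          intro l hl
          refine ⟨_, ((((Runs.load 2 (.inr (.inr (s, (t, ⟨l, hl⟩))))).seq
            (.load 3 (.inl ⟨l, hl⟩))).seq (.bin 2 .mul 2 3)).seq (.bin 1 .add 1 2)).imp le_rfl ?_⟩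
          rintro mem reg reg' ⟨r3, ⟨r2, ⟨r1, rfl, rfl⟩, rfl⟩, rfl⟩ reg₀ h h0
          obtain ⟨h1, h2⟩ := h h0
          rw [sum_ite_lt_succ _ hl]
          simp [BinOp.eval, h1, h2])
      refine ⟨_, ((((Runs.const 1 0).seq hc).seq (.const 2 (√(m : ℝ))⁻¹)).seq
        (.bin 1 .mul 2 1)).imp (by omega) ?_⟩
      rintro mem reg reg' ⟨r3, ⟨r2, ⟨r1, rfl, h1⟩, rfl⟩, rfl⟩ -
      obtain ⟨h1, h2⟩ := h1 (by simp)
      simp [BinOp.eval, h1, h2])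
    (fun t => .inr (.inl (s, i, t)))
  exact ⟨c, hc.imp (by omega) fun mem reg reg' h => h⟩

/-! ## The fast Hadamard transform -/

/-- The recursion inspects only the lowest `L` bits of the row and the column. Hence row numbers can
be reduced modulo `2 ^ L`, and the block structure of the matrix can be read off by adding `2 ^ L`.
-/
theorem hadamardEntry_congr {L a a' b b' : ℕ} (ha : ∀ i < L, a.testBit i = a'.testBit i)
    (hb : ∀ i < L, b.testBit i = b'.testBit i) :
    hadamardEntry L a b = hadamardEntry L a' b' := by
  induction L with
  | zero => rfl
  | succ L ih =>
    simp only [hadamardEntry]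
    rw [ha L (by omega), hb L (by omega),
      ih (fun i hi => ha i (by omega)) fun i hi => hb i (by omega)]

theorem hadamardEntry_mod (L a b : ℕ) : hadamardEntry L (a % 2 ^ L) b = hadamardEntry L a b :=
  hadamardEntry_congr (fun i hi => by simp [Nat.testBit_mod_two_pow, hi]) fun _ _ => rfl

theorem hadamardEntry_succ_low {L a : ℕ} (ha : a < 2 ^ L) (b : ℕ) :
    hadamardEntry (L + 1) a b = hadamardEntry L a b := by
  simp [hadamardEntry, Nat.testBit_lt_two_pow ha]

theorem hadamardEntry_succ_high_low {L a b : ℕ} (hb : b < 2 ^ L) :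
    hadamardEntry (L + 1) (2 ^ L + a) b = hadamardEntry L a b := by
  simp only [hadamardEntry, Nat.testBit_lt_two_pow hb, Bool.and_false, Bool.false_eq_true, if_false,
    one_mul]
  exact hadamardEntry_congr (fun i hi => Nat.testBit_two_pow_add_gt hi a) fun _ _ => rfl

theorem hadamardEntry_add_right {L a b : ℕ} :
    hadamardEntry L a (2 ^ L + b) = hadamardEntry L a b :=
  hadamardEntry_congr (fun _ _ => rfl) fun _ hi => Nat.testBit_two_pow_add_gt hi b

theorem hadamardEntry_succ_high_high {L a b : ℕ} (ha : a < 2 ^ L) (hb : b < 2 ^ L) :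
    hadamardEntry (L + 1) (2 ^ L + a) (2 ^ L + b) = -hadamardEntry L a b := by
  simp only [hadamardEntry, Nat.testBit_two_pow_add_eq, Nat.testBit_lt_two_pow ha,
    Nat.testBit_lt_two_pow hb, Bool.not_false, Bool.and_self, if_true, neg_mul, one_mul]
  rw [hadamardEntry_congr (fun i hi => Nat.testBit_two_pow_add_gt hi a)
    fun i hi => Nat.testBit_two_pow_add_gt hi b]

/-- Pairwise sums and differences of the two halves of an array of length `2 * w`. -/
theorem exists_butterflies {ι : Type} {base w : ℕ} (hbase : 1 ≤ base) :
    ∃ c : Prog ι → Prog ι, Runs c (w * 3) fun _ reg reg' =>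
      (∀ a < w, reg' (base + a) = reg (base + a) + reg (base + w + a) ∧
        reg' (base + w + a) = reg (base + a) - reg (base + w + a)) ∧
      ∀ a, a ≠ 0 → (a < base ∨ base + 2 * w ≤ a) → reg' a = reg a := by
  obtain ⟨c, hc⟩ := Runs.loop (ι := ι) (T := 3) (fun i _ reg reg' =>
      (∀ a < i, reg' (base + a) = reg (base + a) + reg (base + w + a) ∧
        reg' (base + w + a) = reg (base + a) - reg (base + w + a)) ∧
      (∀ a < w, i ≤ a → reg' (base + a) = reg (base + a) ∧
        reg' (base + w + a) = reg (base + w + a)) ∧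
      ∀ a, a ≠ 0 → (a < base ∨ base + 2 * w ≤ a) → reg' a = reg a)
    (by simp) w (by
      intro i hi
      -- In place, with `l` and `h` the two entries: register `0` becomes `2h`, then `l` becomes `l
      -- + h`, then `h` becomes `(l + h) - 2h = l - h`.
      refine ⟨_, (((Runs.bin 0 .add (base + w + i) (base + w + i)).seq
        (.bin (base + i) .add (base + i) (base + w + i))).seq
        (.bin (base + w + i) .sub (base + i) 0)).imp le_rfl ?_⟩
      rintro mem reg reg' ⟨r2, ⟨r1, rfl, rfl⟩, rfl⟩ reg₀ ⟨h1, h2, h3⟩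
      obtain ⟨g1, g2⟩ := h2 i hi le_rfl
      refine ⟨fun a ha => ?_, fun a ha hia => ?_, fun a ha0 ha => ?_⟩
      · rcases (Nat.lt_succ_iff_lt_or_eq.1 ha) with h | rfl
        · obtain ⟨e1, e2⟩ := h1 a h
          rw [← e1, ← e2]
          constructor <;>
          · simp only [Function.update_apply]
            repeat rw [if_neg (by omega)]
        · have n1 : base + a ≠ 0 := by omega
          have n2 : base + w + a ≠ 0 := by omega
          have n3 : base + w + a ≠ base + a := by omega
          constructor <;>
            simp [-Nat.add_eq_zero_iff, -Nat.add_right_cancel_iff, BinOp.eval,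
              n1, n1.symm, n2, n3.symm, g1, g2]
      · obtain ⟨e1, e2⟩ := h2 a ha (by omega)
        rw [← e1, ← e2]
        constructor <;>
        · simp only [Function.update_apply]
          repeat rw [if_neg (by omega)]
      · rw [← h3 a ha0 ha]
        simp only [Function.update_apply]
        repeat rw [if_neg (by omega)])
  exact ⟨c, hc.imp le_rfl fun mem reg reg' h => ⟨h.1, h.2.2⟩⟩

/-- `H_{2D} (u, v) = (H_D u + H_D v, H_D u - H_D v)`: transform both halves in place and finish with
butterflies. The clause on untouched registers lets the transforms of the two halves run one after
the other; register `0` is scratch. -/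
theorem exists_hadamard_code {ι : Type} (L base : ℕ) (hbase : 1 ≤ base) :
    ∃ c : Prog ι → Prog ι, Runs c (3 * L * 2 ^ L) fun _ reg reg' =>
      (∀ a < 2 ^ L, reg' (base + a)
        = ∑ b ∈ Finset.range (2 ^ L), hadamardEntry L a b * reg (base + b)) ∧
      ∀ a, a ≠ 0 → (a < base ∨ base + 2 ^ L ≤ a) → reg' a = reg a := by
  induction L generalizing base with
  | zero =>
    refine ⟨_, Runs.nil.imp (by omega) ?_⟩
    rintro mem reg reg' rfl
    simp [hadamardEntry]
  | succ L ih =>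
    obtain ⟨c₁, h₁⟩ := ih base hbase
    obtain ⟨c₂, h₂⟩ := ih (base + 2 ^ L) (hbase.trans (Nat.le_add_right _ _))
    obtain ⟨c₃, h₃⟩ := exists_butterflies (ι := ι) (w := 2 ^ L) hbase
    refine ⟨_, ((h₁.seq h₂).seq h₃).imp ?_ ?_⟩
    · have : 3 * (L + 1) * 2 ^ (L + 1) = 3 * L * 2 ^ L + 3 * L * 2 ^ L + 6 * 2 ^ L := by ring
      omega
    rintro mem reg r3 ⟨r2, ⟨r1, ⟨e1, u1⟩, ⟨e2, u2⟩⟩, ⟨e3, u3⟩⟩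
    have hpow : 2 ^ (L + 1) = 2 ^ L + 2 ^ L := by ring
    have hlow : ∀ a < 2 ^ L, r2 (base + a)
        = ∑ b ∈ Finset.range (2 ^ L), hadamardEntry L a b * reg (base + b) := fun a ha => by
      rw [u2 _ (by omega) (.inl (by omega)), e1 a ha]
    have hhigh : ∀ a < 2 ^ L, r2 (base + 2 ^ L + a)
        = ∑ b ∈ Finset.range (2 ^ L), hadamardEntry L a b * reg (base + (2 ^ L + b)) :=
        fun a ha => by
      rw [e2 a ha]
      refine Finset.sum_congr rfl fun b _ => ?_
      rw [u1 (base + 2 ^ L + b) (by positivity) (.inr (Nat.le_add_right _ _)), add_assoc]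
    constructor
    · intro a ha
      rw [hpow, Finset.sum_range_add]
      by_cases h : a < 2 ^ L
      · rw [(e3 a h).1, hlow a h, hhigh a h]
        simp only [hadamardEntry_succ_low h, hadamardEntry_add_right]
      · obtain ⟨a, rfl⟩ := Nat.exists_eq_add_of_le (not_lt.1 h)
        have h' : a < 2 ^ L := by omega
        rw [← add_assoc, (e3 a h').2, hlow a h', hhigh a h', sub_eq_add_neg,
          ← Finset.sum_neg_distrib]
        congr 1
        · refine Finset.sum_congr rfl fun b hb => ?_
          rw [hadamardEntry_succ_high_low (Finset.mem_range.1 hb)]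
        · refine Finset.sum_congr rfl fun b hb => ?_
          rw [hadamardEntry_succ_high_high h' (Finset.mem_range.1 hb), neg_mul]
    · intro a ha0 ha
      rw [u3 a ha0 (by omega), u2 a ha0 (by omega), u1 a ha0 (by omega)]

/-! ## Query time of the fast transform -/

theorem sum_range_dite_eq {d D : ℕ} (hd : d ≤ D) (f : ℕ → ℝ) (g : Fin d → ℝ) :
    (∑ b ∈ Finset.range D, f b * if h : b < d then g ⟨b, h⟩ else 0) = ∑ l : Fin d, f l * g l := by
  rw [Finset.sum_fin_eq_sum_range]
  symm
  rw [← Finset.sum_subset (Finset.range_subset_range.2 hd)]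
  · refine Finset.sum_congr rfl fun b hb => ?_
    simp [Finset.mem_range.1 hb]
  · intro b _ hb
    simp only [Finset.mem_range] at hb
    simp [hb]

theorem queryTimeLE_fastJL {d m : ℕ} (r n k : ℕ) [NeZero r] (ε lo hi : ℝ)
    {L : ℕ} (hL : gridLevels ε lo hi + 2 ≤ 2 ^ L) {B : ℝ}
    (hB : (k * (2 ^ Nat.clog 2 d * (3 * Nat.clog 2 d + 3) + m * 8 + 11) + (2 * L + 1) : ℝ) ≤ B) :
    QueryTimeLE (fastJL d m) r n k ε lo hi B := by
  set K := Nat.clog 2 d with hK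
  refine queryTimeLE_of_code _ r n k ε lo hi
    (T := 2 ^ K * (3 * K + 3) + m * 8 + 2) hL (fun i s => ?_)
    (by push_cast; convert hB using 1; ring)
  -- The block starting at register `4` receives the signed vector padded with zeros; the lower
  -- registers remain free for scratch.
  obtain ⟨c₁, h₁⟩ := Runs.loop (ι := Address (fastJL d m) r n) (T := 3)
    (fun i mem _ reg' => ∀ a < i, reg' (4 + a) = if h : a < d then
      mem (.inr (.inr (s, .inl ⟨a, h⟩))) * mem (.inl ⟨a, h⟩) else 0) (by simp) (2 ^ K) (by
      intro i _
      by_cases hi : i < d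
      · refine ⟨_, (((Runs.load 1 (.inr (.inr (s, .inl ⟨i, hi⟩)))).seq (.load 2 (.inl ⟨i, hi⟩))).seq
          (.bin (4 + i) .mul 1 2)).imp le_rfl ?_⟩
        rintro mem reg reg' ⟨r2, ⟨r1, rfl, rfl⟩, rfl⟩ reg₀ h a ha
        rcases (Nat.lt_succ_iff_lt_or_eq.1 ha) with ha | rfl
        · rw [← h a ha]
          simp only [Function.update_apply]
          repeat rw [if_neg (by omega)]
        · simp [BinOp.eval, hi]
      · refine ⟨_, (Runs.const (4 + i) 0).imp (by omega) ?_⟩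
        rintro mem reg reg' rfl reg₀ h a ha
        rcases (Nat.lt_succ_iff_lt_or_eq.1 ha) with ha | rfl
        · rw [← h a ha]
          simp only [Function.update_apply]
          repeat rw [if_neg (by omega)]
        · simp [hi])
  obtain ⟨c₂, h₂⟩ := exists_hadamard_code (ι := Address (fastJL d m) r n) K 4 (by norm_num)
  obtain ⟨c, hc⟩ := exists_estimate_code (ι := Address (fastJL d m) r n)
    (fun mem reg => ∀ a < 2 ^ K, reg (4 + a) = ∑ l : Fin d,
      hadamardEntry K a l * (mem (.inr (.inr (s, .inl l))) * mem (.inl l)))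
    (by
      intro mem reg i a hi h b hb
      rw [← h b hb, Function.update_apply, if_neg (by omega)])
    ((h₁.seq h₂).imp le_rfl (by
      rintro mem reg reg' ⟨r1, h1, h2, -⟩ a ha
      rw [h2 a ha, ← sum_range_dite_eq (Nat.le_pow_clog one_lt_two d)]
      exact Finset.sum_congr rfl fun b hb => by rw [h1 b (Finset.mem_range.1 hb)]))
    (fun mem t => (√(m : ℝ))⁻¹ * ∑ l : Fin d,
      hadamardEntry K ⌈mem (.inr (.inr (s, .inr t)))⌉₊ l * mem (.inr (.inr (s, .inl l)))
        * mem (.inl l))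
    (T₁ := 4) (m := m) (fun t => by
      -- The branch on the row number serves as indirect addressing: each branch names a fixed
      -- register of the block. Reducing modulo `2 ^ K` keeps the program exact for every tape
      -- content, including numbers that are not row numbers.
      refine ⟨_, ((Runs.load 1 (.inr (.inr (s, .inr t)))).seq (Runs.ceil 1 fun z =>
        (Runs.const 2 (√(m : ℝ))⁻¹).seq (.bin 1 .mul 2 (4 + z.toNat % 2 ^ K)))).imp le_rfl ?_⟩
      rintro mem reg reg' ⟨r1, rfl, r2, rfl, rfl⟩ h
      refine ⟨fun a ha => ?_, by simp [Function.update_apply], ?_⟩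
      · rw [← h a ha]
        simp only [Function.update_apply]
        repeat rw [if_neg (by omega)]
      · have hlt := Nat.mod_lt ⌈mem (.inr (.inr (s, .inr t)))⌉.toNat (Nat.two_pow_pos K)
        simp only [BinOp.eval, Function.update_self]
        rw [Function.update_of_ne (by omega), Function.update_of_ne (by omega), h _ hlt]
        simp only [hadamardEntry_mod, mul_assoc]
        rfl)
    (fun t => .inr (.inl (s, i, t)))
  refine ⟨c, hc.imp ?_ fun mem reg reg' h => h⟩
  have : 2 ^ K * (3 * K + 3) = 2 ^ K * 3 + 3 * K * 2 ^ K := by ring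
  omega

/-! ## Fourth moments of sums of independent variables -/

theorem _root_.MeasureTheory.MemLp.integrable_pow_of_le {Ω : Type*} [MeasurableSpace Ω]
    {μ : Measure Ω} [IsFiniteMeasure μ] {X : Ω → ℝ} {n : ℕ} (h : MemLp X n μ) {k : ℕ} (hk : k ≤ n) :
    Integrable (fun ω => X ω ^ k) μ := by
  have hX : MemLp X k μ := h.mono_exponent (by exact_mod_cast hk)
  refine (integrable_norm_iff (hX.1.pow k)).1 ?_
  simpa using hX.integrable_norm_pow'

/-- Laws on the reals with the moments needed for Johnson-Lindenstrauss sketches. -/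
structure IsSketchEntry (ν : Measure ℝ) (K : ℝ) : Prop where
  prob : IsProbabilityMeasure ν
  memLp : MemLp id 4 ν
  integral_one : ∫ x, x ∂ν = 0
  integral_two : ∫ x, x ^ 2 ∂ν = 1
  integral_three : ∫ x, x ^ 3 ∂ν = 0
  integral_four : ∫ x, x ^ 4 ∂ν ≤ K

/-- Add one independent summand at a time. The terms of odd degree in the new variable vanish, and
with `A` the previous sum of squares the fourth moment becomes at most `K A² + 6 A a² + K a⁴ ≤ K (A
+ a²)²`, which is where `3 ≤ K` enters. -/
theorem IsSketchEntry.sum {ι : Type*} [Fintype ι] {ν : Measure ℝ} {K : ℝ} (h : IsSketchEntry ν K)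
    (hK : 3 ≤ K) (a : ι → ℝ) (s : Finset ι) :
    MemLp (fun x : ι → ℝ => ∑ i ∈ s, a i * x i) 4 (Measure.pi fun _ => ν) ∧
    ∫ x : ι → ℝ, (∑ i ∈ s, a i * x i) ^ 2 ∂(Measure.pi fun _ => ν) = ∑ i ∈ s, a i ^ 2 ∧
    ∫ x : ι → ℝ, (∑ i ∈ s, a i * x i) ^ 4 ∂(Measure.pi fun _ => ν) ≤ K * (∑ i ∈ s, a i ^ 2) ^ 2 := by
  classical
  have := h.prob
  induction s using Finset.induction_on with
  | empty => simp
  | insert i s hi ih =>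
    obtain ⟨hL, h2, h4⟩ := ih
    set μ : Measure (ι → ℝ) := Measure.pi fun _ => ν
    set Y : (ι → ℝ) → ℝ := fun x => ∑ i ∈ s, a i * x i with hY
    set W : (ι → ℝ) → ℝ := fun x => a i * x i with hW
    have hev : MeasurePreserving (fun x : ι → ℝ => x i) μ ν := measurePreserving_eval _ i
    have hWL : MemLp W 4 μ := (h.memLp.comp_measurePreserving hev).const_mul (a i)
    have hmom : ∀ k : ℕ, ∫ x, W x ^ k ∂μ = a i ^ k * ∫ x, x ^ k ∂ν := fun k => by
      rw [← hev.map_eq, integral_map hev.measurable.aemeasurable (by fun_prop),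
        ← integral_const_mul]
      simp [hW, mul_pow]
    have hind : IndepFun Y W μ := by
      have hi' : iIndepFun (fun i (x : ι → ℝ) => a i * x i) μ :=
        iIndepFun_pi (X := fun i y => a i * y) fun i => by fun_prop
      have := hi'.indepFun_finsetSum_of_notMem (fun i => by fun_prop) hi
      convert this using 1
      ext x
      simp [hY]
    have hprod : ∀ k l : ℕ, ∫ x, Y x ^ k * W x ^ l ∂μ = (∫ x, Y x ^ k ∂μ) * ∫ x, W x ^ l ∂μ := by
      intro k l
      refine (hind.comp (measurable_id.pow_const k)
        (measurable_id.pow_const l)).integral_fun_mul_eq_mul_integral ?_ ?_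
      · exact ((by fun_prop : Measurable Y).pow_const k).aestronglyMeasurable
      · exact ((by fun_prop : Measurable W).pow_const l).aestronglyMeasurable
    have hint : ∀ k l : ℕ, k ≤ 4 → l ≤ 4 → Integrable (fun x => Y x ^ k * W x ^ l) μ := by
      intro k l hk hl
      exact (hind.comp (measurable_id.pow_const k) (measurable_id.pow_const l)).integrable_mul
        (hL.integrable_pow_of_le (n := 4) hk) (hWL.integrable_pow_of_le (n := 4) hl)
    have hsum : ∀ x : ι → ℝ, ∑ j ∈ insert i s, a j * x j = Y x + W x := fun x => by
      rw [Finset.sum_insert hi, add_comm]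
    simp only [hsum, Finset.sum_insert hi]
    refine ⟨hL.add hWL, ?_, ?_⟩
    · have e : ∀ x, (Y x + W x) ^ 2 = Y x ^ 2 * W x ^ 0 + (2 * (Y x ^ 1 * W x ^ 1)
          + Y x ^ 0 * W x ^ 2) := fun x => by ring
      simp only [e]
      have i20 := hint 2 0 (by norm_num) (by norm_num)
      have i11 := (hint 1 1 (by norm_num) (by norm_num)).const_mul 2
      have i02 := hint 0 2 (by norm_num) (by norm_num)
      have j1 : Integrable (fun x => 2 * (Y x ^ 1 * W x ^ 1) + Y x ^ 0 * W x ^ 2) μ := i11.add i02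
      rw [integral_add i20 j1, integral_add i11 i02, integral_const_mul, hprod, hprod, hprod, hmom,
        hmom, hmom, h2]
      simp [h.integral_one, h.integral_two]
      ring
    · have e : ∀ x, (Y x + W x) ^ 4 = Y x ^ 4 * W x ^ 0 + (4 * (Y x ^ 3 * W x ^ 1)
          + (6 * (Y x ^ 2 * W x ^ 2) + (4 * (Y x ^ 1 * W x ^ 3) + Y x ^ 0 * W x ^ 4))) :=
        fun x => by ring
      simp only [e]
      have i40 := hint 4 0 (by norm_num) (by norm_num)
      have i31 := (hint 3 1 (by norm_num) (by norm_num)).const_mul 4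
      have i22 := (hint 2 2 (by norm_num) (by norm_num)).const_mul 6
      have i13 := (hint 1 3 (by norm_num) (by norm_num)).const_mul 4
      have i04 := hint 0 4 (by norm_num) (by norm_num)
      have j1 : Integrable (fun x => 4 * (Y x ^ 1 * W x ^ 3) + Y x ^ 0 * W x ^ 4) μ := i13.add i04
      have j2 : Integrable (fun x => 6 * (Y x ^ 2 * W x ^ 2)
        + (4 * (Y x ^ 1 * W x ^ 3) + Y x ^ 0 * W x ^ 4)) μ := i22.add j1
      have j3 : Integrable (fun x => 4 * (Y x ^ 3 * W x ^ 1) + (6 * (Y x ^ 2 * W x ^ 2)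
        + (4 * (Y x ^ 1 * W x ^ 3) + Y x ^ 0 * W x ^ 4))) μ := i31.add j2
      rw [integral_add i40 j3, integral_add i31 j2, integral_add i22 j1, integral_add i13 i04,
        integral_const_mul,
        integral_const_mul, integral_const_mul, hprod, hprod, hprod, hprod, hprod, hmom, hmom, hmom,
        hmom, hmom, h2]
      simp only [pow_zero, pow_one, h.integral_one, h.integral_two, h.integral_three, integral_const,
        probReal_univ, smul_eq_mul, mul_one, one_mul, mul_zero, zero_add]
      have hA : 0 ≤ ∑ i ∈ s, a i ^ 2 := Finset.sum_nonneg fun _ _ => sq_nonneg _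
      nlinarith [mul_le_mul_of_nonneg_left h.integral_four (by positivity : 0 ≤ a i ^ 4),
        mul_nonneg hA (sq_nonneg (a i)),
        mul_le_mul_of_nonneg_right hK (mul_nonneg hA (sq_nonneg (a i)))]

theorem exp_half_le : Real.exp (1 / 2) ≤ 5 / 3 := by
  have h1 := Real.exp_one_lt_d9
  have h2 : Real.exp (1 / 2) * Real.exp (1 / 2) = Real.exp 1 := by
    rw [← Real.exp_add]; norm_num
  nlinarith [Real.exp_pos (1 / 2)]

theorem isSketchEntry_gaussianReal : IsSketchEntry (gaussianReal 0 1) 80 where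
  prob := inferInstance
  memLp := memLp_id_gaussianReal 4
  integral_one := integral_id_gaussianReal
  integral_two := by
    have := variance_eq_sub (memLp_id_gaussianReal (μ := 0) (v := 1) 2)
    simpa [variance_id_gaussianReal] using this.symm
  integral_three := by
    have h : ∫ x, x ^ 3 ∂(gaussianReal 0 1) = ∫ x, (-x) ^ 3 ∂(gaussianReal 0 1) := by
      have := gaussianReal_map_neg (μ := 0) (v := 1)
      rw [neg_zero] at this
      conv_lhs => rw [← this]
      rw [integral_map (by fun_prop) (by fun_prop)]
    have e : ∀ x : ℝ, (-x) ^ 3 = -x ^ 3 := fun x => by ring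
    simp only [e, integral_neg] at h
    linarith
  integral_four := by
    have i1 := integrable_exp_mul_gaussianReal (μ := 0) (v := 1) 1
    have i2 := integrable_exp_mul_gaussianReal (μ := 0) (v := 1) (-1)
    have m1 : ∫ x, Real.exp (1 * x) ∂(gaussianReal 0 1) = Real.exp (1 / 2) := by
      have := congrFun (mgf_id_gaussianReal (μ := 0) (v := 1)) 1
      simpa [mgf] using this
    have m2 : ∫ x, Real.exp (-1 * x) ∂(gaussianReal 0 1) = Real.exp (1 / 2) := by
      have := congrFun (mgf_id_gaussianReal (μ := 0) (v := 1)) (-1)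
      simpa [mgf] using this
    -- One term of the exponential series gives `x⁴/4! ≤ e^|x|`. As `E e^(±x) = e^(1/2) ≤ 5/3`, the
    -- fourth moment is at most `24 · 2 · 5/3 = 80`; the exact value is not needed.
    have hb : ∀ x : ℝ, x ^ 4 ≤ 24 * (Real.exp (1 * x) + Real.exp (-1 * x)) := by
      intro x
      have h := Real.pow_div_factorial_le_exp |x| (abs_nonneg x) 4
      have e1 : |x| ^ 4 = x ^ 4 := by
        rw [show (4 : ℕ) = 2 * 2 by rfl, pow_mul, pow_mul, sq_abs]
      have e2 : ((Nat.factorial 4 : ℕ) : ℝ) = 24 := by norm_num [Nat.factorial]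
      rw [e1, e2, div_le_iff₀ (by norm_num)] at h
      have h3 : Real.exp |x| ≤ Real.exp (1 * x) + Real.exp (-1 * x) := by
        rcases abs_cases x with ⟨h, -⟩ | ⟨h, -⟩ <;> rw [h]
        · simpa using (Real.exp_pos (-x)).le
        · simpa using (Real.exp_pos x).le
      linarith
    calc ∫ x, x ^ 4 ∂(gaussianReal 0 1)
        ≤ ∫ x, 24 * (Real.exp (1 * x) + Real.exp (-1 * x)) ∂(gaussianReal 0 1) :=
          integral_mono ((memLp_id_gaussianReal 4).integrable_pow_of_le (n := 4) le_rfl)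
            ((i1.add i2).const_mul _) hb
      _ = 24 * (Real.exp (1 / 2) + Real.exp (1 / 2)) := by
          rw [integral_const_mul, integral_add i1 i2, m1, m2]
      _ ≤ 80 := by linarith [exp_half_le]

/-! ## Uniform distributions on finite sets -/

theorem uniformOn_memLp (t : Finset ℝ) (f : ℝ → ℝ) (hf : Measurable f) (p : ℝ≥0∞) :
    MemLp f p (uniformOn (t : Set ℝ)) := by
  have hb : ∀ᵐ x ∂(uniformOn (t : Set ℝ)), ‖f x‖ ≤ ∑ y ∈ t, ‖f y‖ := by
    have : uniformOn (t : Set ℝ) (t : Set ℝ)ᶜ = 0 := by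
      rw [uniformOn_eq_zero_iff t.finite_toSet]; simp
    filter_upwards [(mem_ae_iff.2 this : (t : Set ℝ) ∈ ae _)] with x hx
    exact Finset.single_le_sum (f := fun y => ‖f y‖) (fun _ _ => norm_nonneg _) hx
  exact MemLp.of_bound hf.aestronglyMeasurable _ hb

theorem integral_uniformOn (t : Finset ℝ) (f : ℝ → ℝ) :
    ∫ x, f x ∂(uniformOn (t : Set ℝ)) = (t.card : ℝ)⁻¹ * ∑ y ∈ t, f y := by
  have hc : Measure.count (t : Set ℝ) = t.card := Measure.count_apply_finset t
  have : IsFiniteMeasure ((Measure.count : Measure ℝ).restrict (t : Set ℝ)) :=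
    ⟨by simp [hc]⟩
  rw [uniformOn, ProbabilityTheory.cond, integral_smul_measure, hc]
  have : (Measure.count : Measure ℝ).restrict (t : Set ℝ) = ∑ y ∈ t, Measure.dirac y := by
    ext s hs
    rw [Measure.restrict_apply hs, Measure.finsetSum_apply]
    simp only [Measure.dirac_apply' _ hs]
    classical
    have : s ∩ (t : Set ℝ) = ((t.filter (· ∈ s) : Finset ℝ) : Set ℝ) := by
      ext; simp [and_comm]
    rw [this, Measure.count_apply_finset]
    simp [Set.indicator_apply, Finset.sum_boole]
  rw [this, integral_finsetSum_measure fun i _ => integrable_dirac (by simp)]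
  simp

theorem isSketchEntry_sign : IsSketchEntry (uniformOn ({1, -1} : Set ℝ)) 80 := by
  have e : ({1, -1} : Set ℝ) = (({1, -1} : Finset ℝ) : Set ℝ) := by simp
  have hc : ({1, -1} : Finset ℝ).card = 2 := by
    rw [Finset.card_insert_of_notMem (by norm_num), Finset.card_singleton]
  have hs : ∀ f : ℝ → ℝ, ∑ y ∈ ({1, -1} : Finset ℝ), f y = f 1 + f (-1) := fun f => by
    rw [Finset.sum_insert (by norm_num), Finset.sum_singleton]
  refine ⟨isProbabilityMeasure_uniformOn (by simp) (by simp), ?_, ?_, ?_, ?_, ?_⟩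
  · rw [e]; exact uniformOn_memLp _ _ measurable_id _
  all_goals
    rw [e, integral_uniformOn, hc, hs]
    norm_num

/-! ## Chebyshev's inequality for averages of independent copies -/

theorem pi_deviation_le {X : Type*} [MeasurableSpace X] (ν : Measure X) [IsProbabilityMeasure ν]
    {W : X → ℝ} (hW : MemLp W 2 ν) {V : ℝ} (hV : ∫ x, W x ^ 2 ∂ν ≤ V)
    {m : ℕ} (hm : 0 < m) {δ : ℝ} (hδ : 0 < δ) :
    (Measure.pi fun _ : Fin m => ν) {g | δ ≤ |(m : ℝ)⁻¹ * ∑ t, W (g t) - ∫ x, W x ∂ν|}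
      ≤ ENNReal.ofReal (V / (m * δ ^ 2)) := by
  set μ : Measure (Fin m → X) := Measure.pi fun _ => ν
  have hm' : (0 : ℝ) < m := by exact_mod_cast hm
  have hL : ∀ t : Fin m, MemLp (fun g : Fin m → X => W (g t)) 2 μ := fun t =>
    hW.comp_measurePreserving (measurePreserving_eval _ t)
  have hS : MemLp (∑ t : Fin m, fun g : Fin m → X => W (g t)) 2 μ :=
    memLp_finsetSum' _ fun t _ => hL t
  have hmean : ∫ g, (∑ t : Fin m, fun g : Fin m → X => W (g t)) g ∂μ = m * ∫ x, W x ∂ν := by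
    simp only [Finset.sum_apply]
    rw [integral_finsetSum _ fun t _ => (hL t).integrable (by norm_num)]
    have : ∀ t : Fin m, ∫ g : Fin m → X, W (g t) ∂μ = ∫ x, W x ∂ν := fun t => by
      have hp := measurePreserving_eval (fun _ : Fin m => ν) t
      have := integral_map (f := W) hp.measurable.aemeasurable (by rw [hp.map_eq]; exact hW.1)
      rw [hp.map_eq] at this
      exact this.symm
    simp [this]
  have hvar : Var[∑ t : Fin m, fun g : Fin m → X => W (g t); μ] ≤ m * V := by
    rw [variance_sum_pi (X := fun _ => W) fun _ => hW]
    simp only [Finset.sum_const, Finset.card_univ, Fintype.card_fin, nsmul_eq_mul]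
    gcongr
    exact (variance_le_expectation_sq hW.1).trans hV
  refine (measure_mono ?_).trans ((meas_ge_le_variance_div_sq hS
    (c := m * δ) (by positivity)).trans (ENNReal.ofReal_le_ofReal ?_))
  · intro g hg
    simp only [Set.mem_ofPred_eq] at hg ⊢
    rw [hmean, Finset.sum_apply]
    have : ∑ t, W (g t) - m * ∫ x, W x ∂ν = m * ((m : ℝ)⁻¹ * ∑ t, W (g t) - ∫ x, W x ∂ν) := by
      field_simp
    rw [this, abs_mul, abs_of_pos hm']
    gcongr
  · calc _ ≤ m * V / (m * δ) ^ 2 := by gcongr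
      _ = V / (m * δ ^ 2) := by field_simp

/-! ## The two transforms preserve norms -/

/-- A family of random linear maps such that each vector keeps its squared norm up to a factor
`1 ± δ`, except with probability `p`. -/
structure IsGoodSketch {d m : ℕ} (F : SketchFamily d m) (δ p : ℝ) : Prop where
  prob : IsProbabilityMeasure F.law
  sub : ∀ g x y, F.sketch g x - F.sketch g y = F.sketch g (x - y)
  meas : ∀ z, Measurable fun g => ‖F.sketch g z‖
  bound : ∀ z, F.law {g | ¬ |‖F.sketch g z‖ ^ 2 - ‖z‖ ^ 2| ≤ δ * ‖z‖ ^ 2} ≤ ENNReal.ofReal p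

/-- The squared norm of the sketch is the average of `m` independent copies of `(∑ z l * g l)²`,
which has mean `‖z‖²` and second moment at most `80 ‖z‖⁴`. Chebyshev is enough because only a
constant failure probability per sketch is required. -/
theorem isGoodSketch_gaussianJL {d m : ℕ} (hm : 0 < m) {δ : ℝ} (hδ : 0 < δ) :
    IsGoodSketch (gaussianJL d m) δ (80 / (m * δ ^ 2)) := by
  have hm' : (0 : ℝ) < m := by exact_mod_cast hm
  have hnorm : ∀ g (z : EuclideanSpace ℝ (Fin d)), ‖(gaussianJL d m).sketch g z‖ ^ 2
      = (m : ℝ)⁻¹ * ∑ t, (∑ l, z l * g (t, l)) ^ 2 := by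
    intro g z
    rw [EuclideanSpace.real_norm_sq_eq, Finset.mul_sum]
    refine Finset.sum_congr rfl fun t _ => ?_
    simp only [gaussianJL, mul_pow, inv_pow, Real.sq_sqrt hm'.le, mul_comm (z _)]
  refine ⟨(inferInstance :
    IsProbabilityMeasure (Measure.pi fun _ : Fin m × Fin d => gaussianReal 0 1)), fun g x y => ?_, fun z => ?_, fun z => ?_⟩
  · ext t
    simp [gaussianJL, mul_sub, Finset.sum_sub_distrib]
  · refine Measurable.norm ?_
    refine (WithLp.measurable_toLp 2 _).comp (measurable_pi_lambda _ fun t => ?_)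
    simp only [gaussianJL]
    fun_prop
  -- The Chebyshev threshold `δ ‖z‖²` has to be positive, so the zero vector is treated apart.
  · by_cases hz : z = 0
    · simp [hz, hnorm]
    have hz' : 0 < ‖z‖ := norm_pos_iff.2 hz
    obtain ⟨h4, h2, h44⟩ := isSketchEntry_gaussianReal.sum (by norm_num) (fun l => z l) Finset.univ
    -- The Gaussian matrix as a family of `m` independent rows.
    have hcurry : (Measure.pi fun _ : Fin m × Fin d => gaussianReal 0 1).map (MeasurableEquiv.curry (Fin m) (Fin d) ℝ)
        = Measure.pi fun _ : Fin m => Measure.pi fun _ : Fin d => gaussianReal 0 1 := by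
      have := Measure.infinitePi_map_curry (fun (_ : Fin m) (_ : Fin d) => gaussianReal 0 1)
      simp only [Measure.infinitePi_eq_pi] at this
      exact this
    have hdev := pi_deviation_le (Measure.pi fun _ : Fin d => gaussianReal 0 1)
      (W := fun g => (∑ l, z l * g l) ^ 2) (V := 80 * (∑ l, z l ^ 2) ^ 2) (m := m)
      ((memLp_two_iff_integrable_sq (h4.1.pow 2)).2 (by
        simpa only [Pi.pow_apply, ← pow_mul] using h4.integrable_pow_of_le (n := 4) le_rfl))
      (by simpa only [← pow_mul] using h44) hm (δ := δ * ‖z‖ ^ 2) (by positivity)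
    rw [h2, ← hcurry, MeasurableEquiv.map_apply, ← EuclideanSpace.real_norm_sq_eq] at hdev
    change (Measure.pi fun _ : Fin m × Fin d => gaussianReal 0 1) _ ≤ _
    refine (measure_mono ?_).trans (hdev.trans (ENNReal.ofReal_le_ofReal (le_of_eq ?_)))
    · intro g hg
      have hg' := (congrArg (fun u : ℝ => ¬ |u - ‖z‖ ^ 2| ≤ δ * ‖z‖ ^ 2) (hnorm g z)).mp hg
      exact (not_le.1 hg').le
    · field_simp

/-! ### Parseval's identity for the Hadamard matrix, and the fast transform. -/

theorem hadamardEntry_sq (L a b : ℕ) : hadamardEntry L a b ^ 2 = 1 := by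
  induction L with
  | zero => simp [hadamardEntry]
  | succ L ih =>
    rw [hadamardEntry, mul_pow, ih]
    split_ifs <;> norm_num

/-- Rows `a` and `2 ^ L + a` carry the sum and the difference of the transforms of the two halves,
so the parallelogram identity doubles the constant at each level. -/
theorem sum_hadamard_sq (L : ℕ) (z : ℕ → ℝ) :
    ∑ a ∈ Finset.range (2 ^ L), (∑ b ∈ Finset.range (2 ^ L), hadamardEntry L a b * z b) ^ 2
      = 2 ^ L * ∑ b ∈ Finset.range (2 ^ L), z b ^ 2 := by
  induction L generalizing z with
  | zero => simp [hadamardEntry]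
  | succ L ih =>
    have hpow : 2 ^ (L + 1) = 2 ^ L + 2 ^ L := by ring
    have hlow : ∀ a ∈ Finset.range (2 ^ L),
        (∑ b ∈ Finset.range (2 ^ (L + 1)), hadamardEntry (L + 1) a b * z b) ^ 2
        + (∑ b ∈ Finset.range (2 ^ (L + 1)), hadamardEntry (L + 1) (2 ^ L + a) b * z b) ^ 2
        = 2 * (∑ b ∈ Finset.range (2 ^ L), hadamardEntry L a b * z b) ^ 2
        + 2 * (∑ b ∈ Finset.range (2 ^ L), hadamardEntry L a b * z (2 ^ L + b)) ^ 2 := by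
      intro a ha
      have ha := Finset.mem_range.1 ha
      rw [hpow, Finset.sum_range_add, Finset.sum_range_add]
      have e : ∑ b ∈ Finset.range (2 ^ L), hadamardEntry (L + 1) (2 ^ L + a) b * z b
          = ∑ b ∈ Finset.range (2 ^ L), hadamardEntry L a b * z b :=
        Finset.sum_congr rfl fun b hb => by
          rw [hadamardEntry_succ_high_low (Finset.mem_range.1 hb)]
      have e' : ∑ b ∈ Finset.range (2 ^ L),
          hadamardEntry (L + 1) (2 ^ L + a) (2 ^ L + b) * z (2 ^ L + b)
          = -∑ b ∈ Finset.range (2 ^ L), hadamardEntry L a b * z (2 ^ L + b) := by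
        rw [← Finset.sum_neg_distrib]
        exact Finset.sum_congr rfl fun b hb => by
          rw [hadamardEntry_succ_high_high ha (Finset.mem_range.1 hb), neg_mul]
      simp only [e, e', hadamardEntry_succ_low ha, hadamardEntry_add_right]
      ring
    conv_lhs => rw [hpow, Finset.sum_range_add, ← Finset.sum_add_distrib]
    rw [← hpow, Finset.sum_congr rfl hlow, Finset.sum_add_distrib, ← Finset.mul_sum,
      ← Finset.mul_sum, ih, ih fun b => z (2 ^ L + b), hpow, Finset.sum_range_add]
    ring

theorem sum_hadamard_fin_sq {L d : ℕ} (hd : d ≤ 2 ^ L) (z : Fin d → ℝ) :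
    ∑ a ∈ Finset.range (2 ^ L), (∑ l : Fin d, hadamardEntry L a l * z l) ^ 2
      = 2 ^ L * ∑ l : Fin d, z l ^ 2 := by
  have h := sum_hadamard_sq L fun b => if h : b < d then z ⟨b, h⟩ else 0
  have e : ∀ b, (if h : b < d then z ⟨b, h⟩ else 0) ^ 2
      = 1 * if h : b < d then z ⟨b, h⟩ ^ 2 else 0 := fun b => by
    split_ifs <;> simp
  simp only [sum_range_dite_eq hd, e] at h
  rw [h, sum_range_dite_eq hd (fun _ => 1) fun l => z l ^ 2]
  simp

/-- The law of a row number of the fast transform. -/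
theorem integral_rowLaw (L : ℕ) (f : ℕ → ℝ) :
    ∫ x, f ⌈x⌉₊ ∂(uniformOn (Set.range fun a : Fin (2 ^ L) => ((a : ℕ) : ℝ)))
      = (2 ^ L : ℝ)⁻¹ * ∑ a ∈ Finset.range (2 ^ L), f a := by
  have hinj : Function.Injective (Nat.cast : ℕ → ℝ) := Nat.cast_injective
  have e : (Set.range fun a : Fin (2 ^ L) => ((a : ℕ) : ℝ))
      = (((Finset.range (2 ^ L)).map ⟨_, hinj⟩ : Finset ℝ) : Set ℝ) := by
    ext x
    simp only [Set.mem_range, Finset.coe_map, Set.mem_image, Finset.mem_coe, Finset.mem_range,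
      Function.Embedding.coeFn_mk]
    exact ⟨fun ⟨a, h⟩ => ⟨a, a.2, h⟩, fun ⟨a, h, h'⟩ => ⟨⟨a, h⟩, h'⟩⟩
  rw [e, integral_uniformOn]
  simp

theorem isProbabilityMeasure_rowLaw (L : ℕ) :
    IsProbabilityMeasure (uniformOn (Set.range fun a : Fin (2 ^ L) => ((a : ℕ) : ℝ))) :=
  isProbabilityMeasure_uniformOn (Set.finite_range _) (Set.range_nonempty _)

theorem memLp_rowLaw (L : ℕ) (f : ℕ → ℝ) (p : ℝ≥0∞) :
    MemLp (fun x => f ⌈x⌉₊) p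
      (uniformOn (Set.range fun a : Fin (2 ^ L) => ((a : ℕ) : ℝ))) := by
  have := uniformOn_memLp (Set.finite_range fun a : Fin (2 ^ L) => ((a : ℕ) : ℝ)).toFinset
    (fun x => f ⌈x⌉₊) ((measurable_of_countable f).comp Nat.measurable_ceil) p
  simpa using this

/-- Condition on the signs. The `m` sampled rows are then independent, and by Parseval their squared
coordinates have mean exactly `‖z‖²`; Chebyshev leaves the average fourth power of the coordinates
as variance bound. Averaging over the signs bounds it by `80 ‖z‖⁴`, since each coordinate is a
random sign sum. No uniform bound on the coordinates is needed, hence no logarithmic loss in `m`. -/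
theorem isGoodSketch_fastJL {d m : ℕ} (hm : 0 < m) {δ : ℝ} (hδ : 0 < δ) :
    IsGoodSketch (fastJL d m) δ (80 / (m * δ ^ 2)) := by
  have hm' : (0 : ℝ) < m := by exact_mod_cast hm
  set L := Nat.clog 2 d with hL
  have hd : d ≤ 2 ^ L := Nat.le_pow_clog one_lt_two d
  have hnorm : ∀ g (z : EuclideanSpace ℝ (Fin d)), ‖(fastJL d m).sketch g z‖ ^ 2
      = (m : ℝ)⁻¹ * ∑ t, (∑ l : Fin d, hadamardEntry L ⌈g (.inr t)⌉₊ l * (g (.inl l) * z l)) ^ 2 := by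
    intro g z
    rw [EuclideanSpace.real_norm_sq_eq, Finset.mul_sum]
    refine Finset.sum_congr rfl fun t _ => ?_
    simp only [fastJL, mul_pow, inv_pow, Real.sq_sqrt hm'.le, mul_assoc, ← hL]
  have hmeas : ∀ (z : EuclideanSpace ℝ (Fin d)) (t : Fin m), Measurable fun g : Fin d ⊕ Fin m → ℝ =>
      ∑ l : Fin d, hadamardEntry L ⌈g (.inr t)⌉₊ l * g (.inl l) * z l := by
    intro z t
    refine Finset.measurable_sum _ fun l _ => ?_
    have h1 : Measurable fun g : Fin d ⊕ Fin m → ℝ => hadamardEntry L ⌈g (.inr t)⌉₊ l :=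
      (measurable_of_countable fun a : ℕ => hadamardEntry L a l).comp
        (Nat.measurable_ceil.comp (measurable_pi_apply _))
    fun_prop
  have hp1 := isSketchEntry_sign.prob
  have hp2 := isProbabilityMeasure_rowLaw L
  set ν₁ : Measure ℝ := uniformOn ({1, -1} : Set ℝ) with hν₁
  set ν₂ : Measure ℝ := uniformOn (Set.range fun a : Fin (2 ^ L) => ((a : ℕ) : ℝ)) with hν₂
  set ν : Fin d ⊕ Fin m → Measure ℝ := fun c => Sum.elim (fun _ => ν₁) (fun _ => ν₂) c with hν
  have hprob : ∀ c, IsProbabilityMeasure (ν c) := by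
    rintro (c | c)
    · exact hp1
    · exact hp2
  have hlaw : (fastJL d m).law = Measure.pi ν := rfl
  have hmp : MeasurePreserving (MeasurableEquiv.sumPiEquivProdPi fun _ : Fin d ⊕ Fin m => ℝ)
      (Measure.pi ν) ((Measure.pi fun _ : Fin d => ν₁).prod (Measure.pi fun _ : Fin m => ν₂)) :=
    measurePreserving_sumPiEquivProdPi ν
  refine ⟨(inferInstance : IsProbabilityMeasure (Measure.pi ν)), fun g x y => ?_, fun z => ?_, fun z => ?_⟩
  · ext t
    simp [fastJL, mul_sub, Finset.sum_sub_distrib]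
  · refine Measurable.norm ?_
    refine (WithLp.measurable_toLp 2 _).comp (measurable_pi_lambda _ fun t => ?_)
    exact (hmeas z t).const_mul _
  by_cases hz : z = 0
  · simp [hz, hnorm]
  have hz' : 0 < ‖z‖ := norm_pos_iff.2 hz
  have hz2 : ‖z‖ ^ 2 = ∑ l, z l ^ 2 := EuclideanSpace.real_norm_sq_eq z
  set B : Set ((Fin d → ℝ) × (Fin m → ℝ)) := {g | ¬ |(m : ℝ)⁻¹ * ∑ t,
    (∑ l : Fin d, hadamardEntry L ⌈g.2 t⌉₊ l * (g.1 l * z l)) ^ 2 - ‖z‖ ^ 2| ≤ δ * ‖z‖ ^ 2} with hB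
  have hBm : MeasurableSet B := by
    have : B = {g | |(m : ℝ)⁻¹ * ∑ t, (∑ l : Fin d, hadamardEntry L ⌈g.2 t⌉₊ l
        * (g.1 l * z l)) ^ 2 - ‖z‖ ^ 2| ≤ δ * ‖z‖ ^ 2}ᶜ := by
      ext g
      simp [hB]
    rw [this]
    refine (measurableSet_le (Measurable.abs (Measurable.sub_const (Measurable.const_mul
      (Finset.measurable_sum _ fun t _ => Measurable.pow_const
        (Finset.measurable_sum _ fun l _ => ?_) _) _) _)) measurable_const).compl
    have h1 : Measurable fun g : (Fin d → ℝ) × (Fin m → ℝ) => hadamardEntry L ⌈g.2 t⌉₊ l :=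
      (measurable_of_countable fun a : ℕ => hadamardEntry L a l).comp
        (Nat.measurable_ceil.comp ((measurable_pi_apply _).comp measurable_snd))
    fun_prop
  have hset : {g : Fin d ⊕ Fin m → ℝ | ¬ |‖(fastJL d m).sketch g z‖ ^ 2 - ‖z‖ ^ 2| ≤ δ * ‖z‖ ^ 2}
      = (MeasurableEquiv.sumPiEquivProdPi fun _ : Fin d ⊕ Fin m => ℝ) ⁻¹' B := by
    ext g
    exact (congrArg (fun u : ℝ => ¬ |u - ‖z‖ ^ 2| ≤ δ * ‖z‖ ^ 2) (hnorm g z)).to_iff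
  change (Measure.pi ν) {g : Fin d ⊕ Fin m → ℝ | ¬ _} ≤ _
  rw [hset, hmp.measure_preimage hBm.nullMeasurableSet, Measure.prod_apply hBm]
  -- the average fourth power of the transformed coordinates, given the signs
  set V : (Fin d → ℝ) → ℝ := fun s => (2 ^ L : ℝ)⁻¹ * ∑ a ∈ Finset.range (2 ^ L),
    (∑ l : Fin d, (hadamardEntry L a l * z l) * s l) ^ 4 with hV
  have hsign : ∀ᵐ s ∂(Measure.pi fun _ : Fin d => ν₁), ∀ l, s l ^ 2 = 1 := by
    rw [ae_all_iff]
    intro l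
    have h1 : ∀ᵐ x ∂ν₁, x ^ 2 = 1 := by
      rw [ae_iff, hν₁, uniformOn_eq_zero_iff (by simp)]
      ext x
      simp only [Set.mem_inter_iff, Set.mem_insert_iff, Set.mem_singleton_iff, Set.mem_ofPred_eq,
        Set.mem_empty_iff_false, iff_false, not_and, not_not]
      rintro (rfl | rfl) <;> norm_num
    exact (measurePreserving_eval (fun _ : Fin d => ν₁) l).quasiMeasurePreserving.ae h1
  have hcond : ∀ᵐ s ∂(Measure.pi fun _ : Fin d => ν₁),
      (Measure.pi fun _ : Fin m => ν₂) (Prod.mk s ⁻¹' B)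
        ≤ ENNReal.ofReal (V s / (m * (δ * ‖z‖ ^ 2) ^ 2)) := by
    filter_upwards [hsign] with s hs
    have hdev := pi_deviation_le ν₂
      (W := fun x => (∑ l : Fin d, hadamardEntry L ⌈x⌉₊ l * (s l * z l)) ^ 2) (V := V s) (m := m)
      (memLp_rowLaw L (fun a => (∑ l : Fin d, hadamardEntry L a l * (s l * z l)) ^ 2) 2)
      (by
        rw [hν₂, integral_rowLaw L fun a =>
          ((∑ l : Fin d, hadamardEntry L a l * (s l * z l)) ^ 2) ^ 2, hV]
        simp only [← pow_mul, mul_assoc, mul_comm (s _)]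
        rfl) hm (δ := δ * ‖z‖ ^ 2) (by positivity)
    have hmean : ∫ x, (∑ l : Fin d, hadamardEntry L ⌈x⌉₊ l * (s l * z l)) ^ 2 ∂ν₂ = ‖z‖ ^ 2 := by
      rw [hν₂, integral_rowLaw L fun a =>
          (∑ l : Fin d, hadamardEntry L a l * (s l * z l)) ^ 2,
        sum_hadamard_fin_sq hd fun l => s l * z l, hz2]
      simp [mul_pow, hs]
    rw [hmean] at hdev
    refine (measure_mono fun g hg => ?_).trans hdev
    simp only [Set.mem_preimage, hB, Set.mem_ofPred_eq, not_le] at hg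
    exact hg.le
  have hfour : ∀ a : ℕ, Integrable (fun s : Fin d → ℝ =>
        (∑ l : Fin d, (hadamardEntry L a l * z l) * s l) ^ 4) (Measure.pi fun _ : Fin d => ν₁) ∧
      ∫ s : Fin d → ℝ, (∑ l : Fin d, (hadamardEntry L a l * z l) * s l) ^ 4
        ∂(Measure.pi fun _ : Fin d => ν₁) ≤ 80 * (‖z‖ ^ 2) ^ 2 := by
    intro a
    obtain ⟨h4, -, h44⟩ := isSketchEntry_sign.sum (by norm_num)
      (fun l : Fin d => hadamardEntry L a l * z l) Finset.univ
    refine ⟨h4.integrable_pow_of_le (n := 4) le_rfl, h44.trans_eq ?_⟩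
    simp [mul_pow, hadamardEntry_sq, hz2]
  have hVint : Integrable V (Measure.pi fun _ : Fin d => ν₁) :=
    (integrable_finsetSum _ fun a _ => (hfour a).1).const_mul _
  have hV0 : ∀ s, 0 ≤ V s := fun s => by positivity
  have hVle : ∫ s, V s ∂(Measure.pi fun _ : Fin d => ν₁) ≤ 80 * (‖z‖ ^ 2) ^ 2 := by
    rw [hV, integral_const_mul, integral_finsetSum _ fun a _ => (hfour a).1]
    calc _ ≤ (2 ^ L : ℝ)⁻¹ * ∑ a ∈ Finset.range (2 ^ L), 80 * (‖z‖ ^ 2) ^ 2 := by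
          gcongr with a
          exact (hfour a).2
      _ = 80 * (‖z‖ ^ 2) ^ 2 := by simp
  refine (lintegral_mono_ae hcond).trans ?_
  rw [← ofReal_integral_eq_lintegral_ofReal (hVint.div_const _)
    (ae_of_all _ fun s => by have := hV0 s; positivity), integral_div]
  refine ENNReal.ofReal_le_ofReal ?_
  calc _ ≤ 80 * (‖z‖ ^ 2) ^ 2 / (m * (δ * ‖z‖ ^ 2) ^ 2) := by gcongr
    _ = 80 / (m * δ ^ 2) := by field_simp

/-! ## Rounding -/

theorem gridValue_mono {ε lo : ℝ} (hε : 0 < ε) (hlo : 0 < lo) (M : ℕ) :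
    Monotone (gridValue ε lo : Fin (M + 2) → ℝ) := by
  intro u v huv
  have h : (u : ℕ) ≤ v := huv
  unfold gridValue
  split_ifs with h1 h2 h2
  · exact le_rfl
  · positivity
  · omega
  · gcongr
    · linarith

theorem gridValue_gridIndex_of_nonpos {ε lo s : ℝ} {M : ℕ} (hs : s ≤ 0) :
    gridValue ε lo (gridIndex ε lo M s) = 0 := by
  simp [gridIndex, hs, gridValue]

theorem gridValue_gridIndex_of_pos {ε lo s : ℝ} {M : ℕ} (hs : 0 < s) :
    gridValue ε lo (gridIndex ε lo M s)
      = lo * (1 + ε / 4) ^ min ⌈Real.log (s / lo) / Real.log (1 + ε / 4)⌉₊ M := by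
  simp only [gridIndex, not_le.2 hs, if_false, gridValue]
  rw [if_neg (by omega)]
  congr 2
  omega

/-- Rounding up to the grid is accurate. -/
theorem gridValue_gridIndex_mem {ε lo hi s : ℝ} (hε : 0 < ε) (hlo : 0 < lo) (hs : 0 < s) :
    min s ((1 + ε / 4) * hi) ≤ gridValue ε lo (gridIndex ε lo (gridLevels ε lo hi) s) ∧
      gridValue ε lo (gridIndex ε lo (gridLevels ε lo hi) s) ≤ max lo ((1 + ε / 4) * s) := by
  rw [gridValue_gridIndex_of_pos hs]
  set β := 1 + ε / 4 with hβ
  have hβ1 : 1 < β := by linarith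
  have hβ0 : 0 < β := by linarith
  have hlog : 0 < Real.log β := Real.log_pos hβ1
  have key : ∀ x : ℝ, 0 < x → x ≤ lo * β ^ ⌈Real.log (x / lo) / Real.log β⌉₊ := by
    intro x hx
    have h1 := Nat.le_ceil (Real.log (x / lo) / Real.log β)
    rw [div_le_iff₀ hlog, ← Real.log_pow] at h1
    have h2 := (Real.log_le_log_iff (by positivity) (by positivity)).1 h1
    rw [div_le_iff₀ hlo] at h2
    linarith
  constructor
  · rcases le_total ⌈Real.log (s / lo) / Real.log β⌉₊ (gridLevels ε lo hi) with h | h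
    · rw [min_eq_left h]
      exact (min_le_left _ _).trans (key s hs)
    · rw [min_eq_right h]
      refine (min_le_right _ _).trans ?_
      rcases le_or_gt hi 0 with h0 | h0
      · exact (mul_nonpos_of_nonneg_of_nonpos hβ0.le h0).trans (by positivity)
      -- The extra `+ 1` in `gridLevels` supplies the factor `1 + ε/4` beyond `hi`.
      · rw [gridLevels, pow_succ]
        have := key hi h0
        nlinarith
  · set c := ⌈Real.log (s / lo) / Real.log β⌉₊ with hc
    have h1 : lo * β ^ min c (gridLevels ε lo hi) ≤ lo * β ^ c := by
      gcongr
      · exact hβ1.le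
      · exact min_le_left _ _
    refine h1.trans ?_
    rcases Nat.eq_zero_or_pos c with h0 | h0
    · simp [h0]
    · refine le_max_of_le_right ?_
      have h2 : 0 < Real.log (s / lo) / Real.log β := Nat.ceil_pos.1 h0
      have h3 := Nat.ceil_lt_add_one h2.le
      rw [← hc] at h3
      have h4 : ((c - 1 : ℕ) : ℝ) ≤ Real.log (s / lo) / Real.log β := by
        rw [Nat.cast_sub h0]
        push_cast
        linarith
      rw [le_div_iff₀ hlog, ← Real.log_pow] at h4
      have h5 := (Real.log_le_log_iff (by positivity) (by positivity)).1 h4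
      rw [le_div_iff₀ hlo] at h5
      have h6 : β ^ c = β ^ (c - 1) * β := by rw [← pow_succ, Nat.sub_add_cancel h0]
      rw [h6]
      nlinarith

/-- A squared norm within `1 ± ε/4` gives a norm within `1 ± ε/4`; rounding up costs one more
factor, and `(1 + ε/4)² ≤ 1 + ε`. Distance zero forces the estimate, and hence the answer, to be
exactly zero. -/
theorem rounding_accurate {ε lo hi D s : ℝ} (hε : 0 < ε) (hε1 : ε < 1) (hlo : 0 < lo)
    (hD : D = 0 ∨ lo ≤ D ∧ D ≤ hi) (hs0 : 0 ≤ s) (hs : |s ^ 2 - D ^ 2| ≤ ε / 4 * D ^ 2) :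
    (1 - ε) * D ≤ gridValue ε lo (gridIndex ε lo (gridLevels ε lo hi) s) ∧
      gridValue ε lo (gridIndex ε lo (gridLevels ε lo hi) s) ≤ (1 + ε) * D := by
  rcases hD with rfl | ⟨h1, h2⟩
  · have : s ≤ 0 := by
      have := (abs_le.1 hs).2
      nlinarith
    simp [gridValue_gridIndex_of_nonpos this]
  · have hD0 : 0 < D := hlo.trans_le h1
    obtain ⟨h3, h4⟩ := abs_le.1 hs
    have hup : s ≤ (1 + ε / 4) * D := by
      refine le_of_abs_le (abs_le_of_sq_le_sq ?_ (by positivity))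
      nlinarith [mul_pos hε (sq_pos_of_pos hD0), mul_pos (mul_pos hε hε) (sq_pos_of_pos hD0)]
    have hlow : (1 - ε / 4) * D ≤ s := by
      refine le_of_abs_le (abs_le_of_sq_le_sq ?_ hs0)
      nlinarith [mul_pos hε (sq_pos_of_pos hD0), mul_pos (mul_pos hε hε) (sq_pos_of_pos hD0),
        mul_pos (mul_pos hε (sub_pos.2 hε1)) (sq_pos_of_pos hD0)]
    have hspos : 0 < s := lt_of_lt_of_le (mul_pos (by linarith) hD0) hlow
    obtain ⟨h5, h6⟩ := gridValue_gridIndex_mem (hi := hi) hε hlo hspos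
    refine ⟨le_trans (le_min ?_ ?_) h5, h6.trans (max_le ?_ ?_)⟩
    · nlinarith
    · nlinarith
    · nlinarith
    · calc (1 + ε / 4) * s ≤ (1 + ε / 4) * ((1 + ε / 4) * D) := by gcongr
        _ ≤ (1 + ε) * D := by nlinarith [mul_pos hε hD0, mul_pos (mul_pos hε (sub_pos.2 hε1)) hD0]

/-! ## Accuracy of the private median -/

/-- The smallest `u` with at least half of the entries at most `u` works: by minimality at most half
of the entries lie strictly below it. -/
theorem exists_medianScore_ge {k N : ℕ} [NeZero N] (v : Fin k → Fin N) :
    ∃ u, k ≤ 2 * medianScore v u := by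
  classical
  obtain ⟨N, rfl⟩ := Nat.exists_eq_succ_of_ne_zero (NeZero.ne N)
  have hlast : ∃ u : Fin (N + 1), k ≤ 2 * (Finset.univ.filter fun j => v j ≤ u).card := by
    refine ⟨Fin.last N, ?_⟩
    have : (Finset.univ.filter fun j => v j ≤ Fin.last N) = Finset.univ := by
      ext j; simp [Fin.le_last]
    simp only [this, Finset.card_univ, Fintype.card_fin]
    omega
  obtain ⟨u, hu, hmin⟩ := (Set.toFinite
    {u : Fin (N + 1) | k ≤ 2 * (Finset.univ.filter fun j => v j ≤ u).card}).exists_minimal hlast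
  refine ⟨u, ?_⟩
  have hge : k ≤ 2 * (Finset.univ.filter fun j => u ≤ v j).card := by
    by_contra! hcon
    have hcomp : (Finset.univ.filter fun j => u ≤ v j).card
        + (Finset.univ.filter fun j => v j < u).card = k := by
      have := Finset.card_filter_add_card_filter_not (s := (Finset.univ : Finset (Fin k)))
        (fun j => u ≤ v j)
      simpa only [not_le, Finset.card_univ, Fintype.card_fin] using this
    rcases Nat.eq_zero_or_pos k with hk | hk
    · omega
    by_cases h0 : (u : ℕ) = 0
    · have : (Finset.univ.filter fun j => v j < u) = ∅ := by
        ext j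
        simp only [Finset.mem_filter, Finset.mem_univ, true_and, Finset.notMem_empty, iff_false,
          not_lt, Fin.le_def]
        omega
      rw [this, Finset.card_empty] at hcomp
      omega
    · set u' : Fin (N + 1) := ⟨u - 1, by omega⟩ with hu'
      have hsame : (Finset.univ.filter fun j => v j ≤ u') = Finset.univ.filter fun j => v j < u := by
        ext j
        simp only [Finset.mem_filter, Finset.mem_univ, true_and, Fin.le_def, Fin.lt_def, hu']
        omega
      have hmem : k ≤ 2 * (Finset.univ.filter fun j => v j ≤ u').card := by
        rw [hsame]; omega
      have := hmin hmem (by rw [Fin.le_def, hu']; simp)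
      rw [Fin.le_def, hu'] at this
      simp only at this
      omega
  have hu : k ≤ 2 * (Finset.univ.filter fun j => v j ≤ u).card := hu
  simp only [medianScore]
  omega

/-- The normalizing constant is at least `e^(k/4)`, the weight of a true median. -/
theorem privMed_le {k N : ℕ} [NeZero N] (v : Fin k → Fin N) (u : Fin N) {t : ℕ}
    (h : medianScore v u ≤ t) :
    privMed v u ≤ ENNReal.ofReal (Real.exp ((t : ℝ) / 2 - k / 4)) := by
  obtain ⟨u₀, h₀⟩ := exists_medianScore_ge v
  have h1 : ENNReal.ofReal (Real.exp ((k : ℝ) / 4)) ≤ ∑' u, medianWeight v u := by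
    refine le_trans ?_ (ENNReal.le_tsum u₀)
    refine ENNReal.ofReal_le_ofReal (Real.exp_le_exp.2 ?_)
    have : (k : ℝ) ≤ 2 * medianScore v u₀ := by exact_mod_cast h₀
    linarith
  rw [privMed, PMF.normalize_apply, Real.exp_sub, ENNReal.ofReal_div_of_pos (Real.exp_pos _),
    div_eq_mul_inv]
  gcongr
  rw [medianWeight]
  gcongr

/-- If `g u` is too small, every entry at most `u` is inaccurate as well; if it is too large, every
entry at least `u` is. The smaller count is therefore at most the number of inaccurate entries. -/
theorem medianScore_le_card {k N : ℕ} {g : Fin N → ℝ} (hg : Monotone g) {a b : ℝ}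
    (v : Fin k → Fin N) {u : Fin N} (hu : ¬ (a ≤ g u ∧ g u ≤ b)) :
    medianScore v u ≤ (Finset.univ.filter fun j => ¬ (a ≤ g (v j) ∧ g (v j) ≤ b)).card := by
  by_cases h : a ≤ g u
  · refine (min_le_right _ _).trans (Finset.card_le_card fun j hj => ?_)
    simp only [Finset.mem_filter, Finset.mem_univ, true_and] at hj ⊢
    exact fun hc => hu ⟨h, (hg hj).trans hc.2⟩
  · refine (min_le_left _ _).trans (Finset.card_le_card fun j hj => ?_)
    simp only [Finset.mem_filter, Finset.mem_univ, true_and] at hj ⊢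
    exact fun hc => h (hc.1.trans (hg hj))

/-! ## The answer as a function of the rounded estimates of all sketches -/

/-- The index of the answer, if `v s` is the rounded estimate obtained from sketch `s`. -/
def answer {r N : ℕ} [NeZero r] [NeZero N] (k : ℕ) (v : Fin r → Fin N) : PMF (Fin N) :=
  (PMF.uniformOfFintype (Fin k → Fin r)).bind fun S => privMed fun j => v (S j)

theorem respond_eq_map_answer {d m r n : ℕ} [NeZero r] (F : SketchFamily d m) (k : ℕ)
    (ε lo hi : ℝ) (tape : Fin r × F.Cell → ℝ) (store : StoredWord r n m → ℝ) (q : Query d n) :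
    respond F k ε lo hi tape store q = (answer k fun s =>
      gridIndex ε lo (gridLevels ε lo hi) (estimate F tape store q s)).map (gridValue ε lo) := by
  rw [respond, answer, PMF.map_bind]

theorem answer_apply {r N : ℕ} [NeZero r] [NeZero N] (k : ℕ) (v : Fin r → Fin N) (u : Fin N) :
    answer k v u = ((r : ℝ≥0∞) ^ k)⁻¹ * ∑ S : Fin k → Fin r, privMed (fun j => v (S j)) u := by
  simp [answer, PMF.bind_apply, tsum_fintype, Finset.mul_sum]

/-- The exponential moment of a count over independent samples factorizes. -/
theorem sum_exp_half_card {r : ℕ} (k : ℕ) (p : Fin r → Prop) [DecidablePred p] :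
    ∑ S : Fin k → Fin r, Real.exp (((Finset.univ.filter fun j => p (S j)).card : ℝ) / 2)
      = (∑ s, if p s then Real.exp (1 / 2) else 1) ^ k := by
  rw [Fintype.sum_pow]
  refine Finset.sum_congr rfl fun S _ => ?_
  rw [Finset.prod_ite, Finset.prod_const, Finset.prod_const_one, mul_one, ← Real.exp_nat_mul]
  congr 1
  ring

/-- If at most a quarter of the sketches are inaccurate, then so is the answer, except with
probability `N e ^ (-k / 16)`. -/
theorem sum_answer_inaccurate_le {r N : ℕ} [NeZero r] [NeZero N] (k : ℕ) (v : Fin r → Fin N)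
    {g : Fin N → ℝ} (hg : Monotone g) {a b : ℝ}
    (hbad : 4 * (Finset.univ.filter fun s => ¬ (a ≤ g (v s) ∧ g (v s) ≤ b)).card ≤ r) :
    (∑ u, answer k v u * if a ≤ g u ∧ g u ≤ b then 0 else 1)
      ≤ ENNReal.ofReal (N * Real.exp (-(k / 16 : ℝ))) := by
  classical
  set p : Fin r → Prop := fun s => ¬ (a ≤ g (v s) ∧ g (v s) ≤ b) with hp
  have hr : (0 : ℝ) < r := by exact_mod_cast Nat.pos_of_ne_zero (NeZero.ne r)
  have h1 : ∀ u, (answer k v u * if a ≤ g u ∧ g u ≤ b then (0 : ℝ≥0∞) else 1)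
      ≤ ENNReal.ofReal (((r : ℝ) ^ k)⁻¹ * ∑ S : Fin k → Fin r,
        Real.exp (((Finset.univ.filter fun j => p (S j)).card : ℝ) / 2 - k / 4)) := by
    intro u
    split_ifs with hu
    · simp
    rw [mul_one, answer_apply, ENNReal.ofReal_mul (by positivity),
      ENNReal.ofReal_inv_of_pos (by positivity), ENNReal.ofReal_pow (by positivity),
      ENNReal.ofReal_natCast, ENNReal.ofReal_sum_of_nonneg fun _ _ => (Real.exp_pos _).le]
    gcongr with S
    exact privMed_le _ u (medianScore_le_card hg _ hu)
  refine (Finset.sum_le_sum fun u _ => h1 u).trans ?_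
  rw [Finset.sum_const, Finset.card_univ, Fintype.card_fin, ← ENNReal.ofReal_nsmul, nsmul_eq_mul]
  refine ENNReal.ofReal_le_ofReal (mul_le_mul_of_nonneg_left ?_ (Nat.cast_nonneg _))
  have h2 : ∑ S : Fin k → Fin r,
      Real.exp (((Finset.univ.filter fun j => p (S j)).card : ℝ) / 2 - k / 4)
      = Real.exp (-(k / 4 : ℝ)) * (∑ s, if p s then Real.exp (1 / 2) else 1) ^ k := by
    rw [← sum_exp_half_card k p, Finset.mul_sum]
    refine Finset.sum_congr rfl fun S _ => ?_
    rw [← Real.exp_add]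
    congr 1
    ring
  -- As `e^(1/2) - 1 ≤ 2/3` and at most a quarter of the terms are inaccurate, the average is at
  -- most `7/6 ≤ 1 + 3/16 ≤ e^(3/16)`. Against `e^(-1/4)` this leaves `e^(-1/16)` per sample.
  have h3 : (∑ s, if p s then Real.exp (1 / 2) else 1) ≤ r * Real.exp (3 / 16) := by
    have e : ∀ s, (if p s then Real.exp (1 / 2) else 1)
        = 1 + (Real.exp (1 / 2) - 1) * if p s then 1 else 0 := fun s => by split_ifs <;> ring
    simp only [e, Finset.sum_add_distrib, ← Finset.mul_sum, Finset.sum_const,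
      Finset.card_univ, Fintype.card_fin, nsmul_eq_mul, mul_one]
    have h8 : (∑ s, if p s then (1 : ℝ) else 0) = (Finset.univ.filter fun s => p s).card :=
      Finset.sum_boole _ _
    rw [h8]
    have h4 : (4 : ℝ) * (Finset.univ.filter fun s => p s).card ≤ r := by exact_mod_cast hbad
    have h5 := Real.add_one_le_exp (3 / 16 : ℝ)
    have h6 := exp_half_le
    have h7 := Real.add_one_le_exp (1 / 2 : ℝ)
    nlinarith [mul_le_mul_of_nonneg_left h5 hr.le]
  rw [h2]
  calc ((r : ℝ) ^ k)⁻¹ * (Real.exp (-(k / 4 : ℝ))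
        * (∑ s, if p s then Real.exp (1 / 2) else 1) ^ k)
      ≤ ((r : ℝ) ^ k)⁻¹ * (Real.exp (-(k / 4 : ℝ)) * (r * Real.exp (3 / 16)) ^ k) := by
        gcongr
    _ = Real.exp (-(k / 4 : ℝ)) * Real.exp (3 / 16) ^ k := by
        rw [mul_pow]; field_simp
    _ = Real.exp (-(k / 16 : ℝ)) := by
        rw [← Real.exp_nat_mul, ← Real.exp_add]
        congr 1
        ring

/-! ## Privacy amplification by subsampling -/

/-- Only the terms in `J` can change, and each changed term is at most `e` times the average of all
values `g (w s)`. -/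
theorem sum_le_of_differ {α : Type*} {r : ℕ} [NeZero r] {v w : Fin r → α} {J : Finset (Fin r)}
    (h : ∀ s, s ∉ J → v s = w s) {e : ℝ≥0∞} {g : α → ℝ≥0∞} (hg : ∀ x y, g x ≤ e * g y) :
    ∑ s, g (v s) ≤ (1 + e * J.card / r) * ∑ s, g (w s) := by
  classical
  have hr0 : (r : ℝ≥0∞) ≠ 0 := by exact_mod_cast NeZero.ne r
  have h1 : ∑ s, g (v s) ≤ ∑ s, g (w s) + ∑ s ∈ J, g (v s) := by
    rw [← Finset.sum_sdiff (Finset.subset_univ J)]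
    gcongr
    exact (Finset.sum_congr rfl fun s hs => by rw [h s (Finset.mem_sdiff.1 hs).2]).trans_le
      (Finset.sum_le_sum_of_subset (Finset.subset_univ _))
  have h2 : ∀ s, g (v s) ≤ e / r * ∑ s, g (w s) := by
    intro s
    have : r * g (v s) ≤ e * ∑ s, g (w s) := by
      rw [Finset.mul_sum]
      calc (r : ℝ≥0∞) * g (v s) = ∑ _s : Fin r, g (v s) := by simp
        _ ≤ _ := Finset.sum_le_sum fun s' _ => hg _ _
    rw [ENNReal.mul_comm_div, ← mul_div_assoc, ENNReal.le_div_iff_mul_le (.inl hr0) (.inl (by simp)),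
      mul_comm]
    exact this
  calc ∑ s, g (v s) ≤ ∑ s, g (w s) + ∑ s ∈ J, e / r * ∑ s, g (w s) :=
        h1.trans (add_le_add_right (Finset.sum_le_sum fun s _ => h2 s) _)
    _ = (1 + e * J.card / r) * ∑ s, g (w s) := by
        rw [Finset.sum_const, nsmul_eq_mul, add_mul, one_mul]
        simp only [div_eq_mul_inv]
        ring

/-- The samples are exchanged one at a time with the others held fixed; each exchange alters one row
of the database and costs the factor `1 + e |J| / r`. -/
theorem sum_comp_le_of_differ {α : Type*} {r : ℕ} [NeZero r] {v w : Fin r → α}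
    {J : Finset (Fin r)} (h : ∀ s, s ∉ J → v s = w s) {e : ℝ≥0∞} (k : ℕ)
    (G : (Fin k → α) → ℝ≥0∞)
    (hG : ∀ x y : Fin k → α, (∃ j, ∀ i, i ≠ j → x i = y i) → G x ≤ e * G y) :
    ∑ S : Fin k → Fin r, G (fun j => v (S j))
      ≤ (1 + e * J.card / r) ^ k * ∑ S : Fin k → Fin r, G (fun j => w (S j)) := by
  induction k with
  | zero =>
    have : ∀ S : Fin 0 → Fin r, (fun j => v (S j)) = fun j => w (S j) :=
      fun S => Subsingleton.elim _ _
    simp [this]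
  | succ k ih =>
    have hcons : ∀ (f : Fin r → α) (s : Fin r) (S : Fin k → Fin r),
        (fun j => f ((Fin.cons s S : Fin (k + 1) → Fin r) j)) = Fin.cons (f s) fun j => f (S j) :=
      fun f s S => by
        funext j
        refine Fin.cases ?_ (fun j => ?_) j <;> simp
    have hsum : ∀ f : Fin r → α, ∑ S : Fin (k + 1) → Fin r, G (fun j => f (S j))
        = ∑ s, ∑ S : Fin k → Fin r, G (Fin.cons (f s) fun j => f (S j)) := fun f => by
      rw [← (Fin.consEquiv fun _ => Fin r).sum_comp, Fintype.sum_prod_type]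
      simp only [Fin.consEquiv_apply, hcons]
    rw [hsum, hsum]
    set c := 1 + e * J.card / r
    calc ∑ s, ∑ S : Fin k → Fin r, G (Fin.cons (v s) fun j => v (S j))
        ≤ ∑ s, c ^ k * ∑ S : Fin k → Fin r, G (Fin.cons (v s) fun j => w (S j)) := by
          refine Finset.sum_le_sum fun s _ => ih (fun x => G (Fin.cons (v s) x)) ?_
          rintro x y ⟨j, hj⟩
          refine hG _ _ ⟨j.succ, fun i hi => ?_⟩
          revert hi
          refine Fin.cases ?_ (fun i => ?_) i
          · simp
          · intro hi
            simpa using hj i fun h => hi (by rw [h])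
      _ = c ^ k * ∑ S : Fin k → Fin r, ∑ s, G (Fin.cons (v s) fun j => w (S j)) := by
          rw [← Finset.mul_sum, Finset.sum_comm]
      _ ≤ c ^ k * ∑ S : Fin k → Fin r, c * ∑ s, G (Fin.cons (w s) fun j => w (S j)) := by
          gcongr with S
          refine sum_le_of_differ (g := fun x => G (Fin.cons x fun j => w (S j))) h fun x y => ?_
          refine hG _ _ ⟨0, fun i hi => ?_⟩
          obtain ⟨i, rfl⟩ := Fin.exists_succ_eq.2 hi
          simp
      _ = _ := by
          rw [← Finset.mul_sum, Finset.sum_comm, ← mul_assoc, ← pow_succ]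

/-- Amplification by subsampling: privacy parameter `1` improves to order `|J| k / r`, because a
sample rarely falls into `J`. The `3` bounds Euler's number. -/
theorem answer_le_of_differ {r N : ℕ} [NeZero r] [NeZero N] (k : ℕ) {v w : Fin r → Fin N}
    {J : Finset (Fin r)} (h : ∀ s, s ∉ J → v s = w s) (u : Fin N) :
    answer k v u ≤ ENNReal.ofReal (Real.exp (3 * J.card * k / r)) * answer k w u := by
  have hr : (0 : ℝ) < r := by exact_mod_cast Nat.pos_of_ne_zero (NeZero.ne r)
  have h1 := sum_comp_le_of_differ h (e := ENNReal.ofReal (Real.exp 1)) k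
    (fun x : Fin k → Fin N => privMed x u) (fun x y hxy => by
      have := privMed_isPureDP x y hxy {u}
      rwa [PMF.toOuterMeasure_apply_singleton, PMF.toOuterMeasure_apply_singleton] at this)
  have hc : (1 + ENNReal.ofReal (Real.exp 1) * J.card / r) ^ k
      ≤ ENNReal.ofReal (Real.exp (3 * J.card * k / r)) := by
    have e1 : 1 + ENNReal.ofReal (Real.exp 1) * J.card / r
        = ENNReal.ofReal (1 + Real.exp 1 * J.card / r) := by
      rw [ENNReal.ofReal_add zero_le_one (by positivity), ENNReal.ofReal_one,
        ENNReal.ofReal_div_of_pos hr, ENNReal.ofReal_mul (Real.exp_pos _).le,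
        ENNReal.ofReal_natCast, ENNReal.ofReal_natCast]
    rw [e1, ← ENNReal.ofReal_pow (by positivity)]
    refine ENNReal.ofReal_le_ofReal ?_
    have e2 : 3 * (J.card : ℝ) * k / r = k * (3 * J.card / r) := by ring
    rw [e2, Real.exp_nat_mul]
    gcongr
    have e3 := Real.add_one_le_exp (3 * (J.card : ℝ) / r)
    have e4 : Real.exp 1 * J.card / r ≤ 3 * J.card / r := by
      gcongr
      exact Real.exp_one_lt_three.le
    linarith
  rw [answer_apply, answer_apply]
  calc _ ≤ ((r : ℝ≥0∞) ^ k)⁻¹ * (ENNReal.ofReal (Real.exp (3 * J.card * k / r))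
        * ∑ S : Fin k → Fin r, privMed (fun j => w (S j)) u) := by
        gcongr
        exact h1.trans (mul_le_mul_left hc _)
    _ = _ := by ring

/-! ## Change of measure in one round -/

/-- Cauchy-Schwarz bounds the left side by `∑ p²/q · ∑ q ψ²`, and `∑ p²/q = 1 + ∑ (p - q)²/q` with
`|p - q| ≤ (C - 1) q`. The excess is quadratic in `C - 1`, and this is the origin of `√Q`. -/
theorem sq_sum_mul_le_of_ratio {α : Type*} [Fintype α] {C : ℝ} (p q ψ : α → ℝ)
    (hp : ∀ a, 0 ≤ p a) (hq : ∀ a, 0 ≤ q a) (hp1 : ∑ a, p a = 1) (hq1 : ∑ a, q a = 1)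
    (h₁ : ∀ a, p a ≤ C * q a) (h₂ : ∀ a, q a ≤ C * p a) :
    (∑ a, p a * ψ a) ^ 2 ≤ (1 + (C - 1) ^ 2) * ∑ a, q a * ψ a ^ 2 := by
  have hzero : ∀ a, q a = 0 → p a = 0 := fun a h => le_antisymm (by simpa [h] using h₁ a) (hp a)
  have hcs := Finset.sum_sq_le_sum_mul_sum_of_sq_le_mul Finset.univ (r := fun a => p a * ψ a)
    (f := fun a => p a ^ 2 / q a) (g := fun a => q a * ψ a ^ 2)
    (fun a _ => div_nonneg (sq_nonneg _) (hq a)) (fun a _ => mul_nonneg (hq a) (sq_nonneg _))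
    (fun a _ => by
      rcases eq_or_ne (q a) 0 with h | h
      · simp [h, hzero a h]
      · exact le_of_eq (by field_simp))
  refine hcs.trans (mul_le_mul_of_nonneg_right ?_
    (Finset.sum_nonneg fun a _ => mul_nonneg (hq a) (sq_nonneg _)))
  have hpt : ∀ a, p a ^ 2 / q a ≤ 2 * p a - q a + (C - 1) ^ 2 * q a := by
    intro a
    rcases (hq a).eq_or_lt with h | h
    · simp [← h, hzero a h.symm]
    · rw [div_le_iff₀ h]
      have hC : 1 ≤ C := by
        by_contra! hC
        have hpa : 0 < p a := by
          rcases (hp a).eq_or_lt with h' | h'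
          · have := h₂ a
            rw [← h'] at this
            linarith
          · exact h'
        have := h₁ a
        have := h₂ a
        nlinarith
      have e1 : p a - q a ≤ (C - 1) * q a := by linarith [h₁ a]
      have e2 : -((C - 1) * q a) ≤ p a - q a := by nlinarith [h₁ a, h₂ a]
      nlinarith [sq_le_sq' e2 e1]
  refine (Finset.sum_le_sum fun a _ => hpt a).trans (le_of_eq ?_)
  rw [Finset.sum_add_distrib, Finset.sum_sub_distrib, ← Finset.mul_sum, ← Finset.mul_sum, hp1, hq1]
  ring

theorem PMF.sq_sum_mul_le_of_ratio {α : Type*} [Fintype α] {C : ℝ} (p q : PMF α) {ψ : α → ℝ≥0∞}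
    (hψ : ∀ a, ψ a ≠ ∞) (hC : 0 ≤ C)
    (h₁ : ∀ a, p a ≤ ENNReal.ofReal C * q a) (h₂ : ∀ a, q a ≤ ENNReal.ofReal C * p a) :
    (∑ a, p a * ψ a) ^ 2 ≤ ENNReal.ofReal (1 + (C - 1) ^ 2) * ∑ a, q a * ψ a ^ 2 := by
  have hsum : ∀ p : PMF α, ∑ a, (p a).toReal = 1 := fun p => by
    rw [← ENNReal.toReal_sum fun a _ => p.apply_ne_top a, ← tsum_fintype (L := .unconditional _),
      p.tsum_coe, ENNReal.toReal_one]
  have hle : ∀ p q : PMF α, (∀ a, p a ≤ ENNReal.ofReal C * q a) →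
      ∀ a, (p a).toReal ≤ C * (q a).toReal := fun p q h a => by
    have := ENNReal.toReal_mono (ENNReal.mul_ne_top ENNReal.ofReal_ne_top (q.apply_ne_top a)) (h a)
    rwa [ENNReal.toReal_mul, ENNReal.toReal_ofReal hC] at this
  have key := AdaptiveDistance.sq_sum_mul_le_of_ratio (C := C) (fun a => (p a).toReal)
    (fun a => (q a).toReal) (fun a => (ψ a).toReal) (fun _ => ENNReal.toReal_nonneg)
    (fun _ => ENNReal.toReal_nonneg) (hsum p) (hsum q) (hle p q h₁) (hle q p h₂)
  have e1 : ∑ a, p a * ψ a = ENNReal.ofReal (∑ a, (p a).toReal * (ψ a).toReal) := by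
    rw [ENNReal.ofReal_sum_of_nonneg fun _ _ => by positivity]
    refine Finset.sum_congr rfl fun a _ => ?_
    rw [ENNReal.ofReal_mul ENNReal.toReal_nonneg, ENNReal.ofReal_toReal (p.apply_ne_top a),
      ENNReal.ofReal_toReal (hψ a)]
  have e2 : ∑ a, q a * ψ a ^ 2 = ENNReal.ofReal (∑ a, (q a).toReal * (ψ a).toReal ^ 2) := by
    rw [ENNReal.ofReal_sum_of_nonneg fun _ _ => by positivity]
    refine Finset.sum_congr rfl fun a _ => ?_
    rw [ENNReal.ofReal_mul ENNReal.toReal_nonneg, ENNReal.ofReal_toReal (q.apply_ne_top a),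
      ENNReal.ofReal_pow ENNReal.toReal_nonneg, ENNReal.ofReal_toReal (hψ a)]
  rw [e1, e2, ← ENNReal.ofReal_pow (Finset.sum_nonneg fun _ _ => by positivity),
    ← ENNReal.ofReal_mul (by positivity)]
  exact ENNReal.ofReal_le_ofReal key

/-! ## Expectations over transcripts -/

theorem _root_.PMF.tsum_bind_mul {α β : Type*} (p : PMF α) (f : α → PMF β) (φ : β → ℝ≥0∞) :
    ∑' b, p.bind f b * φ b = ∑' a, p a * ∑' b, f a b * φ b := by
  simp only [PMF.bind_apply, ← ENNReal.tsum_mul_right, ← ENNReal.tsum_mul_left]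
  rw [ENNReal.tsum_comm]
  simp only [mul_assoc]

theorem _root_.PMF.tsum_pure_mul {α : Type*} (a : α) (φ : α → ℝ≥0∞) :
    ∑' b, PMF.pure a b * φ b = φ a := by
  classical
  rw [tsum_eq_single a fun b hb => by simp [hb]]
  simp

theorem _root_.PMF.tsum_map_mul {α β : Type*} (p : PMF α) (f : α → β) (φ : β → ℝ≥0∞) :
    ∑' b, p.map f b * φ b = ∑' a, p a * φ (f a) := by
  rw [← PMF.bind_pure_comp, PMF.tsum_bind_mul]
  simp only [Function.comp, PMF.tsum_pure_mul]

/-- The expectation of `φ` over the transcript of the first `t` rounds, if a query `q` is answered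
with `g u`, where `u` has law `p q`. -/
def expect {𝒬 : Type*} {N : ℕ} (p : 𝒬 → PMF (Fin N)) (g : Fin N → ℝ) (adv : List (𝒬 × ℝ) → 𝒬) :
    ℕ → (List (𝒬 × ℝ) → ℝ≥0∞) → ℝ≥0∞
  | 0, φ => φ []
  | t + 1, φ => expect p g adv t fun h => ∑ u, p (adv h) u * φ (h ++ [(adv h, g u)])

section Expect

variable {𝒬 : Type*} {N : ℕ} (p p' : 𝒬 → PMF (Fin N)) (g : Fin N → ℝ) (adv : List (𝒬 × ℝ) → 𝒬)

theorem tsum_transcript_mul (t : ℕ) (φ : List (𝒬 × ℝ) → ℝ≥0∞) :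
    ∑' h, transcript (fun q => (p q).map g) adv t h * φ h = expect p g adv t φ := by
  induction t generalizing φ with
  | zero => exact PMF.tsum_pure_mul _ _
  | succ t ih =>
    rw [transcript, PMF.tsum_bind_mul, expect, ← ih]
    simp only [PMF.map_comp, PMF.tsum_map_mul, tsum_fintype, Function.comp]

theorem sum_pmf_eq_one (p : PMF (Fin N)) : ∑ u, p u = 1 := by
  rw [← tsum_fintype (L := .unconditional _), p.tsum_coe]

theorem expect_mono {φ ψ : List (𝒬 × ℝ) → ℝ≥0∞} (h : ∀ l, φ l ≤ ψ l) (t : ℕ) :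
    expect p g adv t φ ≤ expect p g adv t ψ := by
  induction t generalizing φ ψ with
  | zero => exact h _
  | succ t ih => exact ih fun l => Finset.sum_le_sum fun u _ => by gcongr; exact h _

theorem expect_add (φ ψ : List (𝒬 × ℝ) → ℝ≥0∞) (t : ℕ) :
    expect p g adv t (fun h => φ h + ψ h) = expect p g adv t φ + expect p g adv t ψ := by
  induction t generalizing φ ψ with
  | zero => rfl
  | succ t ih => simp only [expect, mul_add, Finset.sum_add_distrib, ih]

theorem expect_const_mul (c : ℝ≥0∞) (φ : List (𝒬 × ℝ) → ℝ≥0∞) (t : ℕ) :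
    expect p g adv t (fun h => c * φ h) = c * expect p g adv t φ := by
  induction t generalizing φ with
  | zero => rfl
  | succ t ih => simp only [expect, mul_left_comm _ c, ← Finset.mul_sum, ih]

theorem expect_const (c : ℝ≥0∞) (t : ℕ) : expect p g adv t (fun _ => c) = c := by
  induction t with
  | zero => rfl
  | succ t ih => simp only [expect, ← Finset.sum_mul, sum_pmf_eq_one, one_mul, ih]

theorem expect_sum {κ : Type*} (s : Finset κ) (φ : κ → List (𝒬 × ℝ) → ℝ≥0∞) (t : ℕ) :
    expect p g adv t (fun h => ∑ i ∈ s, φ i h) = ∑ i ∈ s, expect p g adv t (φ i) := by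
  classical
  induction s using Finset.induction_on with
  | empty => simp [expect_const]
  | insert i s hi ih => simp only [Finset.sum_insert hi, expect_add, ih]

/-- Change of measure: the second moments grow by a constant factor per round. -/
theorem expect_sq_le {C : ℝ} (hC : 0 ≤ C) (h₁ : ∀ q u, p q u ≤ ENNReal.ofReal C * p' q u)
    (h₂ : ∀ q u, p' q u ≤ ENNReal.ofReal C * p q u) {φ : List (𝒬 × ℝ) → ℝ≥0∞} (hφ : ∀ l, φ l ≤ 1)
    (t : ℕ) : expect p g adv t φ ^ 2
      ≤ ENNReal.ofReal (1 + (C - 1) ^ 2) ^ t * expect p' g adv t fun h => φ h ^ 2 := by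
  induction t generalizing φ with
  | zero => simp [expect]
  | succ t ih =>
    have h1 : ∀ l, ∑ u, p (adv l) u * φ (l ++ [(adv l, g u)]) ≤ 1 := fun l => by
      rw [← sum_pmf_eq_one (p (adv l))]
      exact Finset.sum_le_sum fun u _ => mul_le_of_le_one_right' (hφ _)
    -- The last round is already summed into the function to which `ih` applies; the one-round
    -- inequality then handles its square. The bound by `1` ensures finiteness.
    refine (ih h1).trans ?_
    rw [pow_succ _ t, mul_assoc, expect,
      ← expect_const_mul p' g adv (ENNReal.ofReal (1 + (C - 1) ^ 2))]
    refine mul_le_mul_right ?_ _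
    refine expect_mono _ _ _ (fun l => ?_) t
    exact PMF.sq_sum_mul_le_of_ratio _ _ (fun u => ne_top_of_le_ne_top ENNReal.one_ne_top (hφ _)) hC
      (h₁ _) (h₂ _)

/-- An adversary reaches only finitely many transcripts, since answers range over a finite set.
Hence measurability is needed for each fixed transcript only, and the adversary itself may be
arbitrary. -/
theorem measurable_expect {X : Type*} [MeasurableSpace X] {p : X → 𝒬 → PMF (Fin N)}
    (hp : ∀ q u, Measurable fun x => p x q u) {φ : X → List (𝒬 × ℝ) → ℝ≥0∞}
    (hφ : ∀ h, Measurable fun x => φ x h) (t : ℕ) :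
    Measurable fun x => expect (p x) g adv t (φ x) := by
  induction t generalizing φ with
  | zero => exact hφ _
  | succ t ih => exact ih fun h => Finset.measurable_sum _ fun u _ => (hp _ u).mul (hφ _)

theorem lintegral_expect {X : Type*} [MeasurableSpace X] (μ : Measure X)
    {φ : X → List (𝒬 × ℝ) → ℝ≥0∞} (hφ : ∀ h, Measurable fun x => φ x h) (t : ℕ) :
    ∫⁻ x, expect p g adv t (φ x) ∂μ = expect p g adv t fun h => ∫⁻ x, φ x h ∂μ := by
  induction t generalizing φ with
  | zero => rfl
  | succ t ih =>
    simp only [expect]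
    rw [ih fun h => Finset.measurable_sum _ fun u _ => (hφ _).const_mul _]
    congr 1
    funext h
    rw [lintegral_finsetSum _ fun u _ => (hφ _).const_mul _]
    exact Finset.sum_congr rfl fun u _ => lintegral_const_mul _ (hφ _)

/-- The union bound over the rounds. -/
theorem expect_exists_le {I : 𝒬 × ℝ → Prop} {B : 𝒬 → Prop} [DecidablePred I] [DecidablePred B]
    {β : ℝ≥0∞} (hβ : ∀ q, ¬ B q → ∑ u, p q u * (if I (q, g u) then 1 else 0) ≤ β) (t : ℕ) :
    (expect p g adv t fun h => if ∃ e ∈ h, I e then 1 else 0)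
      ≤ (∑ i ∈ Finset.range t, expect p g adv i fun h => if B (adv h) then 1 else 0) + t * β := by
  induction t with
  | zero => simp [expect]
  | succ t ih =>
    have h1 : ∀ h : List (𝒬 × ℝ), (∑ u, p (adv h) u *
        if ∃ e ∈ h ++ [(adv h, g u)], I e then (1 : ℝ≥0∞) else 0)
        ≤ (if ∃ e ∈ h, I e then 1 else 0) + ((if B (adv h) then 1 else 0) + β) := by
      intro h
      have h2 : ∀ u, (if ∃ e ∈ h ++ [(adv h, g u)], I e then (1 : ℝ≥0∞) else 0)
          ≤ (if ∃ e ∈ h, I e then 1 else 0) + if I (adv h, g u) then 1 else 0 := by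
        intro u
        simp only [List.mem_append, List.mem_singleton, or_and_right, exists_or, exists_eq_left]
        split_ifs <;> simp_all
      have h3 : (∑ u, p (adv h) u * if I (adv h, g u) then (1 : ℝ≥0∞) else 0)
          ≤ (if B (adv h) then 1 else 0) + β := by
        by_cases hB : B (adv h)
        · simp only [hB, if_true]
          have h4 : ∀ u, (if I (adv h, g u) then (1 : ℝ≥0∞) else 0) ≤ 1 := fun u => by
            split_ifs <;> simp
          exact le_add_right ((Finset.sum_le_sum fun u _ =>
            mul_le_of_le_one_right' (h4 u)).trans (sum_pmf_eq_one (p (adv h))).le)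
        · simpa [hB] using hβ _ hB
      calc _ ≤ ∑ u, p (adv h) u * ((if ∃ e ∈ h, I e then 1 else 0)
            + if I (adv h, g u) then 1 else 0) := by
            gcongr with u
            exact h2 u
        _ ≤ _ := by
            simp only [mul_add, Finset.sum_add_distrib, ← Finset.sum_mul, sum_pmf_eq_one, one_mul]
            gcongr
    rw [expect]
    refine (expect_mono _ _ _ h1 t).trans ?_
    rw [expect_add, expect_add, expect_const, Finset.sum_range_succ]
    push_cast
    calc _ ≤ _ := add_le_add_left ih _
      _ = _ := by ring

end Expect

/-! ## Adaptively chosen queries find few bad sketches -/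

theorem sq_lintegral_le {X : Type*} [MeasurableSpace X] (μ : Measure X) [IsProbabilityMeasure μ]
    {f : X → ℝ≥0∞} (hf : Measurable f) : (∫⁻ x, f x ∂μ) ^ 2 ≤ ∫⁻ x, f x ^ 2 ∂μ := by
  have h := ENNReal.lintegral_mul_le_Lp_mul_Lq μ (p := 2) (q := 2)
    (by constructor <;> norm_num) hf.aemeasurable (aemeasurable_const (b := (1 : ℝ≥0∞)))
  simp only [Pi.mul_apply, mul_one, lintegral_const, measure_univ, ENNReal.rpow_two, one_pow,
    ENNReal.one_rpow] at h
  calc (∫⁻ x, f x ∂μ) ^ 2 ≤ ((∫⁻ x, f x ^ 2 ∂μ) ^ (1 / 2 : ℝ)) ^ 2 := by gcongr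
    _ = ∫⁻ x, f x ^ 2 ∂μ := by
      rw [← ENNReal.rpow_natCast, ← ENNReal.rpow_mul]
      norm_num

section Adaptive

variable {𝒬 X : Type*} [MeasurableSpace X] {N r : ℕ} [NeZero N] [NeZero r]

theorem measurable_answer (idx : 𝒬 → X → Fin N) (hidx : ∀ q, Measurable (idx q)) (k : ℕ) (q : 𝒬) (u : Fin N) :
    Measurable fun T : Fin r → X => answer k (fun s => idx q (T s)) u :=
  (measurable_of_finite fun v : Fin r → Fin N => answer k v u).comp
    (measurable_pi_lambda _ fun s => (hidx q).comp (measurable_pi_apply s))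

open Classical in
/-- The probability that all sketches in a given set `J` are bad for the next query. -/
theorem sq_lintegral_expect_all_bad_le (idx : 𝒬 → X → Fin N)
    (hidx : ∀ q, Measurable (idx q)) (k : ℕ) (g : Fin N → ℝ) (adv : List (𝒬 × ℝ) → 𝒬)
    (μ : Measure X) [IsProbabilityMeasure μ] {bad : 𝒬 → Set X} (hbad : ∀ q, MeasurableSet (bad q))
    {P : ℝ≥0∞} (hP : ∀ q, μ (bad q) ≤ P)
    (J : Finset (Fin r)) (t : ℕ) :
    (∫⁻ T : Fin r → X, expect (fun q => answer k fun s => idx q (T s)) g adv t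
      (fun h => if ∀ j ∈ J, T j ∈ bad (adv h) then 1 else 0) ∂(Measure.pi fun _ => μ)) ^ 2
      ≤ ENNReal.ofReal (1 + (Real.exp (3 * J.card * k / r) - 1) ^ 2) ^ t * P ^ J.card := by
  set K := ENNReal.ofReal (1 + (Real.exp (3 * J.card * k / r) - 1) ^ 2)
  obtain ⟨z⟩ : Nonempty X := by
    by_contra h
    rw [not_nonempty_iff] at h
    exact (IsProbabilityMeasure.ne_zero μ) (Measure.eq_zero_of_isEmpty μ)
  have hφ : ∀ h : List (𝒬 × ℝ), Measurable fun T : Fin r → X =>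
      if ∀ j ∈ J, T j ∈ bad (adv h) then (1 : ℝ≥0∞) else 0 := by
    intro h
    refine Measurable.ite ?_ measurable_const measurable_const
    have : {T : Fin r → X | ∀ j ∈ J, T j ∈ bad (adv h)} = ⋂ j ∈ J, (fun T => T j) ⁻¹' bad (adv h) := by
      ext; simp
    rw [this]
    exact Finset.measurableSet_biInter _ fun j _ => measurable_pi_apply j (hbad _)
  -- Once the sketches in `J` are frozen at `z`, the law of the transcript no longer depends on
  -- them.
  set repl : (Fin r → X) → Fin r → X := fun T s => if s ∈ J then z else T s with hrepl
  have hreplm : Measurable repl := measurable_pi_lambda _ fun s => by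
    by_cases hs : s ∈ J
    · simp [hrepl, hs]
    · simpa [hrepl, hs] using measurable_pi_apply s
  refine (sq_lintegral_le _ (measurable_expect g adv (measurable_answer idx hidx k) hφ t)).trans ?_
  -- The square on the right disappears because the indicator equals its own square.
  have hchange : ∀ T : Fin r → X, expect (fun q => answer k fun s => idx q (T s)) g adv t
      (fun h => if ∀ j ∈ J, T j ∈ bad (adv h) then 1 else 0) ^ 2
      ≤ K ^ t * expect (fun q => answer k fun s => idx q (repl T s)) g adv t
      (fun h => if ∀ j ∈ J, T j ∈ bad (adv h) then 1 else 0) := by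
    intro T
    refine (expect_sq_le _ (fun q => answer k fun s => idx q (repl T s)) g adv (Real.exp_pos _).le
      (fun q u => answer_le_of_differ k (J := J) (fun s hs => by simp [hrepl, hs]) u)
      (fun q u => answer_le_of_differ k (J := J) (fun s hs => by simp [hrepl, hs]) u)
      (fun l => by split_ifs <;> simp) t).trans_eq ?_
    congr 2
    funext h
    split_ifs <;> simp
  refine (lintegral_mono hchange).trans ?_
  have hm : Measurable fun T : Fin r → X => K ^ t *
      expect (fun q => answer k fun s => idx q (repl T s)) g adv t
      (fun h => if ∀ j ∈ J, T j ∈ bad (adv h) then 1 else 0) :=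
    (measurable_expect g adv (fun q u => (measurable_answer idx hidx k q u).comp hreplm) hφ t).const_mul _
  -- Integrate over the coordinates in `J` first. The transcript law is constant there, and for each
  -- transcript the event is a product of `|J|` independent events.
  have hfub := lintegral_le_of_lmarginal_le (μ := fun _ : Fin r => μ) J hm
    (g := fun _ => K ^ t * P ^ J.card) measurable_const (by
      intro T
      simp only [lmarginal, lintegral_const, measure_univ, mul_one]
      have hr : ∀ y : ∀ _ : J, X, repl (Function.updateFinset T J y) = repl T := by
        intro y
        funext s
        by_cases hs : s ∈ J <;> simp [hrepl, Function.updateFinset, hs]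
      have hb : ∀ (y : ∀ _ : J, X) (h : List (𝒬 × ℝ)),
          (if ∀ j ∈ J, Function.updateFinset T J y j ∈ bad (adv h) then (1 : ℝ≥0∞) else 0)
          = (Set.univ.pi fun _ : J => bad (adv h)).indicator 1 y := by
        intro y h
        have : (∀ j ∈ J, Function.updateFinset T J y j ∈ bad (adv h))
            ↔ y ∈ Set.univ.pi fun _ : J => bad (adv h) := by
          simp only [Set.mem_univ_pi, Subtype.forall]
          refine forall₂_congr fun j hj => ?_
          simp [Function.updateFinset, hj]
        simp only [this, Set.indicator_apply, Pi.one_apply]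
      have hms : ∀ h : List (𝒬 × ℝ), MeasurableSet (Set.univ.pi fun _ : J => bad (adv h)) :=
        fun h => MeasurableSet.univ_pi fun _ => hbad _
      simp only [hr, hb]
      have hmi : ∀ h : List (𝒬 × ℝ), Measurable fun y : ∀ _ : J, X =>
          (Set.univ.pi fun _ : J => bad (adv h)).indicator (1 : (∀ _ : J, X) → ℝ≥0∞) y :=
        fun h => measurable_one.indicator (hms h)
      rw [lintegral_const_mul' _ _ (ENNReal.pow_ne_top ENNReal.ofReal_ne_top)]
      refine mul_le_mul_right ((lintegral_expect _ g adv _ hmi t).trans_le ?_) _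
      refine (expect_mono _ _ _ (ψ := fun _ => P ^ J.card) (fun h => ?_) t).trans_eq
        (expect_const _ _ _ _ _)
      rw [lintegral_indicator_one (hms h), Measure.pi_pi]
      calc ∏ _j : J, μ (bad (adv h)) ≤ ∏ _j : J, P := Finset.prod_le_prod' fun _ _ => hP _
        _ = P ^ J.card := by simp)
  refine hfub.trans_eq ?_
  simp

/-- Compares all `ℓ`-sets of sketches with those inside a bad set of `r / 4 + 1` sketches. The
hypothesis gives `r ≤ 8 (r / 4 + 2 - ℓ)`, a bound for every factor of the falling factorials. -/
theorem choose_le_pow_mul_choose {r ℓ : ℕ} (h : 8 * ℓ ≤ r) :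
    r.choose ℓ ≤ 8 ^ ℓ * (r / 4 + 1).choose ℓ := by
  have h1 : r.descFactorial ℓ ≤ 8 ^ ℓ * (r / 4 + 1).descFactorial ℓ :=
    calc r.descFactorial ℓ ≤ r ^ ℓ := Nat.descFactorial_le_pow _ _
      _ ≤ (8 * (r / 4 + 1 + 1 - ℓ)) ^ ℓ := Nat.pow_le_pow_left (by omega) _
      _ = 8 ^ ℓ * (r / 4 + 1 + 1 - ℓ) ^ ℓ := mul_pow _ _ _
      _ ≤ _ := Nat.mul_le_mul_left _ (Nat.pow_sub_le_descFactorial _ _)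
  rw [Nat.descFactorial_eq_factorial_mul_choose, Nat.descFactorial_eq_factorial_mul_choose,
    mul_left_comm] at h1
  exact Nat.le_of_mul_le_mul_left h1 (Nat.factorial_pos ℓ)

open Classical in
/-- The probability that more than a quarter of the sketches are bad for the next query. -/
theorem lintegral_expect_many_bad_le (idx : 𝒬 → X → Fin N)
    (hidx : ∀ q, Measurable (idx q)) (k : ℕ) (g : Fin N → ℝ) (adv : List (𝒬 × ℝ) → 𝒬)
    (μ : Measure X) [IsProbabilityMeasure μ] {bad : 𝒬 → Set X} (hbad : ∀ q, MeasurableSet (bad q))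
    {P : ℝ≥0∞} (hP : ∀ q, μ (bad q) ≤ P)
    {ℓ t Q : ℕ} (hℓ : 8 * ℓ ≤ r) (ht : t ≤ Q) {γ : ℝ≥0∞}
    (hγ : 64 ^ ℓ * (ENNReal.ofReal (1 + (Real.exp (3 * ℓ * k / r) - 1) ^ 2) ^ Q * P ^ ℓ) ≤ γ ^ 2) :
    ∫⁻ T : Fin r → X, expect (fun q => answer k fun s => idx q (T s)) g adv t
      (fun h => if r < 4 * (Finset.univ.filter fun s => T s ∈ bad (adv h)).card then 1 else 0)
      ∂(Measure.pi fun _ => μ) ≤ γ := by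
  set c := (r / 4 + 1).choose ℓ with hc
  have hc0 : c ≠ 0 := (Nat.choose_pos (by omega)).ne'
  set A := ∫⁻ T : Fin r → X, expect (fun q => answer k fun s => idx q (T s)) g adv t
      (fun h => if r < 4 * (Finset.univ.filter fun s => T s ∈ bad (adv h)).card then 1 else 0)
      ∂(Measure.pi fun _ => μ)
  set Bd : Finset (Fin r) → ℝ≥0∞ := fun J => ∫⁻ T : Fin r → X,
    expect (fun q => answer k fun s => idx q (T s)) g adv t
      (fun h => if ∀ j ∈ J, T j ∈ bad (adv h) then 1 else 0) ∂(Measure.pi fun _ => μ) with hBd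
  have hmJ : ∀ J : Finset (Fin r), Measurable fun T : Fin r → X =>
      expect (fun q => answer k fun s => idx q (T s)) g adv t
      (fun h => if ∀ j ∈ J, T j ∈ bad (adv h) then 1 else 0) := by
    intro J
    refine measurable_expect g adv (measurable_answer idx hidx k) (fun h => ?_) t
    refine Measurable.ite ?_ measurable_const measurable_const
    have : {T : Fin r → X | ∀ j ∈ J, T j ∈ bad (adv h)} = ⋂ j ∈ J, (fun T => T j) ⁻¹' bad (adv h) := by
      ext; simp
    rw [this]
    exact Finset.measurableSet_biInter _ fun j _ => measurable_pi_apply j (hbad _)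
  -- Double counting: if more than a quarter of the sketches are bad, at least `c` sets `J` of size
  -- `ℓ` are entirely bad.
  have h1 : c * A ≤ ∑ J ∈ Finset.powersetCard ℓ Finset.univ, Bd J := by
    rw [hBd, ← lintegral_finsetSum _ fun J _ => hmJ J, ← lintegral_const_mul' _ _ (by simp)]
    refine lintegral_mono fun T => ?_
    rw [← expect_const_mul, ← expect_sum]
    refine expect_mono _ _ _ (fun h => ?_) t
    set S := Finset.univ.filter fun s => T s ∈ bad (adv h) with hS
    have h2 : ∑ J ∈ Finset.powersetCard ℓ (Finset.univ : Finset (Fin r)),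
        (if ∀ j ∈ J, T j ∈ bad (adv h) then (1 : ℝ≥0∞) else 0) = S.card.choose ℓ := by
      rw [Finset.sum_boole, ← Finset.card_powersetCard]
      congr 2
      ext J
      simp only [Finset.mem_filter, Finset.mem_powersetCard, true_and, hS,
        Finset.subset_iff, Finset.mem_univ]
      tauto
    rw [h2]
    split_ifs with hlt
    · rw [mul_one]
      exact_mod_cast Nat.choose_le_choose ℓ (show r / 4 + 1 ≤ S.card by omega)
    · simp
  have h3 : ∀ J ∈ Finset.powersetCard ℓ (Finset.univ : Finset (Fin r)), 8 ^ ℓ * Bd J ≤ γ := by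
    intro J hJ
    have hcard : J.card = ℓ := (Finset.mem_powersetCard.1 hJ).2
    have h4 := sq_lintegral_expect_all_bad_le idx hidx k g adv μ hbad hP J t
    rw [hcard] at h4
    refine (ENNReal.pow_le_pow_left_iff two_ne_zero).1 (le_trans ?_ hγ)
    rw [mul_pow, ← pow_mul, mul_comm ℓ 2, pow_mul]
    norm_num
    refine mul_le_mul_right (h4.trans ?_) _
    gcongr
    rw [← ENNReal.ofReal_one]
    exact ENNReal.ofReal_le_ofReal (by nlinarith [sq_nonneg (Real.exp (3 * ℓ * k / r) - 1)])
  have h5 : (8 : ℝ≥0∞) ^ ℓ * (c * A) ≤ 8 ^ ℓ * (c * γ) := by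
    calc (8 : ℝ≥0∞) ^ ℓ * (c * A)
        ≤ ∑ J ∈ Finset.powersetCard ℓ (Finset.univ : Finset (Fin r)), 8 ^ ℓ * Bd J := by
          rw [← Finset.mul_sum]
          gcongr
      _ ≤ ∑ J ∈ Finset.powersetCard ℓ (Finset.univ : Finset (Fin r)), γ := Finset.sum_le_sum h3
      _ = (r.choose ℓ : ℕ) * γ := by simp
      _ ≤ ((8 ^ ℓ * c : ℕ) : ℝ≥0∞) * γ := by
          gcongr
          exact choose_le_pow_mul_choose hℓ
      _ = _ := by push_cast; ring
  rwa [ENNReal.mul_le_mul_iff_right (by positivity) (by simp),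
    ENNReal.mul_le_mul_iff_right (by exact_mod_cast hc0) (by simp)] at h5

end Adaptive

/-! ## Accuracy against adaptive adversaries -/

theorem measurable_gridIndex (ε lo : ℝ) (M : ℕ) : Measurable (gridIndex ε lo M) := by
  refine Measurable.ite measurableSet_Iic measurable_const ?_
  have h : Measurable fun s : ℝ => ⌈Real.log (s / lo) / Real.log (1 + ε / 4)⌉₊ :=
    Nat.measurable_ceil.comp ((Real.measurable_log.comp (measurable_id.div_const lo)).div_const _)
  exact (measurable_of_countable fun c : ℕ => (⟨min (c + 1) (M + 1), by omega⟩ : Fin (M + 2))).comp h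

theorem estimate_build {d m r n : ℕ} {F : SketchFamily d m} {δ p : ℝ} (hF : IsGoodSketch F δ p)
    (T : Fin r → F.Cell → ℝ) (x : Fin n → EuclideanSpace ℝ (Fin d)) (q : Query d n) (s : Fin r) :
    estimate F (fun c => T c.1 c.2) (build F (fun c => T c.1 c.2) x) q s
      = ‖F.sketch (T s) (x q.2 - q.1)‖ := by
  rw [← hF.sub]
  rfl

-- For a fixed seed the adversary is deterministic. In each round failure has two sources: more than
-- a quarter of the sketches are bad (`γ`), or the median fails although few are (`β`).
open Classical in
theorem successProb_ge {d m r n : ℕ} [NeZero r] {F : SketchFamily d m} {ε lo hi p : ℝ}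
    (hε : 0 < ε) (hε1 : ε < 1) (hlo : 0 < lo) (hF : IsGoodSketch F (ε / 4) p) {k Q ℓ : ℕ}
    {γ β : ℝ} (hγ0 : 0 ≤ γ) (hp0 : 0 ≤ p) (hℓ : 8 * ℓ ≤ r)
    (hγ : 64 ^ ℓ * ((1 + (Real.exp (3 * ℓ * k / r) - 1) ^ 2) ^ Q * p ^ ℓ) ≤ γ ^ 2)
    (hβ : (gridLevels ε lo hi + 2 : ℝ) * Real.exp (-(k / 16 : ℝ)) ≤ β)
    (x : Fin n → EuclideanSpace ℝ (Fin d)) {Θ : Type} [MeasurableSpace Θ] (ρ : Measure Θ)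
    [IsProbabilityMeasure ρ] (adv : Θ → List (Query d n × ℝ) → Query d n) :
    1 - ENNReal.ofReal (Q * (γ + β)) ≤ successProb (r := r) F k Q ε lo hi x ρ adv := by
  have hprob := hF.prob
  have hβ0 : 0 ≤ β := le_trans (by positivity) hβ
  set M := gridLevels ε lo hi with hM
  set D : Query d n → ℝ := fun q => ‖x q.2 - q.1‖ with hD
  set inRange : Query d n → Prop := fun q => D q = 0 ∨ lo ≤ D q ∧ D q ≤ hi with hinRange
  set idx : Query d n → (F.Cell → ℝ) → Fin (M + 2) := fun q g =>
    gridIndex ε lo M ‖F.sketch g (x q.2 - q.1)‖ with hidx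
  have hidxm : ∀ q, Measurable (idx q) := fun q => (measurable_gridIndex ε lo M).comp (hF.meas _)
  set bad : Query d n → Set (F.Cell → ℝ) := fun q =>
    {g | ¬ |‖F.sketch g (x q.2 - q.1)‖ ^ 2 - D q ^ 2| ≤ ε / 4 * D q ^ 2} with hbaddef
  have hbad : ∀ q, MeasurableSet (bad q) := by
    intro q
    have : bad q = {g | |‖F.sketch g (x q.2 - q.1)‖ ^ 2 - D q ^ 2| ≤ ε / 4 * D q ^ 2}ᶜ := by
      ext g
      simp [hbaddef]
    rw [this]
    exact (measurableSet_le ((((hF.meas _).pow_const 2).sub_const _).abs) measurable_const).compl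
  have hP : ∀ q, F.law (bad q) ≤ ENNReal.ofReal p := fun q => hF.bound _
  set I : Query d n × ℝ → Prop := fun e => ¬ (inRange e.1 →
    (1 - ε) * D e.1 ≤ e.2 ∧ e.2 ≤ (1 + ε) * D e.1) with hI
  have key : ∀ θ, 1 - ENNReal.ofReal (Q * (γ + β)) ≤ ∫⁻ T : Fin r → F.Cell → ℝ,
      (transcript (respond F k ε lo hi (fun c => T c.1 c.2)
        (build F (fun c => T c.1 c.2) x)) (adv θ) Q).toOuterMeasure (accurate ε lo hi x)
      ∂(Measure.pi fun _ => F.law) := by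
    intro θ
    set E : (Fin r → F.Cell → ℝ) → ℝ≥0∞ := fun T =>
      expect (fun q => answer k fun s => idx q (T s)) (gridValue ε lo) (adv θ) Q
        fun h => if ∃ e ∈ h, I e then 1 else 0 with hE
    have hEm : Measurable E := measurable_expect (gridValue ε lo) (adv θ)
      (measurable_answer idx hidxm k)
      (φ := fun _ h => if ∃ e ∈ h, I e then 1 else 0) (fun _ => measurable_const) Q
    -- `E T` is the failure probability for the tape `T`. An inequality suffices, and it puts the
    -- measurable function `E` in place of the probability being integrated.
    have hacc : ∀ T : Fin r → F.Cell → ℝ, 1 - E T ≤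
        (transcript (respond F k ε lo hi (fun c => T c.1 c.2)
        (build F (fun c => T c.1 c.2) x)) (adv θ) Q).toOuterMeasure (accurate ε lo hi x) := by
      intro T
      have hresp : respond F k ε lo hi (fun c => T c.1 c.2) (build F (fun c => T c.1 c.2) x)
          = fun q => (answer k fun s => idx q (T s)).map (gridValue ε lo) := by
        funext q
        rw [respond_eq_map_answer]
        simp only [estimate_build hF, hidx]
        rfl
      rw [hresp, PMF.toOuterMeasure_apply, tsub_le_iff_right, hE]
      simp only
      rw [← tsum_transcript_mul, ← ENNReal.tsum_add]
      rw [← (transcript (fun q => (answer k fun s => idx q (T s)).map (gridValue ε lo))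
        (adv θ) Q).tsum_coe]
      refine ENNReal.tsum_le_tsum fun h => ?_
      by_cases hh : ∃ e ∈ h, I e
      · simp [hh]
      · have : h ∈ accurate ε lo hi x := by
          push Not at hh
          intro e he
          exact hh e he
        simp [hh, this]
    have hround : ∀ T : Fin r → F.Cell → ℝ, E T ≤
        (∑ i ∈ Finset.range Q, expect (fun q => answer k fun s => idx q (T s)) (gridValue ε lo)
          (adv θ) i fun h =>
            if r < 4 * (Finset.univ.filter fun s => T s ∈ bad (adv θ h)).card then 1 else 0)
        + Q * ENNReal.ofReal β := by
      intro T
      refine expect_exists_le (B := fun q => r < 4 * (Finset.univ.filter fun s => T s ∈ bad q).card)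
        _ _ _ (fun q hq => ?_) Q
      by_cases hr : inRange q
      · have hcard : 4 * (Finset.univ.filter fun s => ¬ ((1 - ε) * D q ≤ gridValue ε lo (idx q (T s))
            ∧ gridValue ε lo (idx q (T s)) ≤ (1 + ε) * D q)).card ≤ r := by
          refine le_trans (Nat.mul_le_mul_left 4 (Finset.card_le_card fun s hs => ?_)) (not_lt.1 hq)
          simp only [Finset.mem_filter, Finset.mem_univ, true_and] at hs ⊢
          intro hs'
          exact hs (rounding_accurate hε hε1 hlo hr (norm_nonneg _) hs')
        refine le_trans (le_of_eq ?_) ((sum_answer_inaccurate_le k (fun s => idx q (T s))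
          (gridValue_mono hε hlo M) hcard).trans (ENNReal.ofReal_le_ofReal
            (by push_cast; exact hβ)))
        refine Finset.sum_congr rfl fun u _ => ?_
        congr 1
        simp only [hI, hr, true_imp_iff]
        split_ifs <;> simp_all
      · simp [hI, hr]
    have hmany : ∀ i, Measurable fun T : Fin r → F.Cell → ℝ =>
        expect (fun q => answer k fun s => idx q (T s)) (gridValue ε lo) (adv θ) i fun h =>
          if r < 4 * (Finset.univ.filter fun s => T s ∈ bad (adv θ h)).card then 1 else 0 := by
      intro i
      refine measurable_expect _ _ (measurable_answer idx hidxm k) (fun h => ?_) i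
      refine Measurable.ite (measurableSet_lt measurable_const (measurable_const.mul ?_))
        measurable_const measurable_const
      simp only [Finset.card_filter]
      exact Finset.measurable_sum _ fun s _ => Measurable.ite
        (measurable_pi_apply s (hbad _)) measurable_const measurable_const
    have hEint : ∫⁻ T, E T ∂(Measure.pi fun _ => F.law) ≤ ENNReal.ofReal (Q * (γ + β)) := by
      refine (lintegral_mono hround).trans ?_
      rw [lintegral_add_right _ measurable_const, lintegral_finsetSum _ fun i _ => hmany i,
        lintegral_const, measure_univ, mul_one, ENNReal.ofReal_mul (Nat.cast_nonneg _),
        ENNReal.ofReal_natCast, ENNReal.ofReal_add hγ0 hβ0, mul_add]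
      gcongr
      have hsum : ∀ i ∈ Finset.range Q, ∫⁻ T : Fin r → F.Cell → ℝ,
          expect (fun q => answer k fun s => idx q (T s)) (gridValue ε lo) (adv θ) i (fun h =>
          if r < 4 * (Finset.univ.filter fun s => T s ∈ bad (adv θ h)).card then 1 else 0)
          ∂(Measure.pi fun _ => F.law) ≤ ENNReal.ofReal γ := by
        intro i hi
        convert lintegral_expect_many_bad_le idx hidxm k (gridValue ε lo) (adv θ) F.law hbad
          hP hℓ (Finset.mem_range.1 hi).le (γ := ENNReal.ofReal γ) ?_
        have h64 : (64 : ℝ≥0∞) = ENNReal.ofReal 64 := by simp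
        rw [h64, ← ENNReal.ofReal_pow (by norm_num), ← ENNReal.ofReal_pow (by positivity),
          ← ENNReal.ofReal_pow hp0, ← ENNReal.ofReal_pow hγ0, ← ENNReal.ofReal_mul (by positivity),
          ← ENNReal.ofReal_mul (by positivity)]
        exact ENNReal.ofReal_le_ofReal hγ
      exact (Finset.sum_le_sum hsum).trans_eq (by simp)
    calc 1 - ENNReal.ofReal (Q * (γ + β)) ≤ 1 - ∫⁻ T, E T ∂(Measure.pi fun _ => F.law) :=
          tsub_le_tsub_left hEint 1
      _ = ∫⁻ _T, 1 ∂(Measure.pi fun _ : Fin r => F.law) - ∫⁻ T, E T ∂(Measure.pi fun _ => F.law) := by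
          simp
      _ ≤ ∫⁻ T, (1 - E T) ∂(Measure.pi fun _ => F.law) := lintegral_sub_le _ _ hEm
      _ ≤ _ := lintegral_mono hacc
  -- The bound is the same for all seeds, so no measurability in `θ` is required.
  calc 1 - ENNReal.ofReal (Q * (γ + β)) = ∫⁻ _θ, (1 - ENNReal.ofReal (Q * (γ + β))) ∂ρ := by simp
    _ ≤ _ := lintegral_mono key

/-! ## Estimates for the parameters -/

theorem half_le_log_of_two_le {X : ℝ} (hX : 2 ≤ X) : 1 / 2 ≤ Real.log X := by
  have h1 := Real.log_two_gt_d9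
  have h2 := Real.log_le_log (by norm_num) hX
  linarith

/-- Here the hypothesis on the range of distances enters: with `log (1 + ε/4) ≥ ε/5` the grid has at
most `5 X^b + 4 ≤ 16 X^b ≤ X^(b+4)` points. -/
theorem gridLevels_add_two_le {ε lo hi X : ℝ} {b : ℕ} (hε : 0 < ε) (hε1 : ε < 1) (hlo : 0 < lo)
    (hle : lo ≤ hi) (hX : 2 ≤ X) (h : Real.log (hi / lo) ≤ ε * X ^ b) :
    (gridLevels ε lo hi + 2 : ℝ) ≤ Real.exp ((b + 4) * Real.log X) := by
  have hX0 : 0 < X := by linarith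
  have hlog : ε / 5 ≤ Real.log (1 + ε / 4) := by
    refine le_trans ?_ (Real.one_sub_inv_le_log_of_pos (by positivity))
    have : (1 + ε / 4)⁻¹ ≤ 1 - ε / 5 := by
      rw [inv_le_iff_one_le_mul₀ (by positivity)]
      nlinarith
    linarith
  have h0 : 0 ≤ Real.log (hi / lo) := Real.log_nonneg ((one_le_div hlo).2 hle)
  have h1 : Real.log (hi / lo) / Real.log (1 + ε / 4) ≤ 5 * X ^ b := by
    rw [div_le_iff₀ (by linarith [div_pos hε (by norm_num : (0 : ℝ) < 5)])]
    calc Real.log (hi / lo) ≤ ε * X ^ b := h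
      _ = 5 * X ^ b * (ε / 5) := by ring
      _ ≤ 5 * X ^ b * Real.log (1 + ε / 4) := by gcongr
  have h2 : (gridLevels ε lo hi : ℝ) ≤ 5 * X ^ b + 2 := by
    have := Nat.ceil_lt_add_one (div_nonneg h0
      (le_trans (by positivity) hlog) : 0 ≤ Real.log (hi / lo) / Real.log (1 + ε / 4))
    rw [gridLevels]
    push_cast
    linarith
  have h3 : 1 ≤ X ^ b := one_le_pow₀ (by linarith)
  have h4 : (2 : ℝ) ^ 4 ≤ X ^ 4 := by gcongr
  have h5 : Real.exp ((b + 4) * Real.log X) = X ^ b * X ^ 4 := by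
    rw [show ((b : ℝ) + 4) = ((b + 4 : ℕ) : ℝ) by push_cast; ring, Real.exp_nat_mul,
      Real.exp_log hX0, pow_add]
  rw [h5]
  nlinarith

theorem numRows_le {C ε : ℝ} (hC : 0 < C) (hε : 0 < ε) (hε1 : ε < 1) :
    (numRows C ε : ℝ) ≤ (C + 1) / ε ^ 2 := by
  have h := Nat.ceil_lt_add_one (by positivity : 0 ≤ C / ε ^ 2)
  have h1 : 1 ≤ 1 / ε ^ 2 := by
    rw [le_div_iff₀ (by positivity)]
    nlinarith
  rw [add_div]
  exact h.le.trans (by linarith)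

theorem div_le_of_numRows {C ε : ℝ} (hC : 0 < C) (hε : 0 < ε) :
    0 < numRows C ε ∧ 80 / (numRows C ε * (ε / 4) ^ 2) ≤ 1280 / C := by
  have h0 : 0 < C / ε ^ 2 := by positivity
  have h := Nat.le_ceil (C / ε ^ 2)
  refine ⟨Nat.ceil_pos.2 h0, ?_⟩
  change C / ε ^ 2 ≤ (numRows C ε : ℝ) at h
  rw [div_le_iff₀ (by positivity)] at h
  have h' : 0 < (numRows C ε : ℝ) := Nat.cast_pos.2 (Nat.ceil_pos.2 h0)
  rw [div_le_div_iff₀ (by positivity) hC]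
  nlinarith

theorem numSamples_bounds {C : ℝ} {n Q : ℕ} (hC : 0 < C) (hΛ : 1 / 2 ≤ Real.log (n * Q)) :
    C * Real.log (n * Q) ≤ numSamples C n Q ∧
      (numSamples C n Q : ℝ) ≤ (C + 2) * Real.log (n * Q) := by
  refine ⟨Nat.le_ceil _, ?_⟩
  have h := Nat.ceil_lt_add_one (by positivity : 0 ≤ C * Real.log (n * Q))
  rw [numSamples]
  linarith

theorem numSketches_bounds {C : ℝ} {n Q : ℕ} (hC : 0 < C) (hQ : 1 ≤ Q)
    (hΛ : 1 / 2 ≤ Real.log (n * Q)) :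
    C * √(Q : ℝ) * Real.log (n * Q) ^ 2 ≤ numSketches C n Q ∧
      (numSketches C n Q : ℝ) ≤ (C + 8) * √(Q : ℝ) * Real.log (n * Q) ^ 2 := by
  have h1 := Nat.le_ceil (C * √(Q : ℝ) * Real.log (n * Q) ^ 2)
  have h2 := Nat.ceil_lt_add_one (by positivity : 0 ≤ C * √(Q : ℝ) * Real.log (n * Q) ^ 2)
  have h3 : 1 ≤ √(Q : ℝ) := Real.one_le_sqrt.2 (by exact_mod_cast hQ)
  have h4 : 2 ≤ 8 * √(Q : ℝ) * Real.log (n * Q) ^ 2 := by nlinarith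
  rw [numSketches]
  push_cast
  constructor <;> nlinarith

theorem exp_sub_one_le {η : ℝ} (h0 : 0 ≤ η) (h1 : η ≤ 1 / 2) : Real.exp η - 1 ≤ 2 * η := by
  have h := Real.one_sub_le_exp_neg η
  rw [Real.exp_neg, le_inv_comm₀ (by linarith) (Real.exp_pos _)] at h
  have : (1 - η)⁻¹ ≤ 1 + 2 * η := by
    rw [inv_le_iff_one_le_mul₀ (by linarith)]
    nlinarith
  linarith

theorem inv_64_le_exp_neg_four : (64 : ℝ)⁻¹ ≤ Real.exp (-4) := by
  rw [Real.exp_neg]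
  refine inv_anti₀ (Real.exp_pos _) ?_
  have h : Real.exp 4 = Real.exp 1 ^ 4 := by rw [← Real.exp_nat_mul]; norm_num
  rw [h]
  have := Real.exp_one_lt_d9.le
  calc Real.exp 1 ^ 4 ≤ 2.7182818286 ^ 4 := by gcongr
    _ ≤ 64 := by norm_num

/-- Since `η √Q ≤ 1/2`, the excess `(e^η - 1)² Q` is at most `1`, so the change of measure costs at
most `e ≤ e^(2ℓ)` over all rounds. Against `(64 p)^ℓ ≤ e^(-4ℓ)` this leaves `e^(-2ℓ)`. -/
theorem ratio_pow_mul_pow_le {ℓ Q : ℕ} {η p : ℝ} (hη0 : 0 ≤ η) (hQ : 1 ≤ Q)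
    (hηQ : η * √(Q : ℝ) ≤ 1 / 2) (hp0 : 0 ≤ p) (hp : 64 * p ≤ Real.exp (-4)) (hℓ : (1 : ℝ) ≤ ℓ) :
    64 ^ ℓ * ((1 + (Real.exp η - 1) ^ 2) ^ Q * p ^ ℓ) ≤ Real.exp (-(ℓ : ℝ)) ^ 2 := by
  have hsq1 : 1 ≤ √(Q : ℝ) := Real.one_le_sqrt.2 (by exact_mod_cast hQ)
  have hsq : √(Q : ℝ) ^ 2 = Q := Real.sq_sqrt (Nat.cast_nonneg _)
  have hη1 : η ≤ 1 / 2 := (le_mul_of_one_le_right hη0 hsq1).trans hηQ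
  have hκ : (Real.exp η - 1) ^ 2 * Q ≤ 1 := by
    have h1 := exp_sub_one_le hη0 hη1
    have h2 : 0 ≤ Real.exp η - 1 := by linarith [Real.add_one_le_exp η]
    calc (Real.exp η - 1) ^ 2 * Q = ((Real.exp η - 1) * √(Q : ℝ)) ^ 2 := by rw [mul_pow, hsq]
      _ ≤ (2 * η * √(Q : ℝ)) ^ 2 := by gcongr
      _ ≤ 1 ^ 2 := by gcongr; linarith
      _ = 1 := by norm_num
  have h1 : (1 + (Real.exp η - 1) ^ 2) ^ Q ≤ Real.exp (2 * ℓ) := by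
    calc (1 + (Real.exp η - 1) ^ 2) ^ Q ≤ Real.exp ((Real.exp η - 1) ^ 2) ^ Q := by
          gcongr
          linarith [Real.add_one_le_exp ((Real.exp η - 1) ^ 2)]
      _ = Real.exp (Q * (Real.exp η - 1) ^ 2) := by rw [Real.exp_nat_mul]
      _ ≤ _ := Real.exp_le_exp.2 (by linarith)
  calc 64 ^ ℓ * ((1 + (Real.exp η - 1) ^ 2) ^ Q * p ^ ℓ)
      = (1 + (Real.exp η - 1) ^ 2) ^ Q * (64 * p) ^ ℓ := by rw [mul_pow]; ring
    _ ≤ Real.exp (2 * ℓ) * Real.exp (-4) ^ ℓ := by gcongr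
    _ = Real.exp (-(ℓ : ℝ)) ^ 2 := by
        rw [← Real.exp_nat_mul, ← Real.exp_nat_mul, ← Real.exp_add]
        congr 1
        push_cast
        ring

theorem rounds_mul_failure_le {n Q c : ℕ} {ℓ X : ℝ} (hn : 1 ≤ n) (hX : X = n * Q) (hX2 : 2 ≤ X)
    (hℓ : (c + 2) * Real.log X ≤ ℓ) :
    Q * (Real.exp (-ℓ) + Real.exp (-((c + 2) * Real.log X))) ≤ (X ^ c)⁻¹ := by
  have hX0 : 0 < X := by linarith
  have hval : Real.exp (-((c + 2) * Real.log X)) = (X ^ (c + 2))⁻¹ := by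
    rw [Real.exp_neg, show ((c : ℝ) + 2) = ((c + 2 : ℕ) : ℝ) by push_cast; ring, Real.exp_nat_mul,
      Real.exp_log hX0]
  have hγ : Real.exp (-ℓ) ≤ (X ^ (c + 2))⁻¹ := hval ▸ Real.exp_le_exp.2 (by linarith)
  have hQX : (Q : ℝ) ≤ X := by
    have : (1 : ℝ) ≤ n := by exact_mod_cast hn
    rw [hX]
    nlinarith [Nat.cast_nonneg (α := ℝ) Q]
  calc (Q : ℝ) * (Real.exp (-ℓ) + Real.exp (-((c + 2) * Real.log X)))
      ≤ X * ((X ^ (c + 2))⁻¹ + (X ^ (c + 2))⁻¹) := by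
        rw [hval]
        gcongr
    _ = 2 / X * (X ^ c)⁻¹ := by
        rw [pow_add]
        field_simp
        norm_num
    _ ≤ 1 * (X ^ c)⁻¹ := by
        gcongr
        rw [div_le_one hX0]
        exact hX2
    _ = (X ^ c)⁻¹ := one_mul _

/-! ## Correctness -/

theorem successProb_ge_of_params (b c : ℕ) {Cm Ck Cr : ℝ} (hCm : Cm = 5242880)
    (hCk : Ck = 16 * (b + c + 6)) (hCr : Cr = 6 * (Ck + 2) * (c + 4)) {n Q d : ℕ} {ε lo hi : ℝ}
    (hnQ : 2 ≤ n * Q) (hε : 0 < ε) (hε1 : ε < 1) (hlo : 0 < lo) (hle : lo ≤ hi)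
    (hrange : Real.log (hi / lo) ≤ ε * ((n : ℝ) * Q) ^ b)
    {F : SketchFamily d (numRows Cm ε)}
    (hF : IsGoodSketch F (ε / 4) (80 / (numRows Cm ε * (ε / 4) ^ 2)))
    (x : Fin n → EuclideanSpace ℝ (Fin d)) (Θ : Type) [MeasurableSpace Θ] (ρ : Measure Θ)
    [IsProbabilityMeasure ρ] (adv : Θ → List (Query d n × ℝ) → Query d n) :
    1 - ENNReal.ofReal ((((n : ℝ) * Q) ^ c)⁻¹) ≤ successProb (r := numSketches Cr n Q) F
      (numSamples Ck n Q) Q ε lo hi x ρ adv := by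
  have hQ1 : 1 ≤ Q := Nat.pos_of_ne_zero fun h => by simp [h] at hnQ
  have hn1 : 1 ≤ n := Nat.pos_of_ne_zero fun h => by simp [h] at hnQ
  have hX2 : (2 : ℝ) ≤ (n : ℝ) * Q := by exact_mod_cast hnQ
  set X : ℝ := (n : ℝ) * Q with hX
  have hX0 : 0 < X := by linarith
  set Λ := Real.log X with hΛdef
  have hΛ : 1 / 2 ≤ Λ := half_le_log_of_two_le hX2
  have hCk0 : 0 < Ck := by rw [hCk]; positivity
  have hCk96 : 96 ≤ Ck := by
    rw [hCk]; nlinarith [Nat.cast_nonneg (α := ℝ) b, Nat.cast_nonneg (α := ℝ) c]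
  have hCr0 : 0 < Cr := by rw [hCr]; positivity
  obtain ⟨hk1, hk2⟩ := numSamples_bounds (n := n) (Q := Q) hCk0 hΛ
  obtain ⟨hr1, hr2⟩ := numSketches_bounds (n := n) (Q := Q) hCr0 hQ1 hΛ
  rw [← hX, ← hΛdef] at hk1 hk2 hr1 hr2
  set k := numSamples Ck n Q
  set r := numSketches Cr n Q
  -- The size of the test sets `J`, chosen so that `e^(-ℓ) ≤ X^(-(c+2))`.
  set ℓ := ⌈((c : ℝ) + 2) * Λ⌉₊ with hℓdef
  have hℓ1 : (c + 2) * Λ ≤ ℓ := Nat.le_ceil _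
  have hc0 : (0 : ℝ) ≤ c := Nat.cast_nonneg c
  have hb0 : (0 : ℝ) ≤ b := Nat.cast_nonneg b
  have hℓ2 : (ℓ : ℝ) ≤ (c + 4) * Λ := by
    have := Nat.ceil_lt_add_one (by positivity : 0 ≤ ((c : ℝ) + 2) * Λ)
    linarith
  have hℓ0 : (1 : ℝ) ≤ ℓ := by nlinarith
  have hsq1 : 1 ≤ √(Q : ℝ) := Real.one_le_sqrt.2 (by exact_mod_cast hQ1)
  have hr0 : (0 : ℝ) < r := lt_of_lt_of_le (by positivity) hr1
  have hlk : (ℓ : ℝ) * k ≤ ((c + 4) * Λ) * ((Ck + 2) * Λ) := by gcongr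
  -- The `6` in `Cr` makes `η √Q = 3 ℓ k √Q / r` at most `1/2`.
  have hrk : 6 * (ℓ * k * √(Q : ℝ)) ≤ r := by
    refine le_trans ?_ hr1
    rw [hCr]
    calc 6 * (ℓ * k * √(Q : ℝ)) ≤ 6 * (((c + 4) * Λ) * ((Ck + 2) * Λ) * √(Q : ℝ)) := by gcongr
      _ = _ := by ring
  have h8 : 8 * ℓ ≤ r := by
    have : (8 : ℝ) * ℓ ≤ r := by
      refine le_trans ?_ hrk
      have hk8 : 2 ≤ (k : ℝ) := by nlinarith
      have : (ℓ : ℝ) * 2 * 1 ≤ ℓ * k * √(Q : ℝ) := by gcongr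
      linarith
    exact_mod_cast this
  set η := 3 * (ℓ : ℝ) * k / r with hη
  have hη0 : 0 ≤ η := by positivity
  have hηQ : η * √(Q : ℝ) ≤ 1 / 2 := by
    rw [hη, div_mul_eq_mul_div, div_le_iff₀ hr0]
    linarith
  obtain ⟨hm0, hp⟩ := div_le_of_numRows (C := Cm) (by rw [hCm]; norm_num) hε
  set p := 80 / (numRows Cm ε * (ε / 4) ^ 2)
  have hp0 : 0 ≤ p := by positivity
  have h64 : 64 * p ≤ Real.exp (-4) := by
    refine le_trans ?_ inv_64_le_exp_neg_four
    rw [hCm] at hp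
    norm_num at hp ⊢
    linarith only [hp]
  have hγ := ratio_pow_mul_pow_le (ℓ := ℓ) hη0 hQ1 hηQ hp0 h64 hℓ0
  have hgrid := gridLevels_add_two_le hε hε1 hlo hle hX2 hrange
  rw [← hΛdef] at hgrid
  -- `k / 16 ≥ (b + c + 6) Λ` pays `(b + 4) Λ` for the size of the grid and leaves `(c + 2) Λ`.
  have hβ : (gridLevels ε lo hi + 2 : ℝ) * Real.exp (-(k / 16 : ℝ)) ≤ Real.exp (-((c + 2) * Λ)) := by
    calc _ ≤ Real.exp ((b + 4) * Λ) * Real.exp (-(k / 16 : ℝ)) := by gcongr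
      _ = Real.exp ((b + 4) * Λ - k / 16) := by rw [← Real.exp_add]; ring_nf
      _ ≤ _ := by
        refine Real.exp_le_exp.2 ?_
        rw [hCk] at hk1
        linarith only [hk1]
  have hmain := successProb_ge hε hε1 hlo hF (Real.exp_pos _).le hp0 h8 hγ hβ x ρ adv
  exact le_trans (tsub_le_tsub_left (ENNReal.ofReal_le_ofReal
    (rounds_mul_failure_le hn1 hX hX2 hℓ1)) 1) hmain

/-! ## Time and space -/

theorem exists_sampler_depth {ε lo hi X : ℝ} {b : ℕ} (hε : 0 < ε) (hε1 : ε < 1) (hlo : 0 < lo)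
    (hle : lo ≤ hi) (hX : 2 ≤ X) (h : Real.log (hi / lo) ≤ ε * X ^ b) :
    ∃ L : ℕ, gridLevels ε lo hi + 2 ≤ 2 ^ L ∧ (2 * L + 1 : ℝ) ≤ (4 * b + 22) * Real.log X := by
  have hΛ := half_le_log_of_two_le hX
  have hb0 : (0 : ℝ) ≤ b := Nat.cast_nonneg b
  -- `log 2 ≥ 1/2`, so the factor `2` converts the natural logarithm into a sufficient binary depth.
  refine ⟨⌈2 * ((b : ℝ) + 4) * Real.log X⌉₊, ?_, ?_⟩
  · have h1 := gridLevels_add_two_le hε hε1 hlo hle hX h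
    have h2 := Nat.le_ceil (2 * ((b : ℝ) + 4) * Real.log X)
    set L := ⌈2 * ((b : ℝ) + 4) * Real.log X⌉₊
    have h3 : Real.exp ((b + 4) * Real.log X) ≤ 2 ^ L := by
      have h4 : (2 : ℝ) ^ L = Real.exp (L * Real.log 2) := by
        rw [Real.exp_nat_mul, Real.exp_log (by norm_num)]
      rw [h4]
      refine Real.exp_le_exp.2 ?_
      have h5 := half_le_log_of_two_le le_rfl
      have h6 : (0 : ℝ) ≤ L := Nat.cast_nonneg _
      nlinarith
    exact_mod_cast h1.trans h3
  · have := Nat.ceil_lt_add_one (by positivity : 0 ≤ 2 * ((b : ℝ) + 4) * Real.log X)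
    nlinarith

theorem storedWords_le {Cm Cr ε : ℝ} (hCm : 0 < Cm) (hCr : 0 < Cr) {n Q : ℕ} (hε : 0 < ε)
    (hε1 : ε < 1) (hQ : 1 ≤ Q) (hΛ : 1 / 2 ≤ Real.log (n * Q)) :
    (storedWords (numSketches Cr n Q) n (numRows Cm ε) : ℝ)
      ≤ (Cr + 8) * (Cm + 1) * (n * √(Q : ℝ) * Real.log (n * Q) ^ 2 / ε ^ 2) := by
  have h1 := (numSketches_bounds (n := n) hCr hQ hΛ).2
  have h2 := numRows_le hCm hε hε1
  simp only [storedWords, Fintype.card_prod, Fintype.card_fin, Nat.cast_mul]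
  calc (numSketches Cr n Q : ℝ) * (n * numRows Cm ε)
      ≤ ((Cr + 8) * √(Q : ℝ) * Real.log (n * Q) ^ 2) * (n * ((Cm + 1) / ε ^ 2)) := by gcongr
    _ = _ := by ring

theorem gaussianJL_steps_le {Cm Ck ε k m L d b Λ : ℝ} (hCm : 0 < Cm) (_hCk : 0 < Ck)
    (hε : 0 < ε) (hε1 : ε < 1) (hd : 1 ≤ d) (hb : 0 ≤ b) (hk0 : 0 ≤ k) (hΛ : 0 ≤ Λ)
    (hk : k ≤ (Ck + 2) * Λ) (hm : m ≤ (Cm + 1) / ε ^ 2) (hL : L ≤ (4 * b + 22) * Λ) :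
    k * (m * (4 * d + 7) + 11) + L
      ≤ (20 * (Cm + 5) * (Ck + 2) + 2 * (4 * b + 22)) * (d * Λ / ε ^ 2) := by
  have h1 : 1 ≤ 1 / ε ^ 2 := by
    rw [le_div_iff₀ (by positivity)]
    nlinarith
  set e := 1 / ε ^ 2 with he
  have h2 : 1 ≤ d * e := one_le_mul_of_one_le_of_one_le hd h1
  rw [show (Cm + 1) / ε ^ 2 = (Cm + 1) * e by rw [he]; ring] at hm
  rw [show d * Λ / ε ^ 2 = d * e * Λ by rw [he]; ring]
  have h3 : m * (4 * d + 7) + 11 ≤ 20 * (Cm + 5) * (d * e) := by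
    have : m * (4 * d + 7) ≤ (Cm + 1) * e * (11 * d) := by
      calc m * (4 * d + 7) ≤ (Cm + 1) * e * (4 * d + 7) := by gcongr
        _ ≤ _ := by gcongr; linarith
    nlinarith
  calc k * (m * (4 * d + 7) + 11) + L
      ≤ (Ck + 2) * Λ * (20 * (Cm + 5) * (d * e)) + (4 * b + 22) * Λ * (d * e) := by
        refine add_le_add ?_ (hL.trans (le_mul_of_one_le_right (by positivity) h2))
        exact (mul_le_mul_of_nonneg_left h3 hk0).trans
          (mul_le_mul_of_nonneg_right hk (by positivity))
    _ ≤ _ := by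
        have : 0 ≤ (4 * b + 22) * Λ * (d * e) := by positivity
        nlinarith

/-- Padding less than doubles the dimension, and `K - 1 ≤ 2 log d` with `1 ≤ 2 log d`; the latter
uses `2 ≤ d`. -/
theorem hadamard_steps_le {d : ℕ} (hd : 2 ≤ d) :
    (2 ^ Nat.clog 2 d * (3 * Nat.clog 2 d + 3) : ℝ) ≤ 36 * (d * Real.log d) := by
  have hd' : (2 : ℝ) ≤ d := by exact_mod_cast hd
  have hlog := half_le_log_of_two_le hd'
  set K := Nat.clog 2 d with hK
  have hK1 : 1 ≤ K := Nat.clog_pos one_lt_two hd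
  have h1 : 2 ^ (K - 1) < d := by
    have := Nat.pow_pred_clog_lt_self one_lt_two (show 1 < d by omega)
    simpa [hK] using this
  have h2 : (2 : ℝ) ^ (K - 1) ≤ d := by exact_mod_cast h1.le
  have h3 : (2 : ℝ) ^ K ≤ 2 * d := by
    rw [← Nat.sub_add_cancel hK1, pow_succ]
    linarith
  have h4 : (K : ℝ) ≤ 4 * Real.log d := by
    have h5 := Real.log_le_log (by positivity) h2
    rw [Real.log_pow, Nat.cast_sub hK1] at h5
    have h6 := half_le_log_of_two_le le_rfl
    have h7 : (0 : ℝ) ≤ (K : ℝ) - 1 := by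
      have : (1 : ℝ) ≤ K := by exact_mod_cast hK1
      linarith
    push_cast at h5
    nlinarith
  calc (2 ^ K * (3 * K + 3) : ℝ) ≤ (2 * d) * (18 * Real.log d) := by
        gcongr
        linarith
    _ = _ := by ring

theorem fastJL_steps_le {Cm Ck ε k m L H d b Λ l : ℝ} (hCm : 0 < Cm) (_hCk : 0 < Ck)
    (hε : 0 < ε) (hd : 1 ≤ d) (hl : 1 / 2 ≤ l) (hb : 0 ≤ b) (hk0 : 0 ≤ k)
    (hΛ : 0 ≤ Λ) (hk : k ≤ (Ck + 2) * Λ) (hm : m ≤ (Cm + 1) / ε ^ 2) (hL : L ≤ (4 * b + 22) * Λ)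
    (hH : H ≤ 36 * (d * l)) :
    k * (H + m * 8 + 11) + L
      ≤ (20 * (Cm + 5) * (Ck + 2) + 2 * (4 * b + 22)) * ((l / ε ^ 2 + d * l) * Λ) := by
  set e := 1 / ε ^ 2 with he
  have he0 : 0 < e := by positivity
  rw [show (Cm + 1) / ε ^ 2 = (Cm + 1) * e by rw [he]; ring] at hm
  rw [show l / ε ^ 2 = l * e by rw [he]; ring]
  have hdl : 1 / 2 ≤ d * l := by nlinarith
  have hle : 0 ≤ l * e := by positivity
  have h1 : H + m * 8 + 11 ≤ 20 * (Cm + 5) * (l * e + d * l) := by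
    have h2 : m * 8 ≤ 16 * (Cm + 1) * (l * e) := by
      calc m * 8 ≤ (Cm + 1) * e * 8 := by gcongr
        _ ≤ (Cm + 1) * e * (16 * l) := by gcongr; linarith
        _ = _ := by ring
    nlinarith
  have h3 : 1 ≤ 2 * (l * e + d * l) := by linarith
  calc k * (H + m * 8 + 11) + L
      ≤ (Ck + 2) * Λ * (20 * (Cm + 5) * (l * e + d * l))
        + (4 * b + 22) * Λ * (2 * (l * e + d * l)) := by
        refine add_le_add ?_ (hL.trans (le_mul_of_one_le_right (by positivity) h3))
        exact (mul_le_mul_of_nonneg_left h1 hk0).trans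
          (mul_le_mul_of_nonneg_right hk (by positivity))
    _ = _ := by ring

end AdaptiveDistance

end

/-! ### The main theorem: choice of constants and assembly. -/

open AdaptiveDistance in
theorem mainTheorem6 (b c : ℕ) :
    ∃ Cm Ck Cr CT CS : ℝ, 0 < Cm ∧ 0 < Ck ∧ 0 < Cr ∧ 0 < CT ∧ 0 < CS ∧
      ∀ (n Q d : ℕ) (ε lo hi : ℝ), 2 ≤ n * Q → 1 ≤ d → 0 < ε → ε < 1 → 0 < lo → lo ≤ hi →
        Real.log (hi / lo) ≤ ε * ((n : ℝ) * Q) ^ b →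
        let m := numRows Cm ε
        let k := numSamples Ck n Q
        let r := numSketches Cr n Q
        -- fast JL
        (2 ≤ d →
          (∀ (x : Fin n → EuclideanSpace ℝ (Fin d)) (Θ : Type) [MeasurableSpace Θ]
              (ρ : MeasureTheory.Measure Θ) [MeasureTheory.IsProbabilityMeasure ρ]
              (adv : Θ → List (Query d n × ℝ) → Query d n),
              1 - ENNReal.ofReal ((((n : ℝ) * Q) ^ c)⁻¹)
                ≤ successProb (r := r) (fastJL d m) k Q ε lo hi x ρ adv) ∧
          QueryTimeLE (fastJL d m) r n k ε lo hi
            (CT * ((Real.log d / ε ^ 2 + d * Real.log d) * Real.log (n * Q))) ∧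
          (storedWords r n m : ℝ) ≤ CS * (n * √(Q : ℝ) * Real.log (n * Q) ^ 3 / ε ^ 2)) ∧
        -- Gaussian JL
        ((∀ (x : Fin n → EuclideanSpace ℝ (Fin d)) (Θ : Type) [MeasurableSpace Θ]
              (ρ : MeasureTheory.Measure Θ) [MeasureTheory.IsProbabilityMeasure ρ]
              (adv : Θ → List (Query d n × ℝ) → Query d n),
              1 - ENNReal.ofReal ((((n : ℝ) * Q) ^ c)⁻¹)
                ≤ successProb (r := r) (gaussianJL d m) k Q ε lo hi x ρ adv) ∧
          QueryTimeLE (gaussianJL d m) r n k ε lo hi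
            (CT * (d * Real.log (n * Q) / ε ^ 2)) ∧
          (storedWords r n m : ℝ) ≤ CS * (n * √(Q : ℝ) * Real.log (n * Q) ^ 2 / ε ^ 2)) := by
  -- `5242880 = 1280 · 64²`: the failure probability of a sketch is at most `1280 / Cm = 64⁻²`, so
  -- that `64 p ≤ 1/64 ≤ e^(-4)`.
  set Cm : ℝ := 5242880 with hCm
  set Ck : ℝ := 16 * (b + c + 6) with hCk
  set Cr : ℝ := 6 * (Ck + 2) * (c + 4) with hCr
  have hCm0 : 0 < Cm := by norm_num [hCm]
  have hCk0 : 0 < Ck := by positivity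
  have hCr0 : 0 < Cr := by positivity
  have hb0 : (0 : ℝ) ≤ b := Nat.cast_nonneg b
  refine ⟨Cm, Ck, Cr, 20 * (Cm + 5) * (Ck + 2) + 2 * (4 * b + 22), 2 * ((Cr + 8) * (Cm + 1)),
    hCm0, hCk0, hCr0, by positivity, by positivity, ?_⟩
  intro n Q d ε lo hi hnQ hd hε hε1 hlo hle hrange m k r
  have hQ1 : 1 ≤ Q := Nat.pos_of_ne_zero fun h => by simp [h] at hnQ
  have hX2 : (2 : ℝ) ≤ (n : ℝ) * Q := by exact_mod_cast hnQ
  have hΛ := half_le_log_of_two_le hX2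
  have hm0 : 0 < m := (div_le_of_numRows hCm0 hε).1
  have hm : (m : ℝ) ≤ (Cm + 1) / ε ^ 2 := numRows_le hCm0 hε hε1
  have hk : (k : ℝ) ≤ (Ck + 2) * Real.log (n * Q) := (numSamples_bounds hCk0 hΛ).2
  obtain ⟨L, hL1, hL2⟩ := exists_sampler_depth hε hε1 hlo hle hX2 hrange
  have hS : (storedWords r n m : ℝ)
      ≤ (Cr + 8) * (Cm + 1) * (n * √(Q : ℝ) * Real.log (n * Q) ^ 2 / ε ^ 2) :=
    storedWords_le hCm0 hCr0 hε hε1 hQ1 hΛ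
  have hd1 : (1 : ℝ) ≤ d := by exact_mod_cast hd
  have hspace : 0 ≤ n * √(Q : ℝ) * Real.log (n * Q) ^ 2 / ε ^ 2 := by positivity
  refine ⟨fun hd2 => ⟨fun x Θ _ ρ _ adv => ?_, ?_, ?_⟩, fun x Θ _ ρ _ adv => ?_, ?_, ?_⟩
  · exact successProb_ge_of_params b c hCm hCk hCr hnQ hε hε1 hlo hle hrange
      (isGoodSketch_fastJL hm0 (by positivity)) x Θ ρ adv
  · exact queryTimeLE_fastJL r n k ε lo hi hL1 (fastJL_steps_le hCm0 hCk0 hε hd1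
      (half_le_log_of_two_le (by exact_mod_cast hd2)) hb0 (Nat.cast_nonneg _) (by linarith) hk hm
      hL2 (hadamard_steps_le hd2))
  · refine hS.trans ?_
    -- The construction meets the bound with `log²`; since `1 ≤ 2 log (nQ)`, the stated bound with
    -- `log³` follows.
    have : n * √(Q : ℝ) * Real.log (n * Q) ^ 2 / ε ^ 2
        ≤ 2 * (n * √(Q : ℝ) * Real.log (n * Q) ^ 3 / ε ^ 2) := by
      calc n * √(Q : ℝ) * Real.log (n * Q) ^ 2 / ε ^ 2
          ≤ n * √(Q : ℝ) * Real.log (n * Q) ^ 2 / ε ^ 2 * (2 * Real.log (n * Q)) :=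
            le_mul_of_one_le_right hspace (by linarith)
        _ = _ := by ring
    calc _ ≤ (Cr + 8) * (Cm + 1) * (2 * (n * √(Q : ℝ) * Real.log (n * Q) ^ 3 / ε ^ 2)) := by gcongr
      _ = _ := by ring
  · exact successProb_ge_of_params b c hCm hCk hCr hnQ hε hε1 hlo hle hrange
      (isGoodSketch_gaussianJL hm0 (by positivity)) x Θ ρ adv
  · exact queryTimeLE_gaussianJL r n k ε lo hi hL1 (gaussianJL_steps_le hCm0 hCk0 hε hε1 hd1
      hb0 (Nat.cast_nonneg _) (by linarith) hk hm hL2)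
  · refine hS.trans ?_
    have h0 : 0 ≤ (Cr + 8) * (Cm + 1) := by positivity
    nlinarith [mul_nonneg h0 hspace]
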